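/- Let $N\ge 2$, $0\le 2n\le N$, and let $b_i=2i+1$ if $N$ is even, $b_i=2i+2$ if $N$ is odd ($0\le i<\lfloor N/2\rfloor$). For $t=(t_1,t_2,\dots)\in\mathbb C^\infty$ define $\mathbf s_m(t)$ by $e^{\sum_{i\ge1}t_iz^i}=\sum_{m\ge0}\mathbf s_m(t)z^m$, $\mathbf s_m=0$ for $m<0$, put $\tilde{\mathbf s}_m(t)=\mathbf s_m(2t)$, and for $\lambda=(\lambda_1\ge\dots\ge\lambda_\ell\ge0)$ put $\mathbf s_\lambda(t)=\det(\mathbf s_{\lambda_i-i+j}(t))_{1\le i,j\le\ell}$. Let $\mathbb Y^{(2n)}_{n(N-2n)}$ be the set of partitions $\lambda_1\ge\dots\ge\lambda_{2n}\ge0$ of $n(N-2n)$ with $\lambda_i+\lambda_{2n+1-i}=N-2n$ for all $i$. Let $m_N(0)$ be the $N\times N$ skew-symmetric antidiagonal matrix whose antidiagonal, read from the upper right to the lower left corner, is $b_{\lfloor N/2\rfloor-1},\dots,b_0,-b_0,\dots,-b_{\lfloor N/2\rfloor-1}$ (with a further $0$ in the middle if $N$ is odd). Let $E_{\ell,N}(t)$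 be the first $\ell$ rows of $e^{\sum_{i\ge1}t_i\Lambda^i}$, where $\Lambda=(\delta_{i,j-1})_{1\le i,j\le N}$, and put $m_\ell(t)=E_{\ell,N}(t)\,m_N(0)\,E_{\ell,N}(t)^{\top}$ for $\ell\le N$ and $\tau_{2n}(t)=\operatorname{pf} m_{2n}(t)$. Then: 1. $m_N(0)=\big((j-i)\,\delta_{i+j,N-1}\big)_{0\le i,j\le N-1}$, i.e. its antidiagonal is $N-1,N-3,\dots,-(N-3),-(N-1)$; and for all $\ell\le N$, $m_\ell(t)=\big((j-i)\,\tilde{\mathbf s}_{N-i-j-1}(t)\big)_{0\le i,j\le \ell-1}$. 2. With $k_i=\lambda_i-i+2n$, $$\tau_{2n}(t)=\sum_{\lambda\in\mathbb Y^{(2n)}_{n(N-2n)}}\Big(\prod_{i=1}^n b_{k_i-\lfloor (N+1)/2\rfloor}\Big)\mathbf s_\lambda(t)=\sum_{\lambda\in\mathbb Y^{(2n)}_{n(N-2n)}}\prod_{i=1}^n(k_i-k_{2n+1-i})\;\mathbf s_\lambda(t)=\operatorname{pf}\big((j-i)\tilde{\mathbf s}_{N-i-j-1}(t)\big)_{0\le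 i,j\le 2n-1}.$$ 3. For every finite set of variables $x=(x_1,\dots,x_k)$, $$\tau_{2n}(t)\Big|_{t_i=\frac1i\sum_k x_k^i}=\prod_{i=1}^{n}(N+1-2i)\;\cdot J^{(1/2)}_{(N-2n)^n}(x).$$ Here $J^{(1/2)}_\lambda$ is the monic Jack symmetric function with parameter $\alpha=\tfrac12$: it equals $m_\lambda$ plus a combination of monomial symmetric functions $m_\mu$ with $\mu<\lambda$ in the dominance order, and it is orthogonal to all these $m_\mu$ (equivalently, to the Jack functions of all $\mu<\lambda$) for $\langle p_\lambda,p_\mu\rangle=\delta_{\lambda\mu}\prod_i i^{m_i}m_i!\;\alpha^{\ell(\lambda)}$, where $m_i$ is the multiplicity of $i$ in $\lambda$ and $\ell(\lambda)$ the number of parts. In particular it is the member with index $(N-2n)^n$ of any family $(J_\lambda)_\lambda$ of symmetric functions which are of the form $m_\lambda+\sum_{\mu<\lambda}a_{\lambda\mu}m_\mu$ and pairwise orthogonal. 4. If $\sum_i|t_i|r^i<\infty$ for some $r>0$, then $$\frac1{n!}\int_{\mathbb R^n}\Delta(z)^4\prod_{k=1}^n e^{2\sum_{i\ge1}t_iz_k^i}\,\delta^{(N-2)}(z_k)\,dz_k=\big((-1)^N(N-2)!\big)^n\,\tau_{2n}(t),$$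 where $\Delta(z)=\prod_{i<j}(z_j-z_i)$ and the integral is the iterated one, with $\int_{\mathbb R}\psi(u)\delta^{(m)}(u)\,du=(-1)^m\psi^{(m)}(0)$. -/

import Mathlib

namespace PfaffLattice

open Matrix Finset

noncomputable section

/-! ### Schur polynomials in the times `t = (t₁, t₂, …)` -/

/-- The formal power series `∑_{i ≥ 1} tᵢ zⁱ`. -/
def timeSeries (t : ℕ+ → ℂ) : PowerSeries ℂ :=
  PowerSeries.mk fun i => if h : 0 < i then t ⟨i, h⟩ else 0

/-- The elementary Schur polynomials `sₘ(t)`: the coefficients of `exp (∑_{i ≥ 1} tᵢ zⁱ)`, with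
`sₘ(t) = 0` for `m < 0`. -/
def elemSchur (t : ℕ+ → ℂ) (m : ℤ) : ℂ :=
  if 0 ≤ m then
    PowerSeries.coeff m.toNat
      ((PowerSeries.exp ℂ).subst (timeSeries t) : PowerSeries ℂ)
  else 0

/-- The Schur polynomial `s_lam(t) = det (s_{lamᵢ - i + j}(t))` of a partition `lam` written as a
vector with `ℓ` entries. -/
def schur {ℓ : ℕ} (lam : Fin ℓ → ℕ) (t : ℕ+ → ℂ) : ℂ :=
  (Matrix.of fun i j : Fin ℓ => elemSchur t ((lam i : ℤ) - (i : ℕ) + (j : ℕ))).det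

open Classical in
/-- The set `𝕐_k^{(ℓ)}` of self-dual partitions `lam₁ ≥ … ≥ lam_ℓ ≥ 0` of `k`, with
`lamᵢ + lam_{ℓ+1-i} = 2k/ℓ` for all `i`. -/
def selfDual (ℓ k : ℕ) : Finset (Fin ℓ → ℕ) :=
  (Fintype.piFinset fun _ : Fin ℓ => Finset.range (k + 1)).filter fun lam =>
    Antitone lam ∧ ∑ i, lam i = k ∧ ∀ i, ℓ * (lam i + lam i.rev) = 2 * k

/-- The strictly decreasing sequence `kᵢ = lamᵢ - i + ℓ`, `1 ≤ i ≤ ℓ` (the index `i : Fin ℓ` stands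
for the mathematical index `i + 1`). -/
def shiftedPart {ℓ : ℕ} (lam : Fin ℓ → ℕ) (i : Fin ℓ) : ℤ :=
  (lam i : ℤ) - ((i : ℕ) + 1) + ℓ

/-- The first half `1, …, n` of the indices `1, …, 2n`. -/
def firstHalf {n : ℕ} (i : Fin n) : Fin (2 * n) := Fin.castLE (by omega) i

/-! ### Pfaffians and the moment matrices -/

/-- The Pfaffian `(1 / (2ⁿ n!)) ∑_σ sgn σ ∏ᵢ A_{σ(2i-1), σ(2i)}` of a `2n × 2n` matrix. -/
def pfaffian {n : ℕ} (A : Matrix (Fin (2 * n)) (Fin (2 * n)) ℂ) : ℂ :=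
  ((2 : ℂ) ^ n * (n.factorial : ℂ))⁻¹ *
    ∑ σ : Equiv.Perm (Fin (2 * n)), ((Equiv.Perm.sign σ : ℤ) : ℂ) *
      ∏ i : Fin n, A (σ ⟨2 * (i : ℕ), by omega⟩) (σ ⟨2 * (i : ℕ) + 1, by omega⟩)

/-- The `N × N` shift matrix `Λ = (δ_{i, j-1})`. -/
def shift (N : ℕ) : Matrix (Fin N) (Fin N) ℂ :=
  Matrix.of fun i j => if (j : ℕ) = i + 1 then 1 else 0

/-- The `ℓ × N` matrix `E_{ℓ,N}(t)` formed by the first `ℓ` rows of `exp (∑_{i ≥ 1} tᵢ Λⁱ)`.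
As `Λ ^ N = 0`, only the terms with `1 ≤ i ≤ N` are written. -/
def evolution {ℓ N : ℕ} (h : ℓ ≤ N) (t : ℕ+ → ℂ) : Matrix (Fin ℓ) (Fin N) ℂ :=
  (IsNilpotent.exp (∑ i : Fin N, t (Nat.succPNat i) • shift N ^ ((i : ℕ) + 1))).submatrix
    (Fin.castLE h) id

/-- The skew-symmetric antidiagonal initial condition `m_N(0)`: its antidiagonal, from the upper
right corner to the lower left corner, is `b_{⌊N/2⌋-1}, …, b₀, -b₀, …, -b_{⌊N/2⌋-1}`, with an
additional central entry `0` between `b₀` and `-b₀` for odd `N`. -/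
def initialMoment (N : ℕ) (b : ℕ → ℂ) : Matrix (Fin N) (Fin N) ℂ :=
  Matrix.of fun i j =>
    if (i : ℕ) + j + 1 = N then
      if (i : ℕ) < j then b (N / 2 - 1 - i)
      else if (j : ℕ) < i then -b (N / 2 - 1 - j)
      else 0
    else 0

/-- `m_ℓ(t) = E_{ℓ,N}(t) m_N(0) E_{ℓ,N}(t)ᵀ`. -/
def moment {ℓ N : ℕ} (h : ℓ ≤ N) (b : ℕ → ℂ) (t : ℕ+ → ℂ) : Matrix (Fin ℓ) (Fin ℓ) ℂ :=
  evolution h t * initialMoment N b * (evolution h t)ᵀ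

/-- The Pfaff lattice tau function `τ_{2n}(t) = pf (E_{2n,N}(t) m_N(0) E_{2n,N}(t)ᵀ)`. -/
def tau {N n : ℕ} (h : 2 * n ≤ N) (b : ℕ → ℂ) (t : ℕ+ → ℂ) : ℂ :=
  pfaffian (moment h b t)

/-! ### Jack symmetric functions -/

/-- The ring of symmetric functions (in infinitely many variables) with rational coefficients, as
the polynomial ring `ℚ[p₁, p₂, …]` in the power sums. -/
abbrev SymmFun : Type := MvPolynomial ℕ+ ℚ

/-- The scalar product with `⟨p_lam, p_mu⟩ = δ_{lam mu} ∏ᵢ i^{mᵢ} mᵢ! · α^{number of parts of lam}`,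
where `mᵢ` is the multiplicity of `i` in `lam`. -/
def jackInner (α : ℚ) (f g : SymmFun) : ℚ :=
  ∑ m ∈ f.support, f.coeff m * g.coeff m *
    ∏ i ∈ m.support, (((i : ℕ) : ℚ) ^ m i * ((m i).factorial : ℚ) * α ^ m i)

/-- The dominance order on the partitions of `d`: every initial sum of (the decreasing
rearrangement of) `mu` is at most the corresponding one of `lam`. -/
def DominatedBy {d : ℕ} (mu lam : d.Partition) : Prop :=
  ∀ r : ℕ, ((mu.parts.sort (· ≥ ·)).take r).sum ≤ ((lam.parts.sort (· ≥ ·)).take r).sum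

/-- `f = ∑_mu a_mu m_mu` with `m_mu` the monomial symmetric functions: this is the identity of the
symmetric polynomials in `x₁, …, x_k`, for every number `k` of variables. -/
def HasMonomialExpansion {d : ℕ} (f : SymmFun) (a : d.Partition → ℚ) : Prop :=
  ∀ k : ℕ, MvPolynomial.aeval (fun i : ℕ+ => MvPolynomial.psum (Fin k) ℚ (i : ℕ)) f =
    ∑ mu : d.Partition, MvPolynomial.C (a mu) * MvPolynomial.msymm (Fin k) ℚ mu

/-- `f ∈ m_lam + span {m_mu : mu < lam}` for the dominance order. -/
def IsMonicTriangular {d : ℕ} (lam : d.Partition) (f : SymmFun) : Prop :=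
  ∃ a : d.Partition → ℚ, a lam = 1 ∧ (∀ mu, a mu ≠ 0 → DominatedBy mu lam) ∧
    HasMonomialExpansion f a

/-- A family of monic Jack symmetric functions for the parameter `α`: triangular for the dominance
order with leading coefficient `1`, and pairwise orthogonal (functions of different degree are
orthogonal by the definition of the scalar product). -/
def IsJackFamily (α : ℚ) (J : ∀ d : ℕ, d.Partition → SymmFun) : Prop :=
  (∀ (d : ℕ) (lam : d.Partition), IsMonicTriangular lam (J d lam)) ∧
    ∀ (d : ℕ) (lam mu : d.Partition), lam ≠ mu → jackInner α (J d lam) (J d mu) = 0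

/-- `f` is the monic Jack symmetric function of `lam` for the parameter `α`: `f` is `m_lam` plus
lower terms in the dominance order, and `f` is orthogonal to all the lower terms, i.e. to the span
of the `m_mu` (equivalently, of the Jack functions of `mu`) with `mu < lam`.  For `α > 0` there is
exactly one such `f`. -/
def IsJack (α : ℚ) {d : ℕ} (lam : d.Partition) (f : SymmFun) : Prop :=
  IsMonicTriangular lam f ∧
    ∀ (g : SymmFun) (a : d.Partition → ℚ),
      (∀ mu, a mu ≠ 0 → DominatedBy mu lam ∧ mu ≠ lam) → HasMonomialExpansion g a →
        jackInner α f g = 0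

/-- The value of a symmetric function at `(x₁, …, x_k)`. -/
def evalSymm {k : ℕ} (f : SymmFun) (x : Fin k → ℂ) : ℂ :=
  MvPolynomial.aeval (fun i : ℕ+ => ∑ j, x j ^ (i : ℕ)) f

/-- The rectangular partition `(s, …, s)` with `n` rows (the empty partition if `s = 0`). -/
def rectangle (n s : ℕ) : (n * s).Partition :=
  Nat.Partition.ofSums (n * s) (Multiset.replicate n s) (by simp)

/-! ### Integration against derivatives of the delta function -/

/-- The iterated integral `∫_{ℝⁿ} φ(z) ∏ₖ δ^{(m)}(zₖ) dzₖ`, where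
`∫_ℝ ψ(u) δ^{(m)}(u) du = (-1)ᵐ ψ^{(m)}(0)`. -/
def deltaIntegral (m : ℕ) : (n : ℕ) → ((Fin n → ℝ) → ℂ) → ℂ
  | 0, φ => φ Fin.elim0
  | n + 1, φ => (-1) ^ m *
      iteratedDeriv m (fun u : ℝ => deltaIntegral m n fun w => φ (Fin.cons u w)) 0

/-- The function `Δ(z)⁴ ∏ₖ exp (2 ∑_{i ≥ 1} tᵢ zₖⁱ)` with `Δ(z) = ∏_{i < j} (zⱼ - zᵢ)`. -/
def symplecticIntegrand (n : ℕ) (t : ℕ+ → ℂ) (z : Fin n → ℝ) : ℂ :=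
  (∏ i : Fin n, ∏ j ∈ Finset.Ioi i, ((z j : ℂ) - (z i : ℂ))) ^ 4 *
    ∏ k : Fin n, Complex.exp (2 * ∑' i : ℕ+, t i * (z k : ℂ) ^ (i : ℕ))

end

end PfaffLattice

open PfaffLattice

namespace PfaffLattice

open Matrix Finset
open scoped PowerSeries Topology

/-! ### Exponential power series, characterized by their differential equation -/

section ExpSolution

variable {R S : Type*} [CommRing R] [CommRing S]

/-- `F` solves `F' = P F`, `F(0) = 1`. -/
structure IsExpSolution (P F : R⟦X⟧) : Prop where
  deriv : PowerSeries.derivative R F = P * F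
  const : PowerSeries.constantCoeff F = 1

theorem IsExpSolution.mul {P Q F G : R⟦X⟧} (hF : IsExpSolution P F) (hG : IsExpSolution Q G) :
    IsExpSolution (P + Q) (F * G) where
  deriv := by
    rw [Derivation.leibniz, hF.deriv, hG.deriv, smul_eq_mul, smul_eq_mul]; ring
  const := by rw [map_mul, hF.const, hG.const, one_mul]

theorem isExpSolution_zero : IsExpSolution (0 : R⟦X⟧) 1 where
  deriv := by simp
  const := by simp

theorem IsExpSolution.coeff_zero {P F : R⟦X⟧} (hF : IsExpSolution P F) :
    PowerSeries.coeff 0 F = 1 := by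
  rw [PowerSeries.coeff_zero_eq_constantCoeff_apply, hF.const]

theorem IsExpSolution.coeff_succ {P F : R⟦X⟧} (hF : IsExpSolution P F) (n : ℕ) :
    ((n : R) + 1) * PowerSeries.coeff (n + 1) F =
      ∑ p ∈ antidiagonal n, PowerSeries.coeff p.1 P * PowerSeries.coeff p.2 F := by
  rw [← PowerSeries.coeff_mul, ← hF.deriv, PowerSeries.coeff_derivative, mul_comm]

theorem IsExpSolution.map {P F : R⟦X⟧} (hF : IsExpSolution P F) (f : R →+* S) :
    IsExpSolution (PowerSeries.map f P) (PowerSeries.map f F) where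
  deriv := by
    rw [← map_mul, ← hF.deriv]
    ext n
    simp [PowerSeries.coeff_derivative]
  const := by
    rw [← PowerSeries.coeff_zero_eq_constantCoeff_apply, PowerSeries.coeff_map, hF.coeff_zero,
      map_one]

theorem natCast_succ_mul_cancel [Algebra ℚ R] {n : ℕ} {a b : R}
    (h : ((n : R) + 1) * a = ((n : R) + 1) * b) : a = b := by
  have h1 : (algebraMap ℚ R ((n : ℚ) + 1)⁻¹) * ((n : R) + 1) = 1 := by
    have h2 : ((n : R) + 1) = algebraMap ℚ R ((n : ℚ) + 1) := by simp
    rw [h2, ← map_mul, inv_mul_cancel₀ (by positivity), map_one]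
  calc a = (algebraMap ℚ R ((n : ℚ) + 1)⁻¹) * (((n : R) + 1) * a) := by
        rw [← mul_assoc, h1, one_mul]
    _ = b := by rw [h, ← mul_assoc, h1, one_mul]

theorem IsExpSolution.unique [Algebra ℚ R] {P F G : R⟦X⟧} (hF : IsExpSolution P F)
    (hG : IsExpSolution P G) : F = G := by
  ext n
  induction n using Nat.strong_induction_on with
  | _ n ih =>
    cases n with
    | zero => rw [hF.coeff_zero, hG.coeff_zero]
    | succ n =>
      apply natCast_succ_mul_cancel (n := n)
      rw [hF.coeff_succ, hG.coeff_succ]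
      refine Finset.sum_congr rfl fun p hp => ?_
      rw [ih p.2 (by have := mem_antidiagonal.mp hp; omega)]

theorem isExpSolution_exp_subst [Algebra ℚ R] {T : R⟦X⟧} (hT : PowerSeries.constantCoeff T = 0) :
    IsExpSolution (PowerSeries.derivative R T) ((PowerSeries.exp R).subst T : R⟦X⟧) where
  deriv := by
    rw [PowerSeries.derivative_subst (PowerSeries.HasSubst.of_constantCoeff_zero' hT),
      PowerSeries.derivative_exp, mul_comm]
  const := by
    have h := PowerSeries.coeff_subst' (PowerSeries.HasSubst.of_constantCoeff_zero' hT)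
      (PowerSeries.exp R) 0
    rw [← PowerSeries.coeff_zero_eq_constantCoeff_apply, h, finsum_eq_single _ 0]
    · simp
    · intro n hn
      simp [hT, hn]

/-- The antiderivative of a power series with vanishing constant coefficient. -/
noncomputable def antideriv [Algebra ℚ R] (P : R⟦X⟧) : R⟦X⟧ :=
  PowerSeries.mk fun n => algebraMap ℚ R (n : ℚ)⁻¹ * PowerSeries.coeff (n - 1) P

theorem exists_isExpSolution [Algebra ℚ R] (P : R⟦X⟧) : ∃ F, IsExpSolution P F := by
  have h0 : PowerSeries.constantCoeff (antideriv P) = 0 := by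
    rw [← PowerSeries.coeff_zero_eq_constantCoeff_apply]; simp [antideriv]
  have h1 : PowerSeries.derivative R (antideriv P) = P := by
    ext n
    have h2 : ((n : R) + 1) = algebraMap ℚ R ((n : ℚ) + 1) := by simp
    rw [PowerSeries.coeff_derivative, antideriv, PowerSeries.coeff_mk, mul_right_comm, h2,
      ← map_mul, Nat.cast_succ, inv_mul_cancel₀ (by positivity), map_one, one_mul,
      Nat.add_sub_cancel]
  exact ⟨_, h1 ▸ isExpSolution_exp_subst h0⟩

/-- The solution of `F' = P F`, `F(0) = 1`. -/
noncomputable def expSolution [Algebra ℚ R] (P : R⟦X⟧) : R⟦X⟧ := (exists_isExpSolution P).choose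

theorem expSolution_spec [Algebra ℚ R] (P : R⟦X⟧) : IsExpSolution P (expSolution P) :=
  (exists_isExpSolution P).choose_spec

theorem isExpSolution_geom (x : R) :
    IsExpSolution (PowerSeries.mk fun i => x ^ (i + 1)) (PowerSeries.mk fun i => x ^ i) where
  deriv := by
    ext n
    rw [PowerSeries.coeff_derivative, PowerSeries.coeff_mul, PowerSeries.coeff_mk]
    have : ∀ p ∈ antidiagonal n, PowerSeries.coeff p.1 (PowerSeries.mk fun i => x ^ (i + 1)) *
        PowerSeries.coeff p.2 (PowerSeries.mk fun i => x ^ i) = x ^ (n + 1) := by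
      intro p hp
      rw [PowerSeries.coeff_mk, PowerSeries.coeff_mk, ← pow_add]
      congr 1
      have := mem_antidiagonal.mp hp
      omega
    rw [Finset.sum_congr rfl this]
    simp [mul_comm]
  const := by simp [← PowerSeries.coeff_zero_eq_constantCoeff_apply]

theorem one_sub_mul_geom (x : R) :
    (1 - PowerSeries.C x * PowerSeries.X) * (PowerSeries.mk fun i => x ^ i) = 1 := by
  ext n
  cases n with
  | zero => simp
  | succ n => simp [sub_mul, mul_assoc, PowerSeries.coeff_succ_X_mul, pow_succ',
      PowerSeries.coeff_one]

end ExpSolution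

/-! ### Coefficients with integer indices and Toeplitz matrices -/

section Toeplitz

variable {R S : Type*} [CommRing R] [CommRing S]

/-- The coefficient of `z ^ m`, extended by zero to negative `m`. -/
noncomputable def coeffZ (F : R⟦X⟧) (m : ℤ) : R := if 0 ≤ m then PowerSeries.coeff m.toNat F else 0

theorem coeffZ_natCast (F : R⟦X⟧) (m : ℕ) : coeffZ F m = PowerSeries.coeff m F := by
  simp [coeffZ]

theorem coeffZ_of_neg (F : R⟦X⟧) {m : ℤ} (hm : m < 0) : coeffZ F m = 0 := by
  simp [coeffZ, hm]

theorem coeffZ_one (m : ℤ) : coeffZ (1 : R⟦X⟧) m = if m = 0 then 1 else 0 := by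
  rcases lt_or_ge m 0 with h | h
  · rw [coeffZ_of_neg _ h, if_neg (by omega)]
  · lift m to ℕ using h
    simp [coeffZ_natCast, PowerSeries.coeff_one]

theorem coeffZ_map (f : R →+* S) (F : R⟦X⟧) (m : ℤ) :
    coeffZ (PowerSeries.map f F) m = f (coeffZ F m) := by
  unfold coeffZ
  split_ifs <;> simp

theorem coeffZ_X_mul_derivative (F : R⟦X⟧) (m : ℤ) :
    coeffZ (PowerSeries.X * PowerSeries.derivative R F) m = m * coeffZ F m := by
  rcases lt_or_ge m 0 with h | h
  · rw [coeffZ_of_neg _ h, coeffZ_of_neg _ h, mul_zero]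
  · lift m to ℕ using h
    rw [coeffZ_natCast, coeffZ_natCast]
    cases m with
    | zero => simp
    | succ n => simp [PowerSeries.coeff_succ_X_mul, PowerSeries.coeff_derivative, mul_comm]

theorem sum_coeffZ_mul {N : ℕ} (F G : R⟦X⟧) {i j : ℤ} (hi : 0 ≤ i) (hj : j < N) :
    ∑ l : Fin N, coeffZ F ((l : ℕ) - i) * coeffZ G (j - (l : ℕ)) = coeffZ (F * G) (j - i) := by
  rw [Fin.sum_univ_eq_sum_range (fun l => coeffZ F ((l : ℤ) - i) * coeffZ G (j - (l : ℤ))) N]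
  rcases lt_or_ge j i with h | h
  · rw [coeffZ_of_neg _ (by omega)]
    refine Finset.sum_eq_zero fun l _ => ?_
    rcases lt_or_ge (l : ℤ) i with h' | h'
    · rw [coeffZ_of_neg _ (by omega), zero_mul]
    · rw [coeffZ_of_neg G (by omega), mul_zero]
  · lift i to ℕ using hi
    lift j to ℕ using by omega
    obtain ⟨m, rfl⟩ : ∃ m, j = i + m := ⟨j - i, by omega⟩
    have h1 : ((i + m : ℕ) : ℤ) - (i : ℤ) = (m : ℕ) := by push_cast; ring
    rw [h1, coeffZ_natCast, PowerSeries.coeff_mul, Finset.Nat.sum_antidiagonal_eq_sum_range_succ_mk]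
    have h2 : (Finset.Ico i (i + m + 1)) ⊆ Finset.range N := by
      intro l hl
      simp only [Finset.mem_Ico, Finset.mem_range] at hl ⊢
      omega
    rw [← Finset.sum_subset h2, Finset.sum_Ico_eq_sum_range]
    · rw [show i + m + 1 - i = m.succ by omega]
      refine Finset.sum_congr rfl fun k hk => ?_
      have hk := Finset.mem_range.mp hk
      rw [show (((i + k : ℕ) : ℤ) - (i : ℤ)) = (k : ℕ) by push_cast; ring,
        show (((i + m : ℕ) : ℤ) - ((i + k : ℕ) : ℤ)) = ((m - k : ℕ) : ℤ) by omega,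
        coeffZ_natCast, coeffZ_natCast]
    · intro l _ hl'
      simp only [Finset.mem_Ico, not_and_or, not_le, not_lt] at hl'
      rcases hl' with h' | h'
      · rw [coeffZ_of_neg _ (by omega), zero_mul]
      · rw [coeffZ_of_neg G (by omega), mul_zero]

/-- The ring homomorphism sending `F` to the upper triangular Toeplitz matrix `F(Λ)`. -/
noncomputable def toeplitz (N : ℕ) : R⟦X⟧ →+* Matrix (Fin N) (Fin N) R where
  toFun F := Matrix.of fun i j => coeffZ F ((j : ℕ) - (i : ℕ))
  map_one' := by
    ext i j
    simp [coeffZ_one, Matrix.one_apply, sub_eq_zero, Fin.ext_iff, eq_comm]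
  map_mul' F G := by
    ext i j
    rw [Matrix.mul_apply]
    exact (sum_coeffZ_mul F G (by omega) (by have := j.2; omega)).symm
  map_zero' := by ext i j; simp [coeffZ]
  map_add' F G := by
    ext i j
    simp only [coeffZ, Matrix.of_apply, Matrix.add_apply]
    split_ifs <;> simp

theorem toeplitz_apply {N : ℕ} (F : R⟦X⟧) (i j : Fin N) :
    toeplitz N F i j = coeffZ F ((j : ℕ) - (i : ℕ)) := rfl

theorem coeff_pow_eq_zero {T : R⟦X⟧} (hT : PowerSeries.constantCoeff T = 0) {m k : ℕ}
    (h : m < k) : PowerSeries.coeff m (T ^ k) = 0 := by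
  apply PowerSeries.coeff_of_lt_order
  refine lt_of_lt_of_le (by exact_mod_cast h : (m : ℕ∞) < k) ?_
  exact PowerSeries.le_order_pow_of_constantCoeff_eq_zero k hT

theorem toeplitz_pow_eq_zero {T : R⟦X⟧} (hT : PowerSeries.constantCoeff T = 0) (N : ℕ) :
    toeplitz N T ^ N = 0 := by
  rw [← map_pow]
  ext i j
  rw [toeplitz_apply, Matrix.zero_apply, coeffZ]
  split_ifs with h
  · exact coeff_pow_eq_zero hT (by have := j.2; omega)
  · rfl

theorem exp_toeplitz [Algebra ℚ R] {T : R⟦X⟧} (hT : PowerSeries.constantCoeff T = 0) (N : ℕ) :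
    IsNilpotent.exp (toeplitz N T) = toeplitz N ((PowerSeries.exp R).subst T : R⟦X⟧) := by
  rw [IsNilpotent.exp_eq_sum (toeplitz_pow_eq_zero hT N)]
  ext i j
  rw [Matrix.sum_apply, toeplitz_apply]
  rcases lt_or_ge ((j : ℕ) : ℤ) (i : ℕ) with h | h
  · rw [coeffZ_of_neg _ (by omega)]
    refine Finset.sum_eq_zero fun k _ => ?_
    rw [← map_pow, Matrix.smul_apply, toeplitz_apply, coeffZ_of_neg _ (by omega), smul_zero]
  · obtain ⟨m, hm⟩ : ∃ m : ℕ, ((j : ℕ) : ℤ) - (i : ℕ) = m := ⟨j - i, by omega⟩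
    rw [hm, coeffZ_natCast, PowerSeries.coeff_subst'
      (PowerSeries.HasSubst.of_constantCoeff_zero' hT),
      finsum_eq_sum_of_support_subset (s := Finset.range N)]
    · refine Finset.sum_congr rfl fun k _ => ?_
      rw [← map_pow, Matrix.smul_apply, toeplitz_apply, hm, coeffZ_natCast, PowerSeries.coeff_exp,
        algebraMap_smul, one_div]
    · intro k hk
      by_contra hk'
      refine hk ?_
      simp only [Finset.coe_range, Set.mem_Iio, not_lt] at hk'
      simp only
      rw [coeff_pow_eq_zero hT (by have := j.2; omega), smul_zero]

end Toeplitz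

/-! ### The moment matrices -/

theorem constantCoeff_timeSeries (t : ℕ+ → ℂ) :
    PowerSeries.constantCoeff (timeSeries t) = 0 := by
  rw [← PowerSeries.coeff_zero_eq_constantCoeff_apply, timeSeries, PowerSeries.coeff_mk]; simp

/-- The power series `exp (∑ tᵢ zⁱ)`. -/
noncomputable def timeExp (t : ℕ+ → ℂ) : PowerSeries ℂ := (PowerSeries.exp ℂ).subst (timeSeries t)

theorem timeExp_spec (t : ℕ+ → ℂ) :
    IsExpSolution (PowerSeries.derivative ℂ (timeSeries t)) (timeExp t) :=
  isExpSolution_exp_subst (constantCoeff_timeSeries t)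

theorem elemSchur_eq (t : ℕ+ → ℂ) (m : ℤ) : elemSchur t m = coeffZ (timeExp t) m := rfl

theorem timeExp_two_mul (t : ℕ+ → ℂ) : timeExp (fun r => 2 * t r) = timeExp t * timeExp t := by
  refine (timeExp_spec _).unique (R := ℂ) ?_
  convert (timeExp_spec t).mul (timeExp_spec t) using 1
  ext n
  simp [PowerSeries.coeff_derivative, timeSeries]
  ring

theorem shift_pow_apply {N : ℕ} (k : ℕ) (i j : Fin N) :
    (shift N ^ k) i j = if (j : ℕ) = i + k then 1 else 0 := by
  have h : shift N = toeplitz N (PowerSeries.X : PowerSeries ℂ) := by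
    ext i j
    rw [toeplitz_apply, shift, Matrix.of_apply, coeffZ]
    split_ifs with h1 h2 h3
    · rw [h1, PowerSeries.coeff_X, if_pos (by omega)]
    · omega
    · rw [PowerSeries.coeff_X, if_neg (by omega)]
    · rfl
  rw [h, ← map_pow, toeplitz_apply, coeffZ]
  split_ifs with h1 h2 h3
  · rw [PowerSeries.coeff_X_pow, if_pos (by omega)]
  · rw [PowerSeries.coeff_X_pow, if_neg (by omega)]
  · omega
  · rfl

theorem sum_smul_shift_pow (N : ℕ) (t : ℕ+ → ℂ) :
    ∑ i : Fin N, t (Nat.succPNat i) • shift N ^ ((i : ℕ) + 1) = toeplitz N (timeSeries t) := by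
  ext i j
  rw [Matrix.sum_apply, toeplitz_apply]
  simp only [Matrix.smul_apply, shift_pow_apply, smul_eq_mul, mul_ite, mul_one, mul_zero]
  rw [coeffZ]
  split_ifs with h
  · rw [timeSeries, PowerSeries.coeff_mk]
    split_ifs with h1
    · rw [Finset.sum_eq_single (⟨(j : ℕ) - i - 1, by have := j.2; omega⟩ : Fin N)]
      · rw [if_pos (by simp only; omega)]
        congr 1
        apply PNat.eq
        simp only [Nat.succPNat_coe, PNat.mk_coe]
        omega
      · intro k _ hk
        rw [if_neg]
        contrapose! hk
        ext
        simp only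
        omega
      · simp
    · exact Finset.sum_eq_zero fun k _ => if_neg (by omega)
  · exact Finset.sum_eq_zero fun k _ => if_neg (by omega)

theorem evolution_apply {ℓ N : ℕ} (h : ℓ ≤ N) (t : ℕ+ → ℂ) (i : Fin ℓ) (j : Fin N) :
    evolution h t i j = coeffZ (timeExp t) ((j : ℕ) - (i : ℕ)) := by
  rw [evolution, sum_smul_shift_pow, exp_toeplitz (constantCoeff_timeSeries t)]
  rfl

theorem initialMoment_apply {N : ℕ} (b : ℕ → ℂ)
    (hb : ∀ i, i < N / 2 → b i = if Even N then 2 * (i : ℂ) + 1 else 2 * (i : ℂ) + 2)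
    (i j : Fin N) : initialMoment N b i j =
      if (i : ℕ) + j + 1 = N then ((j : ℕ) : ℂ) - ((i : ℕ) : ℂ) else 0 := by
  have key : ∀ i j : ℕ, i + j + 1 = N → i < j → b (N / 2 - 1 - i) = (j : ℂ) - i := by
    intro i j h1 h2
    rw [hb _ (by omega)]
    obtain ⟨m, hm⟩ : ∃ m, N / 2 = m + 1 + i := ⟨N / 2 - 1 - i, by omega⟩
    rw [show N / 2 - 1 - i = m by omega]
    split_ifs with h3
    · have := Nat.even_iff.mp h3
      have h4 : j = i + 2 * m + 1 := by omega
      rw [h4]; push_cast; ring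
    · have := Nat.not_even_iff.mp h3
      have h4 : j = i + 2 * m + 2 := by omega
      rw [h4]; push_cast; ring
  rw [initialMoment, Matrix.of_apply]
  split_ifs with h1 h2 h3
  · exact key i j h1 h2
  · rw [key j i (by omega) h3]; ring
  · have : (i : ℕ) = j := by omega
    rw [this, sub_self]
  · rfl

/-- The sum over the antidiagonal that gives the entries of the moment matrix. -/
theorem sum_antidiagonal_coeffZ {R : Type*} [CommRing R] {N : ℕ} (F : R⟦X⟧) (i j : ℕ) :
    ∑ a : Fin N, coeffZ F ((a : ℕ) - i) * (((a.rev : ℕ) : R) - ((a : ℕ) : R)) *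
        coeffZ F ((a.rev : ℕ) - j) =
      ((j : R) - i) * coeffZ (F * F) ((N : ℤ) - i - j - 1) := by
  have hrev : ∀ a : Fin N, ((a.rev : ℕ) : ℤ) = N - 1 - (a : ℕ) := by
    intro a; rw [Fin.val_rev]; have := a.2; omega
  set G := PowerSeries.X * PowerSeries.derivative R F with hG
  have h0 := sum_coeffZ_mul (N := N) F F (i := i) (j := (N : ℤ) - 1 - j) (by omega) (by omega)
  have h1 := sum_coeffZ_mul (N := N) F G (i := i) (j := (N : ℤ) - 1 - j) (by omega) (by omega)
  have h2 := sum_coeffZ_mul (N := N) G F (i := i) (j := (N : ℤ) - 1 - j) (by omega) (by omega)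
  rw [show (N : ℤ) - i - j - 1 = (N : ℤ) - 1 - j - i by ring]
  have h3 : ∑ a : Fin N, coeffZ F ((a : ℕ) - i) * (((a.rev : ℕ) : R) - ((a : ℕ) : R)) *
        coeffZ F ((a.rev : ℕ) - j) =
      ((j : R) - i) * (∑ l : Fin N, coeffZ F ((l : ℕ) - i) * coeffZ F ((N : ℤ) - 1 - j - (l : ℕ)))
      + (∑ l : Fin N, coeffZ F ((l : ℕ) - i) * coeffZ G ((N : ℤ) - 1 - j - (l : ℕ)))
      - ∑ l : Fin N, coeffZ G ((l : ℕ) - i) * coeffZ F ((N : ℤ) - 1 - j - (l : ℕ)) := by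
    rw [Finset.mul_sum, ← Finset.sum_add_distrib, ← Finset.sum_sub_distrib]
    refine Finset.sum_congr rfl fun a _ => ?_
    have h4 : ((a.rev : ℕ) : R) = (((a.rev : ℕ) : ℤ) : R) := by push_cast; rfl
    rw [hG, coeffZ_X_mul_derivative, coeffZ_X_mul_derivative, h4, hrev,
      show (N : ℤ) - 1 - (a : ℕ) - j = (N : ℤ) - 1 - j - (a : ℕ) by ring]
    push_cast
    ring
  rw [h3, h0, h1, h2, mul_comm G F]
  ring

theorem moment_eq {ℓ N : ℕ} (hℓ : ℓ ≤ N) (b : ℕ → ℂ)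
    (hb : ∀ i, i < N / 2 → b i = if Even N then 2 * (i : ℂ) + 1 else 2 * (i : ℂ) + 2)
    (t : ℕ+ → ℂ) : moment hℓ b t =
      Matrix.of fun i j : Fin ℓ => (((j : ℕ) : ℂ) - ((i : ℕ) : ℂ)) *
        elemSchur (fun r => 2 * t r) ((N : ℤ) - (i : ℕ) - (j : ℕ) - 1) := by
  ext i j
  rw [Matrix.of_apply, elemSchur_eq, timeExp_two_mul, ← sum_antidiagonal_coeffZ, moment,
    Matrix.mul_apply]
  rw [← (Equiv.sum_comp Fin.revPerm _)]
  refine Finset.sum_congr rfl fun a _ => ?_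
  rw [Matrix.mul_apply, Finset.sum_eq_single a]
  · rw [initialMoment_apply b hb, Matrix.transpose_apply, evolution_apply, evolution_apply,
      Fin.revPerm_apply, if_pos (by rw [Fin.val_rev]; have := a.2; omega)]
  · intro c _ hc
    rw [initialMoment_apply b hb, if_neg, mul_zero]
    contrapose! hc
    rw [Fin.revPerm_apply, Fin.val_rev] at hc
    ext
    have := a.2
    omega
  · simp

/-! ### Sums of Pfaffian type -/

section Pfaffian

variable {R : Type*} [CommRing R] {n N : ℕ}

/-- The index `2i`. -/
def evenIdx (i : Fin n) : Fin (2 * n) := ⟨2 * (i : ℕ), by omega⟩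

/-- The index `2i + 1`. -/
def oddIdx (i : Fin n) : Fin (2 * n) := ⟨2 * (i : ℕ) + 1, by omega⟩

theorem evenIdx_ne_oddIdx (i j : Fin n) : evenIdx i ≠ oddIdx j := by
  intro h
  have := congrArg Fin.val h
  simp only [evenIdx, oddIdx] at this
  omega

theorem evenIdx_injective : Function.Injective (evenIdx (n := n)) := by
  intro i j h
  have := congrArg Fin.val h
  simp only [evenIdx] at this
  ext; omega

theorem oddIdx_injective : Function.Injective (oddIdx (n := n)) := by
  intro i j h
  have := congrArg Fin.val h
  simp only [oddIdx] at this
  ext; omega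

/-- Indices of `2n` objects as `n` pairs. -/
def pairEquiv (n : ℕ) : Fin n × Fin 2 ≃ Fin (2 * n) where
  toFun p := ⟨2 * (p.1 : ℕ) + (p.2 : ℕ), by omega⟩
  invFun j := (⟨(j : ℕ) / 2, by omega⟩, ⟨(j : ℕ) % 2, by omega⟩)
  left_inv p := by
    ext
    · simp only; omega
    · simp only; omega
  right_inv j := by ext; simp only; omega

theorem pairEquiv_zero (i : Fin n) : pairEquiv n (i, 0) = evenIdx i := rfl

theorem pairEquiv_one (i : Fin n) : pairEquiv n (i, 1) = oddIdx i := rfl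

theorem forall_pairs {P : Fin (2 * n) → Prop} (h0 : ∀ i, P (evenIdx i)) (h1 : ∀ i, P (oddIdx i))
    (j : Fin (2 * n)) : P j := by
  obtain ⟨⟨i, e⟩, rfl⟩ := (pairEquiv n).surjective j
  fin_cases e
  · exact h0 i
  · exact h1 i

@[to_additive]
theorem prod_pairs {M : Type*} [CommMonoid M] (f : Fin (2 * n) → M) :
    ∏ j, f j = ∏ i : Fin n, f (evenIdx i) * f (oddIdx i) := by
  rw [← (pairEquiv n).prod_comp, Fintype.prod_prod_type]
  refine Finset.prod_congr rfl fun i _ => ?_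
  rw [Fin.prod_univ_two, pairEquiv_zero, pairEquiv_one]

/-- The sum `∑_σ sgn σ ∏ᵢ Cᵢ(σ(2i), σ(2i+1))`. -/
def pfMulti (C : Fin n → Matrix (Fin (2 * n)) (Fin (2 * n)) R) : R :=
  ∑ σ : Equiv.Perm (Fin (2 * n)), ((Equiv.Perm.sign σ : ℤ) : R) *
    ∏ i, C i (σ (evenIdx i)) (σ (oddIdx i))

/-- The Pfaffian without its normalization, `∑_σ sgn σ ∏ᵢ A(σ(2i), σ(2i+1))`. -/
def pfSum (A : Matrix (Fin (2 * n)) (Fin (2 * n)) R) : R := pfMulti fun _ => A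

theorem pfaffian_eq (A : Matrix (Fin (2 * n)) (Fin (2 * n)) ℂ) :
    pfaffian A = ((2 : ℂ) ^ n * (n.factorial : ℂ))⁻¹ * pfSum A := rfl

theorem pfMulti_update_transpose (C : Fin n → Matrix (Fin (2 * n)) (Fin (2 * n)) R) (i₀ : Fin n)
    (B : Matrix (Fin (2 * n)) (Fin (2 * n)) R) :
    pfMulti (Function.update C i₀ Bᵀ) = -pfMulti (Function.update C i₀ B) := by
  rw [pfMulti, pfMulti, ← Equiv.sum_comp (Equiv.mulRight (Equiv.swap (evenIdx i₀) (oddIdx i₀))),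
    ← Finset.sum_neg_distrib]
  refine Finset.sum_congr rfl fun σ _ => ?_
  rw [Equiv.coe_mulRight, Equiv.Perm.sign_mul, Equiv.Perm.sign_swap (evenIdx_ne_oddIdx _ _)]
  have : ∏ i, Function.update C i₀ Bᵀ i ((σ * Equiv.swap (evenIdx i₀) (oddIdx i₀)) (evenIdx i))
      ((σ * Equiv.swap (evenIdx i₀) (oddIdx i₀)) (oddIdx i)) =
      ∏ i, Function.update C i₀ B i (σ (evenIdx i)) (σ (oddIdx i)) := by
    refine Finset.prod_congr rfl fun i _ => ?_
    rw [Equiv.Perm.mul_apply, Equiv.Perm.mul_apply]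
    by_cases h : i = i₀
    · subst h
      rw [Equiv.swap_apply_left, Equiv.swap_apply_right, Function.update_self,
        Function.update_self, Matrix.transpose_apply]
    · rw [Function.update_of_ne h, Function.update_of_ne h,
        Equiv.swap_apply_of_ne_of_ne (fun h' => h (evenIdx_injective h'))
          (evenIdx_ne_oddIdx _ _),
        Equiv.swap_apply_of_ne_of_ne (evenIdx_ne_oddIdx _ _).symm
          (fun h' => h (oddIdx_injective h'))]
  rw [this]
  simp

theorem pfMulti_update_sub (C : Fin n → Matrix (Fin (2 * n)) (Fin (2 * n)) R) (i₀ : Fin n)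
    (A B : Matrix (Fin (2 * n)) (Fin (2 * n)) R) :
    pfMulti (Function.update C i₀ (A - B)) =
      pfMulti (Function.update C i₀ A) - pfMulti (Function.update C i₀ B) := by
  rw [pfMulti, pfMulti, pfMulti, ← Finset.sum_sub_distrib]
  refine Finset.sum_congr rfl fun σ _ => ?_
  rw [← mul_sub]
  congr 1
  have key : ∀ D : Matrix (Fin (2 * n)) (Fin (2 * n)) R,
      ∏ i, Function.update C i₀ D i (σ (evenIdx i)) (σ (oddIdx i)) =
        D (σ (evenIdx i₀)) (σ (oddIdx i₀)) *
          ∏ i ∈ univ.erase i₀, C i (σ (evenIdx i)) (σ (oddIdx i)) := by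
    intro D
    rw [← Finset.mul_prod_erase _ _ (mem_univ i₀), Function.update_self]
    congr 1
    refine Finset.prod_congr rfl fun i hi => ?_
    rw [Function.update_of_ne (Finset.ne_of_mem_erase hi)]
  rw [key, key, key, Matrix.sub_apply, sub_mul]

theorem pfSum_sub_transpose (B : Matrix (Fin (2 * n)) (Fin (2 * n)) R) :
    pfSum (B - Bᵀ) = 2 ^ n * pfSum B := by
  have key : ∀ s : Finset (Fin n), pfSum (B - Bᵀ) =
      2 ^ s.card * pfMulti (fun i => if i ∈ s then B else B - Bᵀ) := by
    intro s
    induction s using Finset.induction_on with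
    | empty => simp [pfSum]
    | insert i₀ s hi₀ ih =>
      rw [ih, Finset.card_insert_of_notMem hi₀]
      set C : Fin n → Matrix (Fin (2 * n)) (Fin (2 * n)) R := fun i => if i ∈ s then B else B - Bᵀ
      have h1 : C = Function.update C i₀ (B - Bᵀ) := by
        rw [eq_comm, Function.update_eq_self_iff]
        simp [C, hi₀]
      have h2 : (fun i => if i ∈ insert i₀ s then B else B - Bᵀ) = Function.update C i₀ B := by
        funext i
        by_cases h : i = i₀
        · subst h; simp
        · simp [h, C]
      rw [h2]
      conv_lhs => rw [h1]
      rw [pfMulti_update_sub, pfMulti_update_transpose]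
      ring
  rw [key univ]
  simp [pfSum]

/-- The map `2i ↦ g(i)`, `2i + 1 ↦ N - 1 - g(i)`. -/
def pairFun (g : Fin n → Fin N) (j : Fin (2 * n)) : Fin N :=
  if ((pairEquiv n).symm j).2 = 0 then g ((pairEquiv n).symm j).1
  else (g ((pairEquiv n).symm j).1).rev

theorem pairFun_even (g : Fin n → Fin N) (i : Fin n) : pairFun g (evenIdx i) = g i := by
  rw [pairFun, ← pairEquiv_zero, Equiv.symm_apply_apply, if_pos rfl]

theorem pairFun_odd (g : Fin n → Fin N) (i : Fin n) : pairFun g (oddIdx i) = (g i).rev := by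
  rw [pairFun, ← pairEquiv_one, Equiv.symm_apply_apply, if_neg (by simp)]

theorem pfSum_eq_sum_det (E : Matrix (Fin (2 * n)) (Fin N) R) (c : Fin N → R) :
    pfSum (Matrix.of fun i j => ∑ a, E i a * c a * E j a.rev) =
      ∑ g : Fin n → Fin N, (∏ i, c (g i)) * (Matrix.of fun i j => E i (pairFun g j)).det := by
  rw [pfSum, pfMulti]
  simp only [Matrix.of_apply, Finset.prod_univ_sum, Fintype.piFinset_univ, Finset.mul_sum,
    Matrix.det_apply']
  rw [Finset.sum_comm]
  refine Finset.sum_congr rfl fun g _ => Finset.sum_congr rfl fun σ _ => ?_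
  rw [prod_pairs, mul_left_comm, ← Finset.prod_mul_distrib]
  congr 1
  refine Finset.prod_congr rfl fun i _ => ?_
  rw [pairFun_even, pairFun_odd]
  ring

/-- The permutation `2i ↦ i`, `2i + 1 ↦ 2n - 1 - i`. -/
def unpair (n : ℕ) : Equiv.Perm (Fin (2 * n)) where
  toFun j := if (j : ℕ) % 2 = 0 then ⟨(j : ℕ) / 2, by omega⟩ else ⟨2 * n - 1 - (j : ℕ) / 2, by omega⟩
  invFun j := if h : (j : ℕ) < n then ⟨2 * (j : ℕ), by omega⟩
    else ⟨2 * (2 * n - 1 - (j : ℕ)) + 1, by omega⟩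
  left_inv j := by
    ext
    by_cases h : (j : ℕ) % 2 = 0
    · simp only [h, if_true]
      rw [dif_pos (by omega)]
      simp only
      omega
    · simp only [h, if_false]
      rw [dif_neg (by omega)]
      simp only
      omega
  right_inv j := by
    ext
    by_cases h : (j : ℕ) < n
    · simp [h]
    · simp only [h, dite_false]
      rw [if_neg (by omega)]
      simp only
      omega

theorem unpair_even (i : Fin n) : unpair n (evenIdx i) = ⟨i, by omega⟩ := by
  ext
  simp [unpair, evenIdx]

theorem unpair_odd (i : Fin n) : unpair n (oddIdx i) = (⟨i, by omega⟩ : Fin (2 * n)).rev := by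
  ext
  rw [Fin.val_rev]
  simp only [unpair, oddIdx, Equiv.coe_fn_mk]
  rw [if_neg (by omega)]
  simp only
  omega

theorem sign_unpair (n : ℕ) : Equiv.Perm.sign (unpair n) = 1 := by
  rw [Equiv.Perm.sign_eq_prod_prod_Iio, prod_pairs]
  refine Finset.prod_eq_one fun b _ => ?_
  have h1 : Finset.Iio (oddIdx b) = insert (evenIdx b) (Finset.Iio (evenIdx b)) := by
    ext j
    simp only [Finset.mem_Iio, Finset.mem_insert, Fin.lt_def, Fin.ext_iff, evenIdx, oddIdx]
    omega
  rw [h1, Finset.prod_insert (by simp), unpair_odd, unpair_even,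
    if_pos (by rw [Fin.lt_def, Fin.val_rev]; simp only; omega), one_mul]
  rw [← Finset.prod_mul_distrib]
  refine Finset.prod_eq_one fun j hj => ?_
  have h2 : (unpair n j < (⟨b, by omega⟩ : Fin (2 * n))) ↔
      unpair n j < (⟨b, by omega⟩ : Fin (2 * n)).rev := by
    revert hj
    refine forall_pairs (P := fun j => j ∈ Finset.Iio (evenIdx b) →
      ((unpair n j < (⟨b, by omega⟩ : Fin (2 * n))) ↔
      unpair n j < (⟨b, by omega⟩ : Fin (2 * n)).rev)) ?_ ?_ j
    · intro a ha
      rw [unpair_even]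
      simp only [Finset.mem_Iio, Fin.lt_def, evenIdx, Fin.val_rev] at ha ⊢
      omega
    · intro a ha
      rw [unpair_odd]
      simp only [Finset.mem_Iio, Fin.lt_def, evenIdx, oddIdx, Fin.val_rev] at ha ⊢
      omega
  by_cases h : unpair n j < (⟨b, by omega⟩ : Fin (2 * n))
  · rw [if_pos h, if_pos (h2.mp h), one_mul]
  · rw [if_neg h, if_neg (fun h' => h (h2.mpr h'))]; simp

/-- The map `i ↦ g(i)`, `2n - 1 - i ↦ N - 1 - g(i)` for `i < n`. -/
def symmFun (g : Fin n → Fin N) (j : Fin (2 * n)) : Fin N :=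
  pairFun g ((unpair n).symm j)

theorem symmFun_left (g : Fin n → Fin N) (i : Fin n) : symmFun g ⟨i, by omega⟩ = g i := by
  rw [symmFun, ← unpair_even, Equiv.symm_apply_apply, pairFun_even]

theorem symmFun_right (g : Fin n → Fin N) (i : Fin n) :
    symmFun g (⟨i, by omega⟩ : Fin (2 * n)).rev = (g i).rev := by
  rw [symmFun, ← unpair_odd, Equiv.symm_apply_apply, pairFun_odd]

theorem det_symmFun (E : Matrix (Fin (2 * n)) (Fin N) R) (g : Fin n → Fin N) :
    (Matrix.of fun i j => E i (symmFun g j)).det = (Matrix.of fun i j => E i (pairFun g j)).det := by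
  have := Matrix.det_permute' (unpair n) (Matrix.of fun i j => E i (symmFun g j))
  rw [sign_unpair] at this
  simp only [Units.val_one, Int.cast_one, one_mul] at this
  rw [← this]
  congr 1
  ext i j
  simp [symmFun]

theorem sum_eq_factorial_mul_sum_strictMono (Φ : (Fin n → Fin N) → R)
    (h1 : ∀ g (π : Equiv.Perm (Fin n)), Φ (g ∘ π) = Φ g)
    (h2 : ∀ g, ¬Function.Injective g → Φ g = 0) :
    ∑ g, Φ g = n.factorial * ∑ g with StrictMono g, Φ g := by
  classical
  have h3 : ∑ g, Φ g = ∑ g with Function.Injective g, Φ g := by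
    rw [Finset.sum_filter]
    refine Finset.sum_congr rfl fun g _ => ?_
    split_ifs with h
    · rfl
    · exact h2 g h
  have h4 : (n.factorial : R) * ∑ g with StrictMono g, Φ g =
      ∑ x ∈ (univ.filter fun g : Fin n → Fin N => StrictMono g) ×ˢ
        (univ : Finset (Equiv.Perm (Fin n))), Φ (x.1 ∘ x.2) := by
    rw [Finset.sum_product, Finset.mul_sum]
    refine Finset.sum_congr rfl fun g _ => ?_
    simp only [h1]
    rw [Finset.sum_const, Finset.card_univ, Fintype.card_perm, Fintype.card_fin, nsmul_eq_mul]
  rw [h3, h4, eq_comm]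
  refine Finset.sum_bij (fun x _ => x.1 ∘ x.2) ?_ ?_ ?_ ?_
  · intro x hx
    simp only [Finset.mem_product, Finset.mem_filter, Finset.mem_univ, true_and, and_true] at hx ⊢
    exact hx.injective.comp x.2.injective
  · rintro ⟨g, π⟩ hx ⟨g', π'⟩ hx' h
    simp only [Finset.mem_product, Finset.mem_filter, Finset.mem_univ, true_and, and_true] at hx hx' h
    have h5 : Set.range g = Set.range g' := by
      rw [← π.surjective.range_comp g, h, π'.surjective.range_comp]
    have h6 : g = g' := (hx.range_inj hx').mp h5
    subst h6
    have h7 : π = π' := by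
      ext i
      rw [hx.injective (congrFun h i)]
    rw [h7]
  · intro g hg
    simp only [Finset.mem_filter, Finset.mem_univ, true_and] at hg
    refine ⟨(g ∘ Tuple.sort g, (Tuple.sort g)⁻¹), ?_, ?_⟩
    · simp only [Finset.mem_product, Finset.mem_filter, Finset.mem_univ, true_and, and_true]
      exact (Tuple.monotone_sort g).strictMono_of_injective (hg.comp (Tuple.sort g).injective)
    · funext i
      simp
  · intro x _
    rfl

/-- The permutation of `2n` objects induced by a permutation of `n` pairs. -/
def pairPerm (π : Equiv.Perm (Fin n)) : Equiv.Perm (Fin (2 * n)) :=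
  (pairEquiv n).permCongr (Equiv.prodCongrLeft fun _ => π)

theorem sign_pairPerm (π : Equiv.Perm (Fin n)) : Equiv.Perm.sign (pairPerm π) = 1 := by
  rw [pairPerm, Equiv.Perm.sign_permCongr, Equiv.Perm.sign_prodCongrLeft, Fin.prod_univ_two]
  simp

theorem pairFun_comp (g : Fin n → Fin N) (π : Equiv.Perm (Fin n)) (j : Fin (2 * n)) :
    pairFun (g ∘ π) j = pairFun g (pairPerm π j) := by
  refine forall_pairs (P := fun j => pairFun (g ∘ π) j = pairFun g (pairPerm π j)) ?_ ?_ j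
  · intro i
    have : pairPerm π (evenIdx i) = evenIdx (π i) := by
      rw [← pairEquiv_zero, ← pairEquiv_zero, pairPerm, Equiv.permCongr_apply,
        Equiv.symm_apply_apply]
      rfl
    rw [this, pairFun_even, pairFun_even]; rfl
  · intro i
    have : pairPerm π (oddIdx i) = oddIdx (π i) := by
      rw [← pairEquiv_one, ← pairEquiv_one, pairPerm, Equiv.permCongr_apply,
        Equiv.symm_apply_apply]
      rfl
    rw [this, pairFun_odd, pairFun_odd]; rfl

/-- The minor summation formula for an antidiagonal skew-symmetric matrix. -/
theorem pfSum_antidiagonal (E : Matrix (Fin (2 * n)) (Fin N) R) (w c : Fin N → R)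
    (hw : ∀ a, w a = c a - c a.rev) :
    pfSum (Matrix.of fun i j => ∑ a, E i a * w a * E j a.rev) =
      2 ^ n * (n.factorial * ∑ g with StrictMono g, (∏ i, c (g i)) *
        (Matrix.of fun i j => E i (symmFun g j)).det) := by
  set B : Matrix (Fin (2 * n)) (Fin (2 * n)) R := Matrix.of fun i j => ∑ a, E i a * c a * E j a.rev
    with hB
  have h1 : (Matrix.of fun i j => ∑ a, E i a * w a * E j a.rev) = B - Bᵀ := by
    ext i j
    rw [Matrix.sub_apply, Matrix.transpose_apply, hB, Matrix.of_apply, Matrix.of_apply,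
      Matrix.of_apply, ← Equiv.sum_comp Fin.revPerm (fun a => E j a * c a * E i a.rev),
      ← Finset.sum_sub_distrib]
    refine Finset.sum_congr rfl fun a _ => ?_
    rw [hw, Fin.revPerm_apply, Fin.rev_rev]
    ring
  rw [h1, pfSum_sub_transpose, hB, pfSum_eq_sum_det]
  congr 1
  rw [sum_eq_factorial_mul_sum_strictMono]
  · simp only [det_symmFun]
  · intro g π
    congr 1
    · exact Equiv.prod_comp π fun i => c (g i)
    · have := Matrix.det_permute' (pairPerm π) (Matrix.of fun i j => E i (pairFun g j))
      rw [sign_pairPerm] at this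
      simp only [Units.val_one, Int.cast_one, one_mul] at this
      rw [← this]
      congr 1
      ext i j
      simp [pairFun_comp]
  · intro g hg
    rw [Function.Injective] at hg
    push Not at hg
    obtain ⟨a, a', h, hne⟩ := hg
    rw [Matrix.det_zero_of_column_eq (evenIdx_injective.ne hne), mul_zero]
    intro k
    rw [Matrix.of_apply, Matrix.of_apply, pairFun_even, pairFun_even, h]

end Pfaffian

/-! ### The expansion in Schur functions of self-dual partitions -/

section SelfDual

variable {R : Type*} [CommRing R] {n N s : ℕ}

theorem mem_selfDual {lam : Fin (2 * n) → ℕ} :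
    lam ∈ selfDual (2 * n) (n * s) ↔ Antitone lam ∧ ∀ i, lam i + lam i.rev = s := by
  classical
  simp only [selfDual, Finset.mem_filter, Fintype.mem_piFinset, Finset.mem_range]
  constructor
  · rintro ⟨-, h1, -, h2⟩
    refine ⟨h1, fun i => ?_⟩
    have h3 := h2 i
    have hn : 0 < 2 * n := i.pos
    rw [← mul_assoc] at h3
    exact Nat.eq_of_mul_eq_mul_left hn h3
  · rintro ⟨h1, h2⟩
    refine ⟨fun i => ?_, h1, ?_, fun i => by rw [h2]; ring⟩
    · have hn : 1 ≤ n := by have := i.pos; omega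
      have := h2 i
      nlinarith
    · have h3 : ∑ i, (lam i + lam i.rev) = 2 * (n * s) := by
        simp only [h2, Finset.sum_const, Finset.card_univ, Fintype.card_fin, smul_eq_mul]
        ring
      have h4 : ∑ i : Fin (2 * n), lam i.rev = ∑ i, lam i := Equiv.sum_comp Fin.revPerm lam
      rw [Finset.sum_add_distrib, h4] at h3
      omega

/-- The determinant `det (h_{lamᵢ - i + j})` for the coefficients `h` of a power series. -/
noncomputable def schurDet {ℓ : ℕ} (F : R⟦X⟧) (lam : Fin ℓ → ℕ) : R :=
  (Matrix.of fun i j : Fin ℓ => coeffZ F ((lam i : ℤ) - (i : ℕ) + (j : ℕ))).det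

theorem schur_eq_schurDet {ℓ : ℕ} (lam : Fin ℓ → ℕ) (t : ℕ+ → ℂ) :
    schur lam t = schurDet (timeExp t) lam := rfl

theorem firstHalf_rev_apply {lam : Fin (2 * n) → ℕ} (h : ∀ i, lam i + lam i.rev = s) (i : Fin n) :
    shiftedPart lam (firstHalf i) + shiftedPart lam (firstHalf i).rev = (s : ℤ) + 2 * n - 1 := by
  have h1 := h (firstHalf i)
  have h2 : ((firstHalf i).rev : ℕ) = 2 * n - ((i : ℕ) + 1) := by rw [Fin.val_rev]; rfl
  have h3 : ((firstHalf i : Fin (2 * n)) : ℕ) = i := rfl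
  rw [shiftedPart, shiftedPart, h2, h3]
  omega

theorem shiftedPart_rev_firstHalf (lam : Fin (2 * n) → ℕ) (i : Fin n) :
    shiftedPart lam (firstHalf i).rev = (lam (firstHalf i).rev : ℤ) + (i : ℕ) := by
  have h2 : ((firstHalf i).rev : ℕ) = 2 * n - ((i : ℕ) + 1) := by rw [Fin.val_rev]; rfl
  rw [shiftedPart, h2]
  omega

/-- The strictly increasing `n`-tuple `lam_{2n-i} + i` of a self-dual partition. -/
def lowerHalf (hn : 2 * n ≤ N) (lam : Fin (2 * n) → ℕ)
    (h : ∀ i, lam i + lam i.rev = N - 2 * n) (i : Fin n) : Fin N :=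
  ⟨lam (firstHalf i).rev + i, by have := h (firstHalf i); omega⟩

theorem lowerHalf_val (hn : 2 * n ≤ N) (lam : Fin (2 * n) → ℕ)
    (h : ∀ i, lam i + lam i.rev = N - 2 * n) (i : Fin n) :
    (lowerHalf hn lam h i : ℕ) = lam (firstHalf i).rev + i := rfl

theorem symmFun_lowerHalf (hn : 2 * n ≤ N) (lam : Fin (2 * n) → ℕ)
    (h : ∀ i, lam i + lam i.rev = N - 2 * n) (j : Fin (2 * n)) :
    ((symmFun (lowerHalf hn lam h) j.rev : ℕ) : ℤ) = shiftedPart lam j := by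
  by_cases hj : (j : ℕ) < n
  · have h1 := symmFun_right (lowerHalf hn lam h) ⟨j, hj⟩
    have h2 := firstHalf_rev_apply h ⟨j, hj⟩
    rw [shiftedPart_rev_firstHalf] at h2
    simp only at h1
    rw [h1, Fin.val_rev, lowerHalf_val]
    have h3 : (firstHalf ⟨(j : ℕ), hj⟩ : Fin (2 * n)) = j := rfl
    rw [h3] at h2 ⊢
    have h4 := h j
    simp only at h2 ⊢
    omega
  · have h0 : (j : ℕ) = 2 * n - ((j.rev : ℕ) + 1) := by rw [Fin.val_rev]; omega
    have hj' : (j.rev : ℕ) < n := by omega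
    have h1 := symmFun_left (lowerHalf hn lam h) ⟨j.rev, hj'⟩
    simp only at h1
    have h3 : (firstHalf ⟨(j.rev : ℕ), hj'⟩ : Fin (2 * n)) = j.rev := rfl
    have h4 := shiftedPart_rev_firstHalf lam ⟨j.rev, hj'⟩
    rw [h3, Fin.rev_rev] at h4
    rw [h1, lowerHalf_val, h4, h3, Fin.rev_rev]
    simp

theorem schurDet_eq_det (hn : 2 * n ≤ N) (F : R⟦X⟧) (lam : Fin (2 * n) → ℕ)
    (h : ∀ i, lam i + lam i.rev = N - 2 * n) :
    schurDet F lam = (Matrix.of fun i j : Fin (2 * n) =>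
      coeffZ F ((symmFun (lowerHalf hn lam h) j : ℕ) - (i : ℕ) : ℤ)).det := by
  rw [← Matrix.det_transpose, ← Matrix.det_submatrix_equiv_self Fin.revPerm, schurDet]
  congr 1
  ext i j
  simp only [Matrix.of_apply, Matrix.submatrix_apply, Matrix.transpose_apply, Fin.revPerm_apply,
    symmFun_lowerHalf]
  congr 1
  rw [shiftedPart, Fin.val_rev]
  omega

theorem strictMono_lowerHalf (hn : 2 * n ≤ N) {lam : Fin (2 * n) → ℕ} (h0 : Antitone lam)
    (h : ∀ i, lam i + lam i.rev = N - 2 * n) : StrictMono (lowerHalf hn lam h) := by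
  intro i j hij
  have h1 : lam (firstHalf i).rev ≤ lam (firstHalf j).rev := by
    apply h0
    rw [Fin.rev_le_rev]
    exact hij.le
  rw [Fin.lt_def, lowerHalf, lowerHalf]
  have := Fin.lt_def.mp hij
  simp only
  omega

theorem lowerHalf_lt (hn : 2 * n ≤ N) {lam : Fin (2 * n) → ℕ} (h0 : Antitone lam)
    (h : ∀ i, lam i + lam i.rev = N - 2 * n) (i : Fin n) :
    2 * (lowerHalf hn lam h i : ℕ) + 1 < N := by
  have h1 : lam (firstHalf i).rev ≤ lam (firstHalf i) := by
    apply h0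
    rw [Fin.le_def, Fin.val_rev]
    have : ((firstHalf i : Fin (2 * n)) : ℕ) = i := rfl
    omega
  have h2 := h (firstHalf i)
  rw [lowerHalf]
  simp only
  omega

/-- The self-dual partition attached to a strictly increasing `n`-tuple. -/
def ofLowerHalf (g : Fin n → Fin N) (j : Fin (2 * n)) : ℕ :=
  if hj : (j : ℕ) < n then N - 2 * n - ((g ⟨j, hj⟩ : ℕ) - j)
  else (g ⟨j.rev, by rw [Fin.val_rev]; omega⟩ : ℕ) - j.rev

theorem le_of_strictMono {g : Fin n → Fin N} (hg : StrictMono g) {i j : Fin n} (hij : i ≤ j) :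
    (i : ℕ) ≤ g i ∧ (g i : ℕ) + (j - i : ℕ) ≤ g j := by
  have key : ∀ d : ℕ, ∀ i j : Fin n, (j : ℕ) = i + d → (g i : ℕ) + d ≤ g j := by
    intro d
    induction d with
    | zero =>
      intro i j h
      have : j = i := by ext; omega
      rw [this, add_zero]
    | succ d ih =>
      intro i j h
      have h1 := ih i ⟨i + d, by omega⟩ rfl
      have h2 : g ⟨i + d, by omega⟩ < g j := hg (by rw [Fin.lt_def]; simp only; omega)
      rw [Fin.lt_def] at h2
      omega
  constructor
  · have := key i ⟨0, by have := i.2; omega⟩ i (by simp)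
    omega
  · exact key _ i j (by have := Fin.le_def.mp hij; omega)

theorem ofLowerHalf_add_rev (hn : 2 * n ≤ N) {g : Fin n → Fin N} (hg : StrictMono g)
    (hlt : ∀ i, 2 * (g i : ℕ) + 1 < N) (j : Fin (2 * n)) :
    ofLowerHalf g j + ofLowerHalf g j.rev = N - 2 * n := by
  have key : ∀ j : Fin (2 * n), (j : ℕ) < n →
      ofLowerHalf g j + ofLowerHalf g j.rev = N - 2 * n := by
    intro j hj
    have hj' : ¬ ((j.rev : ℕ) < n) := by rw [Fin.val_rev]; omega
    rw [ofLowerHalf, dif_pos hj, ofLowerHalf, dif_neg hj']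
    simp only [Fin.rev_rev]
    have h1 := (le_of_strictMono hg (i := ⟨j, hj⟩) (j := ⟨n - 1, by omega⟩)
      (by rw [Fin.le_def]; simp only; omega))
    have h2 := hlt ⟨n - 1, by omega⟩
    simp only at h1
    omega
  by_cases hj : (j : ℕ) < n
  · exact key j hj
  · have := key j.rev (by rw [Fin.val_rev]; omega)
    rwa [Fin.rev_rev, add_comm] at this

theorem ofLowerHalf_antitone (hn : 2 * n ≤ N) {g : Fin n → Fin N} (hg : StrictMono g)
    (hlt : ∀ i, 2 * (g i : ℕ) + 1 < N) : Antitone (ofLowerHalf g) := by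
  intro i j hij
  have hij' := Fin.le_def.mp hij
  have bound : ∀ i : Fin n, 2 * ((g i : ℕ) - i) ≤ N - 2 * n := by
    intro i
    have h1 := (le_of_strictMono hg (i := i) (j := ⟨n - 1, by have := i.2; omega⟩)
      (by rw [Fin.le_def]; simp only; omega))
    have h2 := hlt ⟨n - 1, by have := i.2; omega⟩
    simp only at h1
    have := i.2
    omega
  unfold ofLowerHalf
  split_ifs with hi hj hj
  · have h1 := (le_of_strictMono hg (i := ⟨i, hj⟩) (j := ⟨j, hi⟩)
      (by rw [Fin.le_def]; simp only; omega))
    simp only at h1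
    omega
  · omega
  · have h1 := bound ⟨i, hj⟩
    have h2 := bound ⟨j.rev, by rw [Fin.val_rev]; omega⟩
    simp only at h1 h2
    omega
  · have hr : (j.rev : ℕ) ≤ i.rev := Fin.le_def.mp (Fin.rev_le_rev.mpr hij)
    have h1 := (le_of_strictMono hg (i := ⟨j.rev, by rw [Fin.val_rev]; omega⟩)
      (j := ⟨i.rev, by rw [Fin.val_rev]; omega⟩) (by rw [Fin.le_def]; simp only; omega))
    simp only at h1
    omega

theorem lowerHalf_ofLowerHalf (hn : 2 * n ≤ N) {g : Fin n → Fin N} (hg : StrictMono g)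
    (hlt : ∀ i, 2 * (g i : ℕ) + 1 < N) :
    lowerHalf hn (ofLowerHalf g) (ofLowerHalf_add_rev hn hg hlt) = g := by
  funext i
  ext
  have h1 : ((firstHalf i : Fin (2 * n)) : ℕ) = i := rfl
  have h2 : ¬ (((firstHalf i).rev : ℕ) < n) := by rw [Fin.val_rev]; omega
  rw [lowerHalf_val, ofLowerHalf, dif_neg h2]
  simp only [Fin.rev_rev, h1, Fin.eta]
  have := (le_of_strictMono hg (le_refl i)).1
  omega

theorem lowerHalf_injective (hn : 2 * n ≤ N) {lam mu : Fin (2 * n) → ℕ}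
    (h : ∀ i, lam i + lam i.rev = N - 2 * n) (h' : ∀ i, mu i + mu i.rev = N - 2 * n)
    (heq : lowerHalf hn lam h = lowerHalf hn mu h') : lam = mu := by
  have key : ∀ i : Fin n, lam (firstHalf i).rev = mu (firstHalf i).rev := by
    intro i
    have := congrArg Fin.val (congrFun heq i)
    rw [lowerHalf, lowerHalf] at this
    simp only at this
    omega
  funext j
  by_cases hj : (j : ℕ) < n
  · have h1 := key ⟨j, hj⟩
    have h3 : (firstHalf ⟨(j : ℕ), hj⟩ : Fin (2 * n)) = j := rfl
    rw [h3] at h1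
    have := h j
    have := h' j
    omega
  · have hj' : (j.rev : ℕ) < n := by rw [Fin.val_rev]; omega
    have h1 := key ⟨j.rev, hj'⟩
    have h3 : (firstHalf ⟨(j.rev : ℕ), hj'⟩ : Fin (2 * n)) = j.rev := rfl
    rwa [h3, Fin.rev_rev] at h1

/-- The Schur expansion of the Pfaffian of `((j - i) (F²)_{N-1-i-j})`. -/
theorem pfSum_eq_sum_selfDual (hn : 2 * n ≤ N) (F : R⟦X⟧) :
    pfSum (Matrix.of fun i j : Fin (2 * n) => (((j : ℕ) : R) - ((i : ℕ) : R)) *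
        coeffZ (F * F) ((N : ℤ) - (i : ℕ) - (j : ℕ) - 1)) =
      2 ^ n * (n.factorial * ∑ lam ∈ selfDual (2 * n) (n * (N - 2 * n)),
        (∏ i : Fin n, ((shiftedPart lam (firstHalf i) -
          shiftedPart lam (firstHalf i).rev : ℤ) : R)) * schurDet F lam) := by
  set c : Fin N → R := fun a => if a < a.rev then ((a.rev : ℕ) : R) - ((a : ℕ) : R) else 0 with hc
  have key : ∀ (lam : Fin (2 * n) → ℕ) (h : ∀ i, lam i + lam i.rev = N - 2 * n), Antitone lam →
      ∏ i, c (lowerHalf hn lam h i) = ∏ i : Fin n, ((shiftedPart lam (firstHalf i) -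
          shiftedPart lam (firstHalf i).rev : ℤ) : R) := by
    intro lam h h0
    refine Finset.prod_congr rfl fun i _ => ?_
    have h1 := lowerHalf_lt hn h0 h i
    have h2 := firstHalf_rev_apply h i
    have h3 := shiftedPart_rev_firstHalf lam i
    have h4 := lowerHalf_val hn lam h i
    simp only [hc]
    rw [if_pos (by rw [Fin.lt_def, Fin.val_rev]; omega)]
    have h5 : ((((lowerHalf hn lam h i).rev : ℕ) : ℤ) - ((lowerHalf hn lam h i : ℕ) : ℤ)) =
        shiftedPart lam (firstHalf i) - shiftedPart lam (firstHalf i).rev := by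
      rw [Fin.val_rev]
      omega
    rw [← h5]
    push_cast
    rfl
  have hsum : (Matrix.of fun i j : Fin (2 * n) => (((j : ℕ) : R) - ((i : ℕ) : R)) *
        coeffZ (F * F) ((N : ℤ) - (i : ℕ) - (j : ℕ) - 1)) =
      Matrix.of fun i j : Fin (2 * n) => ∑ a : Fin N,
        (Matrix.of fun (i : Fin (2 * n)) (a : Fin N) => coeffZ F ((a : ℕ) - (i : ℕ))) i a *
          (((a.rev : ℕ) : R) - ((a : ℕ) : R)) *
        (Matrix.of fun (i : Fin (2 * n)) (a : Fin N) => coeffZ F ((a : ℕ) - (i : ℕ))) j a.rev := by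
    ext i j
    simp only [Matrix.of_apply, sum_antidiagonal_coeffZ]
  rw [hsum, pfSum_antidiagonal (Matrix.of fun (i : Fin (2 * n)) (a : Fin N) =>
      coeffZ F ((a : ℕ) - (i : ℕ))) (fun a => ((a.rev : ℕ) : R) - ((a : ℕ) : R)) c]
  · congr 2
    symm
    refine Finset.sum_bij_ne_zero
      (fun lam hlam _ => lowerHalf hn lam (mem_selfDual.mp hlam).2) ?_ ?_ ?_ ?_
    · intro lam hlam _
      rw [Finset.mem_filter]
      exact ⟨mem_univ _, strictMono_lowerHalf hn (mem_selfDual.mp hlam).1 _⟩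
    · intro lam hlam _ mu hmu _ h
      exact lowerHalf_injective hn _ _ h
    · intro g hg hne
      have hg := (Finset.mem_filter.mp hg).2
      have hlt : ∀ i, 2 * (g i : ℕ) + 1 < N := by
        intro i
        by_contra hcon
        refine hne ?_
        rw [Finset.prod_eq_zero (mem_univ i), zero_mul]
        simp only [hc]
        rw [if_neg]
        rw [Fin.lt_def, Fin.val_rev]
        omega
      refine ⟨ofLowerHalf g, mem_selfDual.mpr ⟨ofLowerHalf_antitone hn hg hlt,
        ofLowerHalf_add_rev hn hg hlt⟩, ?_, lowerHalf_ofLowerHalf hn hg hlt⟩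
      contrapose! hne
      rw [← hne, schurDet_eq_det hn F _ (ofLowerHalf_add_rev hn hg hlt),
        lowerHalf_ofLowerHalf hn hg hlt]
      have h1 := key _ (ofLowerHalf_add_rev hn hg hlt) (ofLowerHalf_antitone hn hg hlt)
      rw [lowerHalf_ofLowerHalf hn hg hlt] at h1
      rw [h1]
      rfl
    · intro lam hlam _
      obtain ⟨h1, h2⟩ := mem_selfDual.mp hlam
      rw [schurDet_eq_det hn F _ h2, key _ h2 h1]
      rfl
  · intro a
    simp only [hc, Fin.rev_rev]
    rcases lt_trichotomy a a.rev with h | h | h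
    · rw [if_pos h, if_neg h.asymm, sub_zero]
    · rw [← h]; simp
    · rw [if_neg h.asymm, if_pos h]; ring

end SelfDual

/-! ### The scalar product on symmetric functions -/

section JackInner

variable {α : ℚ}

/-- The norm `∏ᵢ i^{mᵢ} mᵢ! α^{mᵢ}` of a power sum monomial. -/
def jackWeight (α : ℚ) (m : ℕ+ →₀ ℕ) : ℚ :=
  ∏ i ∈ m.support, (((i : ℕ) : ℚ) ^ m i * ((m i).factorial : ℚ) * α ^ m i)

theorem jackWeight_eq_prod {m : ℕ+ →₀ ℕ} {s : Finset ℕ+} (hs : m.support ⊆ s) :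
    jackWeight α m = ∏ i ∈ s, (((i : ℕ) : ℚ) ^ m i * ((m i).factorial : ℚ) * α ^ m i) := by
  refine Finset.prod_subset hs fun i _ hi => ?_
  rw [Finsupp.notMem_support_iff.mp hi]
  simp

theorem jackWeight_pos (hα : 0 < α) (m : ℕ+ →₀ ℕ) : 0 < jackWeight α m := by
  refine Finset.prod_pos fun i _ => ?_
  have : (0 : ℚ) < ((i : ℕ) : ℚ) := by exact_mod_cast i.pos
  positivity

theorem jackWeight_add_single (m : ℕ+ →₀ ℕ) (i : ℕ+) :
    jackWeight α (m + Finsupp.single i 1) = jackWeight α m * ((i : ℕ) * (m i + 1) * α) := by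
  classical
  have h1 : (m + Finsupp.single i 1).support ⊆ insert i m.support := by
    intro j hj
    rw [Finset.mem_insert]
    by_contra! h
    have h2 := Finsupp.notMem_support_iff.mp h.2
    rw [Finsupp.mem_support_iff, Finsupp.add_apply, h2, Finsupp.single_eq_of_ne h.1] at hj
    exact hj rfl
  rw [jackWeight_eq_prod h1, jackWeight_eq_prod (Finset.subset_insert i m.support),
    ← Finset.mul_prod_erase _ _ (Finset.mem_insert_self i _),
    ← Finset.mul_prod_erase _ _ (Finset.mem_insert_self i _)]
  set m' : ℕ+ →₀ ℕ := m + Finsupp.single i 1 with hm'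
  have h2 : ∏ j ∈ (insert i m.support).erase i, (((j : ℕ) : ℚ) ^ m' j *
        ((m' j).factorial : ℚ) * α ^ m' j) =
      ∏ j ∈ (insert i m.support).erase i,
        (((j : ℕ) : ℚ) ^ m j * ((m j).factorial : ℚ) * α ^ m j) := by
    refine Finset.prod_congr rfl fun j hj => ?_
    rw [hm', Finsupp.add_apply, Finsupp.single_eq_of_ne (Finset.ne_of_mem_erase hj), add_zero]
  rw [h2, hm', Finsupp.add_apply, Finsupp.single_eq_same, Nat.factorial_succ]
  push_cast
  ring

theorem jackInner_eq_sum (f g : SymmFun) {s : Finset (ℕ+ →₀ ℕ)} (hs : f.support ⊆ s) :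
    jackInner α f g = ∑ m ∈ s, f.coeff m * g.coeff m * jackWeight α m := by
  refine Finset.sum_subset hs fun m _ hm => ?_
  rw [MvPolynomial.notMem_support_iff.mp hm]
  simp

theorem jackInner_comm (f g : SymmFun) : jackInner α f g = jackInner α g f := by
  classical
  rw [jackInner_eq_sum f g (Finset.subset_union_left (s₂ := g.support)),
    jackInner_eq_sum g f (Finset.subset_union_right (s₁ := f.support))]
  refine Finset.sum_congr rfl fun m _ => ?_
  ring

theorem jackInner_add_left (f f' g : SymmFun) :
    jackInner α (f + f') g = jackInner α f g + jackInner α f' g := by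
  classical
  rw [jackInner_eq_sum (f + f') g MvPolynomial.support_add,
    jackInner_eq_sum f g (Finset.subset_union_left (s₂ := f'.support)),
    jackInner_eq_sum f' g (Finset.subset_union_right (s₁ := f.support)),
    ← Finset.sum_add_distrib]
  refine Finset.sum_congr rfl fun m _ => ?_
  rw [MvPolynomial.coeff_add]
  ring

theorem jackInner_smul_left (c : ℚ) (f g : SymmFun) :
    jackInner α (c • f) g = c * jackInner α f g := by
  rw [jackInner_eq_sum (c • f) g MvPolynomial.support_smul, jackInner_eq_sum f g subset_rfl,
    Finset.mul_sum]
  refine Finset.sum_congr rfl fun m _ => ?_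
  rw [MvPolynomial.coeff_smul, smul_eq_mul]
  ring

/-- The scalar product as a bilinear map. -/
noncomputable def jackForm (α : ℚ) : SymmFun →ₗ[ℚ] SymmFun →ₗ[ℚ] ℚ :=
  LinearMap.mk₂ ℚ (jackInner α) jackInner_add_left jackInner_smul_left
    (fun f g g' => by
      rw [jackInner_comm, jackInner_add_left, jackInner_comm g, jackInner_comm g'])
    (fun c f g => by rw [jackInner_comm, jackInner_smul_left, jackInner_comm g, smul_eq_mul])

theorem jackForm_apply (f g : SymmFun) : jackForm α f g = jackInner α f g := rfl

theorem jackForm_monomial (m : ℕ+ →₀ ℕ) (c : ℚ) (g : SymmFun) :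
    jackForm α (MvPolynomial.monomial m c) g = c * g.coeff m * jackWeight α m := by
  rw [jackForm_apply, jackInner_eq_sum _ _ MvPolynomial.support_monomial_subset]
  simp

theorem jackForm_self_eq_zero (hα : 0 < α) {f : SymmFun} (h : jackForm α f f = 0) : f = 0 := by
  rw [jackForm_apply, jackInner_eq_sum f f subset_rfl, Finset.sum_eq_zero_iff_of_nonneg] at h
  · ext m
    by_contra hne
    have h1 := h m (MvPolynomial.mem_support_iff.mpr hne)
    have h2 := jackWeight_pos hα m
    rw [MvPolynomial.coeff_zero] at hne
    simp [hne, h2.ne'] at h1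
  · intro m _
    have := jackWeight_pos hα m
    exact mul_nonneg (mul_self_nonneg _) this.le

/-- The adjoint `α i ∂/∂pᵢ` of the multiplication by `pᵢ`. -/
noncomputable def jackAdjoint (α : ℚ) (i : ℕ+) : Derivation ℚ SymmFun SymmFun :=
  (((i : ℕ) : ℚ) * α) • MvPolynomial.pderiv i

theorem jackForm_mul_X (f g : SymmFun) (i : ℕ+) :
    jackForm α (f * MvPolynomial.X i) g = jackForm α f (jackAdjoint α i g) := by
  induction f using MvPolynomial.induction_on' with
  | monomial m c =>
    rw [MvPolynomial.X, MvPolynomial.monomial_mul, mul_one, jackForm_monomial, jackForm_monomial,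
      jackWeight_add_single, jackAdjoint, Derivation.smul_apply, MvPolynomial.coeff_smul,
      MvPolynomial.coeff_pderiv, smul_eq_mul]
    ring
  | add p q hp hq => rw [add_mul, map_add, map_add, LinearMap.add_apply, LinearMap.add_apply, hp, hq]

end JackInner

/-! ### The functions dual to the monomial symmetric functions -/

section DualFunctions

variable {α : ℚ}

/-- The power series `∑ pᵢ₊₁ zⁱ / α`. -/
noncomputable def dualLog (α : ℚ) : SymmFun⟦X⟧ :=
  PowerSeries.mk fun i => MvPolynomial.C α⁻¹ * MvPolynomial.X (Nat.succPNat i)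

/-- The power series `exp (∑ pᵢ zⁱ / (α i))`. -/
noncomputable def dualSeries (α : ℚ) : SymmFun⟦X⟧ := expSolution (dualLog α)

theorem dualSeries_spec (α : ℚ) : IsExpSolution (dualLog α) (dualSeries α) := expSolution_spec _

/-- The coefficient of `z ^ m` of `exp (∑ pᵢ zⁱ / (α i))`. -/
noncomputable def dualFun (α : ℚ) (m : ℕ) : SymmFun := PowerSeries.coeff m (dualSeries α)

theorem dualFun_zero : dualFun α 0 = 1 := (dualSeries_spec α).coeff_zero

theorem dualFun_succ (m : ℕ) : ((m : SymmFun) + 1) * dualFun α (m + 1) =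
    ∑ p ∈ antidiagonal m,
      MvPolynomial.C α⁻¹ * MvPolynomial.X (Nat.succPNat p.1) * dualFun α p.2 := by
  rw [dualFun, (dualSeries_spec α).coeff_succ]
  simp [dualLog, dualFun]

theorem eq_zero_of_derivative_eq_mul {R : Type*} [CommRing R] [Algebra ℚ R] {P H : R⟦X⟧}
    (h : PowerSeries.derivative R H = P * H) (h0 : PowerSeries.coeff 0 H = 0) : H = 0 := by
  ext n
  rw [map_zero]
  induction n using Nat.strong_induction_on with
  | _ n ih =>
    cases n with
    | zero => exact h0
    | succ n =>
      apply natCast_succ_mul_cancel (n := n)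
      rw [mul_comm, ← PowerSeries.coeff_derivative, h, PowerSeries.coeff_mul, mul_zero]
      refine Finset.sum_eq_zero fun p hp => ?_
      rw [ih p.2 (by have := mem_antidiagonal.mp hp; omega), mul_zero]

theorem jackAdjoint_dualFun (hα : α ≠ 0) (i : ℕ+) (m : ℕ) :
    jackAdjoint α i (dualFun α m) = if (i : ℕ) ≤ m then dualFun α (m - i) else 0 := by
  set D := jackAdjoint α i with hD
  set H : SymmFun⟦X⟧ := PowerSeries.mk (fun m => D (dualFun α m)) -
    PowerSeries.X ^ (i : ℕ) * dualSeries α with hH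
  have hnat : ∀ n : ℕ, D ((n : SymmFun) + 1) = 0 := by
    intro n
    have : ((n : SymmFun) + 1) = algebraMap ℚ SymmFun ((n : ℚ) + 1) := by simp
    rw [this, Derivation.map_algebraMap]
  have hDX : ∀ n : ℕ, D (MvPolynomial.C α⁻¹ * MvPolynomial.X (Nat.succPNat n)) =
      if n + 1 = (i : ℕ) then ((i : ℕ) : SymmFun) else 0 := by
    intro n
    rw [← MvPolynomial.smul_eq_C_mul, Derivation.map_smul, hD, jackAdjoint, Derivation.smul_apply,
      MvPolynomial.pderiv_X, smul_smul, Pi.single_apply]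
    by_cases h : n + 1 = (i : ℕ)
    · rw [if_pos (by apply PNat.eq; simp [← h]), if_pos h, mul_left_comm, inv_mul_cancel₀ hα,
        mul_one, MvPolynomial.smul_eq_C_mul, mul_one]
      simp
    · rw [if_neg (by intro h'; apply h; rw [← h']; simp), if_neg h, smul_zero]
  have hG : PowerSeries.mk (fun m => dualFun α m) = dualSeries α := by
    ext m; simp [dualFun]
  have h1 : PowerSeries.derivative SymmFun (PowerSeries.mk fun m => D (dualFun α m)) =
      dualLog α * (PowerSeries.mk fun m => D (dualFun α m)) +
        (PowerSeries.C ((i : ℕ) : SymmFun) * PowerSeries.X ^ ((i : ℕ) - 1)) * dualSeries α := by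
    have h3 : (PowerSeries.C ((i : ℕ) : SymmFun) * PowerSeries.X ^ ((i : ℕ) - 1)) =
        PowerSeries.mk fun n =>
          D (MvPolynomial.C α⁻¹ * MvPolynomial.X (Nat.succPNat n)) := by
      ext1 n
      rw [PowerSeries.coeff_C_mul, PowerSeries.coeff_X_pow, PowerSeries.coeff_mk, hDX]
      have := i.pos
      by_cases h : n + 1 = (i : ℕ)
      · rw [if_pos h, if_pos (by omega), mul_one]
      · rw [if_neg h, if_neg (by omega), mul_zero]
    rw [h3]
    ext1 n
    have h2 := congrArg D (dualFun_succ (α := α) n)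
    rw [Derivation.leibniz, hnat, smul_zero, add_zero, map_sum] at h2
    rw [PowerSeries.coeff_derivative, PowerSeries.coeff_mk, mul_comm, ← smul_eq_mul, h2, map_add,
      PowerSeries.coeff_mul, PowerSeries.coeff_mul, ← Finset.sum_add_distrib]
    refine Finset.sum_congr rfl fun p _ => ?_
    rw [Derivation.leibniz, PowerSeries.coeff_mk, PowerSeries.coeff_mk, dualLog,
      PowerSeries.coeff_mk, smul_eq_mul, smul_eq_mul, dualFun, mul_comm (PowerSeries.coeff _ _)]
  have h2 : PowerSeries.derivative SymmFun (PowerSeries.X ^ (i : ℕ) * dualSeries α) =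
      dualLog α * (PowerSeries.X ^ (i : ℕ) * dualSeries α) +
        (PowerSeries.C ((i : ℕ) : SymmFun) * PowerSeries.X ^ ((i : ℕ) - 1)) * dualSeries α := by
    rw [Derivation.leibniz, (dualSeries_spec α).deriv, PowerSeries.derivative_pow,
      PowerSeries.derivative_X, smul_eq_mul, smul_eq_mul, map_natCast]
    ring
  have h3 : H = 0 := by
    apply eq_zero_of_derivative_eq_mul (P := dualLog α)
    · rw [hH, map_sub, h1, h2]
      ring
    · have := i.pos
      rw [hH, map_sub, PowerSeries.coeff_mk, dualFun_zero, Derivation.map_one_eq_zero,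
        PowerSeries.coeff_X_pow_mul', if_neg (by omega), sub_zero]
  have h4 := congrArg (PowerSeries.coeff m) h3
  rw [hH, map_sub, PowerSeries.coeff_mk, PowerSeries.coeff_X_pow_mul', map_zero, sub_eq_zero] at h4
  exact h4

theorem derivation_prod {R A ι : Type*} [CommSemiring R] [CommRing A] [Algebra R A] [DecidableEq ι]
    (D : Derivation R A A) (s : Finset ι) (f : ι → A) :
    D (∏ j ∈ s, f j) = ∑ j ∈ s, D (f j) * ∏ l ∈ s.erase j, f l := by
  induction s using Finset.induction_on with
  | empty => simp
  | insert a s ha ih =>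
    rw [Finset.prod_insert ha, Derivation.leibniz, ih, Finset.sum_insert ha,
      Finset.erase_insert ha, smul_eq_mul, smul_eq_mul, Finset.mul_sum, add_comm, mul_comm (∏ j ∈ s, f j)]
    congr 1
    refine Finset.sum_congr rfl fun j hj => ?_
    rw [Finset.erase_insert_of_ne (by rintro rfl; exact ha hj),
      Finset.prod_insert (fun h => ha (Finset.mem_of_mem_erase h))]
    ring

/-- The symmetric polynomial in `k` variables of a symmetric function. -/
noncomputable def toPoly (k : ℕ) : SymmFun →ₐ[ℚ] MvPolynomial (Fin k) ℚ :=
  MvPolynomial.aeval fun i : ℕ+ => MvPolynomial.psum (Fin k) ℚ (i : ℕ)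

theorem constantCoeff_dualFun (m : ℕ) :
    MvPolynomial.constantCoeff (dualFun α m) = if m = 0 then 1 else 0 := by
  have h := ((dualSeries_spec α).map
    (MvPolynomial.constantCoeff : SymmFun →+* ℚ)).unique (R := ℚ) (G := 1) ?_
  · have h1 := congrArg (PowerSeries.coeff m) h
    rw [PowerSeries.coeff_map, PowerSeries.coeff_one] at h1
    exact h1
  · convert isExpSolution_zero (R := ℚ) using 1
    ext n
    simp [dualLog]

/-- The product `∏ⱼ g_{eⱼ}` of the functions dual to the monomial symmetric functions. -/
noncomputable def dualProd (α : ℚ) {k : ℕ} (e : Fin k →₀ ℕ) : SymmFun := ∏ j, dualFun α (e j)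

theorem jackAdjoint_dualProd (hα : α ≠ 0) (i : ℕ+) {k : ℕ} (e : Fin k →₀ ℕ) :
    jackAdjoint α i (dualProd α e) =
      ∑ j, if (i : ℕ) ≤ e j then dualProd α (e - Finsupp.single j (i : ℕ)) else 0 := by
  rw [dualProd, derivation_prod]
  refine Finset.sum_congr rfl fun j _ => ?_
  rw [jackAdjoint_dualFun hα]
  split_ifs with h
  · rw [dualProd, ← Finset.mul_prod_erase _ _ (mem_univ j)]
    congr 1
    · simp
    · refine Finset.prod_congr rfl fun l hl => ?_
      rw [Finsupp.tsub_apply, Finsupp.single_eq_of_ne (Finset.ne_of_mem_erase hl), tsub_zero]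
  · rw [zero_mul]

/-- The coefficients of the monomials of a symmetric function are its scalar products with the
products of the dual functions. -/
theorem coeff_toPoly (hα : α ≠ 0) (f : SymmFun) {k : ℕ} (e : Fin k →₀ ℕ) :
    MvPolynomial.coeff e (toPoly k f) = jackForm α f (dualProd α e) := by
  induction f using MvPolynomial.induction_on generalizing e with
  | C a =>
    rw [MvPolynomial.C_apply, jackForm_monomial, ← MvPolynomial.C_apply, ← MvPolynomial.algebraMap_eq, AlgHom.commutes,
      MvPolynomial.algebraMap_eq, MvPolynomial.coeff_C, ← MvPolynomial.constantCoeff_eq, dualProd,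
      map_prod]
    simp only [constantCoeff_dualFun]
    have hw : jackWeight α 0 = 1 := by simp [jackWeight]
    rw [hw, mul_one]
    by_cases h : 0 = e
    · subst h; simp
    · rw [if_neg h]
      have : ∃ j, e j ≠ 0 := by
        by_contra! h'
        exact h (by ext j; simp [h'])
      obtain ⟨j, hj⟩ := this
      rw [Finset.prod_eq_zero (mem_univ j) (if_neg hj), mul_zero]
  | add p q hp hq => rw [map_add, MvPolynomial.coeff_add, hp, hq, map_add, LinearMap.add_apply]
  | mul_X p i hp =>
    rw [jackForm_mul_X, jackAdjoint_dualProd hα, map_mul, map_sum]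
    have h1 : toPoly k (MvPolynomial.X i) =
        ∑ j, MvPolynomial.monomial (Finsupp.single j (i : ℕ)) (1 : ℚ) := by
      rw [toPoly, MvPolynomial.aeval_X, MvPolynomial.psum]
      refine Finset.sum_congr rfl fun j _ => ?_
      rw [MvPolynomial.X_pow_eq_monomial]
    rw [h1, Finset.mul_sum, MvPolynomial.coeff_sum]
    refine Finset.sum_congr rfl fun j _ => ?_
    rw [MvPolynomial.coeff_mul_monomial']
    by_cases h : (i : ℕ) ≤ e j
    · rw [if_pos h, if_pos (by rwa [Finsupp.single_le_iff]), mul_one, hp]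
    · rw [if_neg h, if_neg (by rwa [Finsupp.single_le_iff]), map_zero]

theorem adjoin_dualFun (hα : α ≠ 0) : Algebra.adjoin ℚ (Set.range (dualFun α)) = ⊤ := by
  have h1 : ∀ m : ℕ, (MvPolynomial.X (Nat.succPNat m) : SymmFun) ∈
      Algebra.adjoin ℚ (Set.range (dualFun α)) := by
    intro m
    induction m using Nat.strong_induction_on with
    | _ m ih =>
      have h2 := dualFun_succ (α := α) m
      rw [← Finset.add_sum_erase _ _ (show (m, 0) ∈ antidiagonal m by simp), dualFun_zero, mul_one,
        eq_comm, ← eq_sub_iff_add_eq] at h2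
      have h3 : (MvPolynomial.X (Nat.succPNat m) : SymmFun) =
          α • (MvPolynomial.C α⁻¹ * MvPolynomial.X (Nat.succPNat m)) := by
        rw [← MvPolynomial.smul_eq_C_mul, smul_smul, mul_inv_cancel₀ hα, one_smul]
      rw [h3, h2]
      have hg : ∀ m, dualFun α m ∈ Algebra.adjoin ℚ (Set.range (dualFun α)) := fun m =>
        Algebra.subset_adjoin ⟨m, rfl⟩
      refine Subalgebra.smul_mem _ (Subalgebra.sub_mem _ (Subalgebra.mul_mem _ ?_ (hg _))
        (Subalgebra.sum_mem _ fun p hp => ?_)) _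
      · exact Subalgebra.add_mem _ (Subalgebra.natCast_mem _ _) (Subalgebra.one_mem _)
      · have h4 := mem_antidiagonal.mp (Finset.mem_of_mem_erase hp)
        have h5 := Finset.ne_of_mem_erase hp
        refine Subalgebra.mul_mem _ ?_ (hg _)
        rw [← MvPolynomial.smul_eq_C_mul]
        refine Subalgebra.smul_mem _ (ih p.1 ?_) _
        rcases Nat.eq_zero_or_pos p.2 with h6 | h6
        · exact absurd (Prod.ext (by simp only; omega) h6) h5
        · omega
  rw [eq_top_iff, ← MvPolynomial.adjoin_range_X, Algebra.adjoin_le_iff]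
  rintro _ ⟨i, rfl⟩
  have := h1 (i.natPred)
  rwa [PNat.succPNat_natPred] at this

theorem eq_zero_of_jackForm_dualProd (hα : 0 < α) {f : SymmFun}
    (h : ∀ (k : ℕ) (e : Fin k →₀ ℕ), jackForm α f (dualProd α e) = 0) : f = 0 := by
  apply jackForm_self_eq_zero hα
  have h1 : f ∈ Algebra.adjoin ℚ (Set.range (dualFun α)) := by
    rw [adjoin_dualFun hα.ne']; trivial
  rw [← Subalgebra.mem_toSubmodule, Algebra.adjoin_eq_span] at h1
  have h2 : Submodule.span ℚ (Submonoid.closure (Set.range (dualFun α)) : Set SymmFun) ≤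
      LinearMap.ker (jackForm α f) := by
    rw [Submodule.span_le]
    intro g hg
    obtain ⟨l, hl, rfl⟩ := Submonoid.exists_list_of_mem_closure hg
    choose! idx hidx using hl
    have h3 := h l.length (Finsupp.equivFunOnFinite.symm fun j => idx (l.get j))
    rw [dualProd] at h3
    rw [SetLike.mem_coe, LinearMap.mem_ker, ← h3]
    congr 1
    rw [← List.prod_ofFn]
    congr 1
    have h4 : (fun j : Fin l.length => dualFun α ((Finsupp.equivFunOnFinite.symm
        fun j => idx (l.get j)) j)) = l.get := by
      funext j
      exact hidx _ (List.get_mem l j)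
    rw [h4, List.ofFn_get]
  exact h2 h1

end DualFunctions

/-! ### Expansions in monomial symmetric functions -/

section Monomial

/-- The multiset of the nonzero exponents of a monomial. -/
def expParts {k : ℕ} (e : Fin k →₀ ℕ) : Multiset ℕ := e.support.val.map e

theorem sum_expParts {k : ℕ} (e : Fin k →₀ ℕ) : (expParts e).sum = ∑ j, e j := by
  change ∑ j ∈ e.support, e j = _
  exact Finset.sum_subset (Finset.subset_univ _) fun j _ hj => Finsupp.notMem_support_iff.mp hj

theorem mem_expParts_of_ne_zero {k : ℕ} (e : Fin k →₀ ℕ) {j : Fin k} (hj : e j ≠ 0) :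
    e j ∈ expParts e :=
  Multiset.mem_map_of_mem e (Finsupp.mem_support_iff.mpr hj)

theorem multiset_prod_X {k : ℕ} (s : Multiset (Fin k)) :
    (s.map (MvPolynomial.X : Fin k → MvPolynomial (Fin k) ℚ)).prod =
      MvPolynomial.monomial (Multiset.toFinsupp s) 1 := by
  induction s using Multiset.induction_on with
  | empty => simp
  | cons a s ih =>
    rw [Multiset.map_cons, Multiset.prod_cons, ih, MvPolynomial.X, MvPolynomial.monomial_mul,
      mul_one, ← Multiset.singleton_add, map_add, Multiset.toFinsupp_singleton]

theorem ofSym_parts {k d : ℕ} (s : Sym (Fin k) d) :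
    (Nat.Partition.ofSym s).parts = expParts (Multiset.toFinsupp s.1) := by
  rw [expParts, Multiset.toFinsupp_support]
  refine Multiset.map_congr rfl fun j _ => ?_
  rw [Multiset.toFinsupp_apply]

theorem coeff_msymm {k d : ℕ} (mu : d.Partition) (e : Fin k →₀ ℕ) :
    MvPolynomial.coeff e (MvPolynomial.msymm (Fin k) ℚ mu) =
      if mu.parts = expParts e then 1 else 0 := by
  rw [MvPolynomial.msymm, MvPolynomial.coeff_sum]
  simp only [multiset_prod_X, MvPolynomial.coeff_monomial]
  split_ifs with h
  · have hcard : Multiset.card (Finsupp.toMultiset e) = d := by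
      rw [Finsupp.card_toMultiset, Finsupp.sum_fintype _ _ (by simp)]
      simp only [id]
      rw [← sum_expParts, ← h, mu.parts_sum]
    let s : Sym (Fin k) d := ⟨Finsupp.toMultiset e, hcard⟩
    have hs : Multiset.toFinsupp s.1 = e := Finsupp.toMultiset_toFinsupp e
    have hmu : Nat.Partition.ofSym s = mu := by
      apply Nat.Partition.ext
      rw [ofSym_parts, hs, h]
    rw [Finset.sum_eq_single (⟨s, hmu⟩ : {a : Sym (Fin k) d // Nat.Partition.ofSym a = mu})]
    · rw [if_pos hs]
    · intro b _ hb
      rw [if_neg]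
      contrapose! hb
      apply Subtype.ext
      apply Subtype.ext
      apply Multiset.toFinsupp.injective
      exact hb.trans hs.symm
    · simp
  · refine Finset.sum_eq_zero fun s _ => if_neg fun h' => h ?_
    rw [← s.2, ofSym_parts]
    exact congrArg expParts h'

theorem hasMonomialExpansion_iff {d : ℕ} {f : SymmFun} {a : d.Partition → ℚ} :
    HasMonomialExpansion f a ↔ ∀ (k : ℕ) (e : Fin k →₀ ℕ), MvPolynomial.coeff e (toPoly k f) =
      ∑ mu : d.Partition, if mu.parts = expParts e then a mu else 0 := by
  have key : ∀ (k : ℕ) (e : Fin k →₀ ℕ), MvPolynomial.coeff e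
      (∑ mu : d.Partition, MvPolynomial.C (a mu) * MvPolynomial.msymm (Fin k) ℚ mu) =
        ∑ mu : d.Partition, if mu.parts = expParts e then a mu else 0 := by
    intro k e
    rw [MvPolynomial.coeff_sum]
    refine Finset.sum_congr rfl fun mu _ => ?_
    rw [MvPolynomial.coeff_C_mul, coeff_msymm, mul_ite, mul_one, mul_zero]
  constructor
  · intro h k e
    rw [← key, ← h k]
    rfl
  · intro h k
    ext e
    rw [key, ← h]
    rfl

theorem HasMonomialExpansion.coeff_eq {d : ℕ} {f : SymmFun} {a : d.Partition → ℚ}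
    (h : HasMonomialExpansion f a) {k : ℕ} {e : Fin k →₀ ℕ} {mu : d.Partition}
    (hmu : mu.parts = expParts e) : MvPolynomial.coeff e (toPoly k f) = a mu := by
  rw [hasMonomialExpansion_iff.mp h, Finset.sum_eq_single mu]
  · rw [if_pos hmu]
  · intro nu _ hnu
    rw [if_neg]
    contrapose! hnu
    exact Nat.Partition.ext (hnu.trans hmu.symm)
  · simp

theorem HasMonomialExpansion.coeff_eq_zero {d : ℕ} {f : SymmFun} {a : d.Partition → ℚ}
    (h : HasMonomialExpansion f a) {k : ℕ} {e : Fin k →₀ ℕ}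
    (hmu : ∀ mu : d.Partition, mu.parts ≠ expParts e) : MvPolynomial.coeff e (toPoly k f) = 0 := by
  rw [hasMonomialExpansion_iff.mp h]
  exact Finset.sum_eq_zero fun mu _ => if_neg (hmu mu)

theorem HasMonomialExpansion.sub_smul {d : ℕ} {f g : SymmFun} {a b : d.Partition → ℚ}
    (hf : HasMonomialExpansion f a) (hg : HasMonomialExpansion g b) (c : ℚ) :
    HasMonomialExpansion (f - c • g) (fun mu => a mu - c * b mu) := by
  intro k
  rw [map_sub, map_smul, hf k, hg k, Finset.smul_sum, ← Finset.sum_sub_distrib]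
  refine Finset.sum_congr rfl fun mu _ => ?_
  rw [map_sub, map_mul, sub_mul, MvPolynomial.smul_eq_C_mul, mul_assoc]

theorem exists_expParts_eq {d : ℕ} (mu : d.Partition) :
    ∃ (k : ℕ) (e : Fin k →₀ ℕ), mu.parts = expParts e := by
  obtain ⟨l, hl⟩ := Quot.exists_rep mu.parts
  refine ⟨l.length, Finsupp.equivFunOnFinite.symm l.get, ?_⟩
  have hl' : (l : Multiset ℕ) = mu.parts := hl
  have h1 : (Finsupp.equivFunOnFinite.symm l.get : Fin l.length →₀ ℕ).support = univ := by
    ext j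
    simp only [Finsupp.mem_support_iff, Finset.mem_univ, iff_true]
    have : l.get j ∈ mu.parts := by
      rw [← hl', Multiset.mem_coe]
      exact List.get_mem l j
    exact (mu.parts_pos this).ne'
  rw [expParts, h1, Fin.univ_val_map, ← hl']
  congr 1
  exact (List.ofFn_get l).symm

theorem HasMonomialExpansion.eq_zero {d : ℕ} {f : SymmFun}
    (h : HasMonomialExpansion f (fun _ : d.Partition => 0)) : f = 0 := by
  apply eq_zero_of_jackForm_dualProd (α := 1) one_pos
  intro k e
  rw [← coeff_toPoly one_ne_zero, hasMonomialExpansion_iff.mp h]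
  simp

/-- The partial sums of the parts of a partition. -/
def partialSums {d : ℕ} (mu : d.Partition) (r : ℕ) : ℕ := ((mu.parts.sort (· ≥ ·)).take r).sum

theorem list_eq_of_take_sum_eq : ∀ {l l' : List ℕ}, (∀ x ∈ l, 0 < x) → (∀ x ∈ l', 0 < x) →
    (∀ r, (l.take r).sum = (l'.take r).sum) → l = l'
  | [], [], _, _, _ => rfl
  | [], b :: l', _, h', h => by
    have h1 := h 1
    have h2 := h' b (by simp)
    simp at h1
    omega
  | a :: l, [], h', _, h => by
    have h1 := h 1
    have h2 := h' a (by simp)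
    simp at h1
    omega
  | a :: l, b :: l', h1, h2, h => by
    have h3 : a = b := by simpa using h 1
    subst h3
    rw [list_eq_of_take_sum_eq (l := l) (l' := l') (fun x hx => h1 x (by simp [hx]))
      (fun x hx => h2 x (by simp [hx]))]
    intro r
    simpa using h (r + 1)

theorem partialSums_injective {d : ℕ} : Function.Injective (partialSums (d := d)) := by
  intro mu nu h
  have h1 : mu.parts.sort (· ≥ ·) = nu.parts.sort (· ≥ ·) := by
    apply list_eq_of_take_sum_eq
    · intro x hx
      exact mu.parts_pos ((Multiset.mem_sort _).mp hx)
    · intro x hx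
      exact nu.parts_pos ((Multiset.mem_sort _).mp hx)
    · exact fun r => congrFun h r
  apply Nat.Partition.ext
  rw [← Multiset.sort_eq mu.parts (· ≥ ·), h1, Multiset.sort_eq]

theorem dominatedBy_iff {d : ℕ} {mu nu : d.Partition} :
    DominatedBy mu nu ↔ partialSums mu ≤ partialSums nu := Iff.rfl

theorem DominatedBy.trans {d : ℕ} {mu nu rho : d.Partition} (h : DominatedBy mu nu)
    (h' : DominatedBy nu rho) : DominatedBy mu rho := fun r => (h r).trans (h' r)

theorem DominatedBy.antisymm {d : ℕ} {mu nu : d.Partition} (h : DominatedBy mu nu)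
    (h' : DominatedBy nu mu) : mu = nu :=
  partialSums_injective (le_antisymm (dominatedBy_iff.mp h) (dominatedBy_iff.mp h'))

/-- In a Jack family, the member with index `lam` is orthogonal to all functions whose monomial
expansion is supported in a lower set that does not contain `lam`. -/
theorem IsJackFamily.orthogonal {α : ℚ} {P : ∀ d : ℕ, d.Partition → SymmFun}
    (hP : IsJackFamily α P) {d : ℕ} (lam : d.Partition) (s : Finset d.Partition)
    (hs : ∀ mu ∈ s, ∀ nu, DominatedBy nu mu → nu ∈ s) (hlam : lam ∉ s) (h : SymmFun)
    (b : d.Partition → ℚ) (hb : ∀ mu, b mu ≠ 0 → mu ∈ s) (hh : HasMonomialExpansion h b) :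
    jackForm α (P d lam) h = 0 := by
  classical
  induction s using Finset.strongInduction generalizing h b with
  | H s ih =>
    rcases s.eq_empty_or_nonempty with rfl | hne
    · have hb0 : b = fun _ => 0 := by
        funext mu
        by_contra hmu
        simpa using hb mu hmu
      subst hb0
      rw [hh.eq_zero, map_zero]
    · obtain ⟨mu, hmu, hmax⟩ := s.exists_maximalFor partialSums hne
      obtain ⟨a, ha1, ha2, ha3⟩ := hP.1 d mu
      have h1 := ih (s.erase mu) (Finset.erase_ssubset hmu) ?_
        (fun h' => hlam (Finset.mem_of_mem_erase h')) (h - b mu • P d mu)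
        (fun nu => b nu - b mu * a nu) ?_ (hh.sub_smul ha3 (b mu))
      · rw [map_sub, map_smul, jackForm_apply (P d lam) (P d mu),
          hP.2 d lam mu (by rintro rfl; exact hlam hmu), smul_zero, sub_zero] at h1
        exact h1
      · intro nu hnu rho hrho
        rw [Finset.mem_erase] at hnu ⊢
        refine ⟨?_, hs nu hnu.2 rho hrho⟩
        rintro rfl
        exact hnu.1 (DominatedBy.antisymm (hmax hnu.2 hrho) hrho)
      · intro nu hnu
        rw [Finset.mem_erase]
        constructor
        · rintro rfl
          rw [ha1] at hnu
          simp at hnu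
        · by_cases h2 : b nu = 0
          · refine hs mu hmu nu (ha2 nu ?_)
            intro h3
            rw [h2, h3] at hnu
            simp at hnu
          · exact hb nu h2

/-- A monic Jack function is the corresponding member of every Jack family. -/
theorem IsJack.eq_of_isJackFamily {α : ℚ} (hα : 0 < α) {d : ℕ} {lam : d.Partition} {J : SymmFun}
    (hJ : IsJack α lam J) {P : ∀ d : ℕ, d.Partition → SymmFun} (hP : IsJackFamily α P) :
    P d lam = J := by
  classical
  obtain ⟨a, ha1, ha2, ha3⟩ := hP.1 d lam
  obtain ⟨⟨b, hb1, hb2, hb3⟩, hJ2⟩ := hJ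
  have hexp := ha3.sub_smul hb3 1
  rw [one_smul] at hexp
  have hlow : ∀ mu, a mu - 1 * b mu ≠ 0 → DominatedBy mu lam ∧ mu ≠ lam := by
    intro mu hmu
    constructor
    · by_cases h : a mu = 0
      · refine hb2 mu fun h' => hmu ?_
        rw [h, h', mul_zero, sub_zero]
      · exact ha2 mu h
    · rintro rfl
      rw [ha1, hb1] at hmu
      simp at hmu
  have h1 : jackForm α J (P d lam - J) = 0 := hJ2 _ _ hlow hexp
  have h2 : jackForm α (P d lam) (P d lam - J) = 0 := by
    refine hP.orthogonal lam (univ.filter fun mu => DominatedBy mu lam ∧ mu ≠ lam) ?_ (by simp) _ _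
      (fun mu hmu => by simpa using hlow mu hmu) hexp
    intro mu hmu nu hnu
    simp only [Finset.mem_filter, Finset.mem_univ, true_and] at hmu ⊢
    refine ⟨hnu.trans hmu.1, ?_⟩
    rintro rfl
    exact hmu.2 (hmu.1.antisymm hnu)
  have h3 : jackForm α (P d lam - J) (P d lam - J) = 0 := by
    rw [LinearMap.map_sub₂, h1, h2, sub_zero]
  exact sub_eq_zero.mp (jackForm_self_eq_zero hα h3)

end Monomial

/-! ### Determinants of complete symmetric polynomials -/

section SchurDet

variable {R S : Type*} [CommRing R] [CommRing S]

theorem map_schurDet (f : R →+* S) (F : R⟦X⟧) {ℓ : ℕ} (lam : Fin ℓ → ℕ) :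
    f (schurDet F lam) = schurDet (PowerSeries.map f F) lam := by
  rw [schurDet, schurDet, RingHom.map_det]
  congr 1
  ext i j
  simp [coeffZ_map]

/-- The power series `1 / (1 - x z)`. -/
def geomSeries (x : R) : R⟦X⟧ := PowerSeries.mk fun i => x ^ i

theorem IsExpSolution.prod {ι : Type*} (s : Finset ι) {P F : ι → R⟦X⟧}
    (h : ∀ j ∈ s, IsExpSolution (P j) (F j)) :
    IsExpSolution (∑ j ∈ s, P j) (∏ j ∈ s, F j) := by
  classical
  induction s using Finset.induction_on with
  | empty => simpa using isExpSolution_zero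
  | insert a s ha ih =>
    rw [Finset.sum_insert ha, Finset.prod_insert ha]
    exact (h a (Finset.mem_insert_self a s)).mul
      (ih fun j hj => h j (Finset.mem_insert_of_mem hj))

/-- The generating series of the complete symmetric polynomials in the variables in `s`. -/
noncomputable def completeSeries {k : ℕ} (s : Finset (Fin k)) : (MvPolynomial (Fin k) ℚ)⟦X⟧ :=
  ∏ j ∈ s, geomSeries (MvPolynomial.X j)

theorem completeSeries_spec {k : ℕ} (s : Finset (Fin k)) :
    IsExpSolution (∑ j ∈ s, PowerSeries.mk fun i => (MvPolynomial.X j : MvPolynomial (Fin k) ℚ) ^ (i + 1))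
      (completeSeries s) :=
  IsExpSolution.prod s fun j _ => isExpSolution_geom (MvPolynomial.X j)

theorem map_toPoly_dualSeries (k : ℕ) :
    PowerSeries.map (toPoly k : SymmFun →+* MvPolynomial (Fin k) ℚ) (dualSeries 1) =
      completeSeries univ := by
  refine ((dualSeries_spec 1).map _).unique (R := MvPolynomial (Fin k) ℚ) ?_
  convert completeSeries_spec (univ : Finset (Fin k)) using 1
  ext1 m
  rw [PowerSeries.coeff_map, dualLog, PowerSeries.coeff_mk, map_sum]
  simp [toPoly, MvPolynomial.psum]

theorem coeff_completeSeries_mem_supported {k : ℕ} (s : Finset (Fin k)) (m : ℕ) :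
    PowerSeries.coeff m (completeSeries s) ∈ MvPolynomial.supported ℚ (s : Set (Fin k)) := by
  induction s using Finset.induction_on generalizing m with
  | empty =>
    rw [completeSeries, Finset.prod_empty, PowerSeries.coeff_one]
    split_ifs
    · exact one_mem _
    · exact zero_mem _
  | insert a s ha ih =>
    rw [completeSeries, Finset.prod_insert ha, PowerSeries.coeff_mul]
    refine Subalgebra.sum_mem _ fun p _ => Subalgebra.mul_mem _ ?_ ?_
    · rw [geomSeries, PowerSeries.coeff_mk]
      refine Subalgebra.pow_mem _ ?_ _
      rw [MvPolynomial.X_mem_supported]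
      simp
    · exact MvPolynomial.supported_mono (by simp) (ih p.2)

theorem isHomogeneous_coeff_completeSeries {k : ℕ} (s : Finset (Fin k)) (m : ℕ) :
    (PowerSeries.coeff m (completeSeries s)).IsHomogeneous m := by
  induction s using Finset.induction_on generalizing m with
  | empty =>
    rw [completeSeries, Finset.prod_empty, PowerSeries.coeff_one]
    split_ifs with h
    · subst h; exact MvPolynomial.isHomogeneous_one _ _
    · exact MvPolynomial.isHomogeneous_zero _ _ _
  | insert a s ha ih =>
    rw [completeSeries, Finset.prod_insert ha, PowerSeries.coeff_mul]
    refine MvPolynomial.IsHomogeneous.sum _ _ _ fun p hp => ?_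
    rw [← mem_antidiagonal.mp hp]
    refine MvPolynomial.IsHomogeneous.mul ?_ (ih p.2)
    rw [geomSeries, PowerSeries.coeff_mk]
    exact MvPolynomial.isHomogeneous_X_pow a p.1

theorem degreeOf_coeffZ_completeSeries_le {k : ℕ} (s : Finset (Fin k)) (j : Fin k) {m : ℤ} {d : ℕ}
    (h : m ≤ d) : (coeffZ (completeSeries s) m).degreeOf j ≤ d := by
  rw [coeffZ]
  split_ifs with h0
  · refine (MvPolynomial.degreeOf_le_totalDegree _ _).trans
      ((isHomogeneous_coeff_completeSeries s _).totalDegree_le.trans ?_)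
    omega
  · simp

theorem degreeOf_coeffZ_completeSeries_erase {k : ℕ} (j : Fin k) (m : ℤ) :
    (coeffZ (completeSeries (univ.erase j)) m).degreeOf j = 0 := by
  rw [coeffZ]
  split_ifs with h0
  · have h := coeff_completeSeries_mem_supported (univ.erase j) m.toNat
    rw [MvPolynomial.mem_supported] at h
    by_contra hne
    have h1 : j ∈ (PowerSeries.coeff m.toNat (completeSeries (univ.erase j))).vars :=
      MvPolynomial.mem_vars_iff_degreeOf_ne_zero.mpr hne
    simpa using h h1
  · simp

theorem coeffZ_eq_add_of_one_sub_mul {F G : R⟦X⟧} {x : R} (h : F = geomSeries x * G) (m : ℤ) :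
    coeffZ F m = coeffZ G m + x * coeffZ F (m - 1) := by
  have h1 : F = G + PowerSeries.C x * (PowerSeries.X * F) := by
    have h2 := one_sub_mul_geom x
    have h3 : (1 - PowerSeries.C x * PowerSeries.X) * F = G := by
      rw [h, ← mul_assoc]
      have : (1 - PowerSeries.C x * PowerSeries.X) * geomSeries x = 1 := h2
      rw [this, one_mul]
    rw [← h3]
    ring
  rcases lt_or_ge m 0 with hm | hm
  · rw [coeffZ_of_neg _ hm, coeffZ_of_neg _ hm, coeffZ_of_neg _ (by omega)]
    ring
  · lift m to ℕ using hm
    cases m with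
    | zero =>
      rw [coeffZ_of_neg F (by simp : ((0 : ℕ) : ℤ) - 1 < 0), coeffZ_natCast, coeffZ_natCast]
      conv_lhs => rw [h1]
      simp
    | succ m =>
      rw [show ((m + 1 : ℕ) : ℤ) - 1 = (m : ℕ) by push_cast; ring, coeffZ_natCast, coeffZ_natCast,
        coeffZ_natCast]
      conv_lhs => rw [h1]
      simp [PowerSeries.coeff_succ_X_mul]

/-- The determinants of complete symmetric polynomials have degree at most `lam₁` in each
variable. -/
theorem degreeOf_schurDet_le {k ℓ s : ℕ} {lam : Fin ℓ → ℕ} (hlam : ∀ i, lam i ≤ s) (j : Fin k) :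
    (schurDet (completeSeries (univ : Finset (Fin k))) lam).degreeOf j ≤ s := by
  cases ℓ with
  | zero => simp [schurDet]
  | succ ℓ =>
    set F := completeSeries (univ : Finset (Fin k)) with hF
    set G := completeSeries (univ.erase j) with hG
    have hFG : F = geomSeries (MvPolynomial.X j) * G :=
      (Finset.mul_prod_erase _ _ (mem_univ j)).symm
    have h1 : schurDet F lam = (Matrix.of fun (i : Fin (ℓ + 1)) (l : Fin (ℓ + 1)) =>
        if l = 0 then coeffZ F ((lam i : ℤ) - (i : ℕ) + (l : ℕ))
        else coeffZ G ((lam i : ℤ) - (i : ℕ) + (l : ℕ))).det := by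
      refine Matrix.det_eq_of_forall_col_eq_smul_add_pred (fun _ => MvPolynomial.X j) ?_ ?_
      · intro i; simp
      · intro i l
        rw [Matrix.of_apply, Matrix.of_apply, Matrix.of_apply, if_neg (Fin.succ_ne_zero l),
          coeffZ_eq_add_of_one_sub_mul hFG]
        congr 3
        simp only [Fin.val_succ, Fin.val_castSucc]
        push_cast
        ring
    rw [h1, Matrix.det_apply']
    refine (MvPolynomial.degreeOf_sum_le _ _ _).trans (Finset.sup_le fun σ _ => ?_)
    refine (MvPolynomial.degreeOf_mul_le _ _ _).trans ?_
    have h2 : MvPolynomial.degreeOf j (((Equiv.Perm.sign σ : ℤ) : MvPolynomial (Fin k) ℚ)) = 0 := by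
      have : ((Equiv.Perm.sign σ : ℤ) : MvPolynomial (Fin k) ℚ) =
          MvPolynomial.C ((Equiv.Perm.sign σ : ℤ) : ℚ) := by simp
      rw [this, MvPolynomial.degreeOf_C]
    rw [h2, zero_add]
    refine (MvPolynomial.degreeOf_prod_le _ _ _).trans ?_
    rw [Fin.sum_univ_succ]
    have h3 : ∑ l : Fin ℓ, MvPolynomial.degreeOf j ((Matrix.of fun (i : Fin (ℓ + 1))
        (l : Fin (ℓ + 1)) =>
        if l = 0 then coeffZ F ((lam i : ℤ) - (i : ℕ) + (l : ℕ))
        else coeffZ G ((lam i : ℤ) - (i : ℕ) + (l : ℕ))) (σ l.succ) l.succ) = 0 := by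
      refine Finset.sum_eq_zero fun l _ => ?_
      rw [Matrix.of_apply, if_neg (Fin.succ_ne_zero l), degreeOf_coeffZ_completeSeries_erase]
    rw [h3, add_zero, Matrix.of_apply, if_pos rfl]
    apply degreeOf_coeffZ_completeSeries_le
    have := hlam (σ 0)
    simp only [Fin.val_zero, Nat.cast_zero]
    omega

theorem coeffZ_mul_of_coeff_eq_zero {Q F : R⟦X⟧} {n : ℕ}
    (hQ : ∀ p, n ≤ p → PowerSeries.coeff p Q = 0) (m : ℤ) :
    coeffZ (Q * F) m = ∑ p ∈ Finset.range n, PowerSeries.coeff p Q * coeffZ F (m - p) := by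
  have key : ∀ M : ℕ, ∑ l : Fin M, coeffZ Q ((l : ℕ) - 0) * coeffZ F (m - (l : ℕ)) =
      ∑ p ∈ Finset.range M, PowerSeries.coeff p Q * coeffZ F (m - p) := by
    intro M
    rw [Fin.sum_univ_eq_sum_range (fun l => coeffZ Q ((l : ℤ) - 0) * coeffZ F (m - (l : ℤ))) M]
    refine Finset.sum_congr rfl fun p _ => ?_
    rw [sub_zero, coeffZ_natCast]
  have h := sum_coeffZ_mul (N := max n (m + 1).toNat) Q F (i := 0) (j := m) le_rfl (by omega)
  rw [key, sub_zero] at h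
  rw [← h]
  symm
  refine Finset.sum_subset (Finset.range_subset_range.mpr (le_max_left _ _)) fun p _ hp => ?_
  rw [hQ p (by simpa using hp), zero_mul]

/-- The polynomial `∏ⱼ (1 - xⱼ z)`. -/
noncomputable def elemPoly {ι : Type*} (s : Finset ι) (x : ι → R) : Polynomial R :=
  ∏ j ∈ s, (1 - Polynomial.C (x j) * Polynomial.X)

theorem coeff_elemPoly_eq_zero {ι : Type*} (s : Finset ι) (x : ι → R) {p : ℕ} (hp : s.card < p) :
    PowerSeries.coeff p (elemPoly s x : R⟦X⟧) = 0 := by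
  rw [Polynomial.coeff_coe]
  apply Polynomial.coeff_eq_zero_of_natDegree_lt
  refine lt_of_le_of_lt ((Polynomial.natDegree_prod_le _ _).trans ?_) hp
  rw [Finset.card_eq_sum_ones]
  refine Finset.sum_le_sum fun j _ => ?_
  refine (Polynomial.natDegree_sub_le _ _).trans ?_
  rw [Polynomial.natDegree_one]
  exact max_le (by omega) ((Polynomial.natDegree_C_mul_le _ _).trans Polynomial.natDegree_X_le)

theorem coeff_zero_elemPoly {ι : Type*} (s : Finset ι) (x : ι → R) :
    PowerSeries.coeff 0 (elemPoly s x : R⟦X⟧) = 1 := by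
  rw [Polynomial.coeff_coe, Polynomial.coeff_zero_eq_eval_zero, elemPoly, Polynomial.eval_prod]
  simp

theorem elemPoly_mul_prod_geom {ι : Type*} (s : Finset ι) (x : ι → R) :
    (elemPoly s x : R⟦X⟧) * ∏ j ∈ s, geomSeries (x j) = 1 := by
  have : (elemPoly s x : R⟦X⟧) = ∏ j ∈ s, (1 - PowerSeries.C (x j) * PowerSeries.X) := by
    rw [elemPoly, ← Polynomial.coeToPowerSeries.ringHom_apply, map_prod]
    simp
  rw [this, ← Finset.prod_mul_distrib]
  exact Finset.prod_eq_one fun j _ => one_sub_mul_geom (x j)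

theorem schurDet_zero {F : R⟦X⟧} (hF : PowerSeries.coeff 0 F = 1) (n : ℕ) :
    schurDet F (fun _ : Fin n => 0) = 1 := by
  rw [schurDet, Matrix.det_of_isUpperTriangular]
  · refine Finset.prod_eq_one fun i _ => ?_
    rw [Matrix.of_apply, show ((0 : ℕ) : ℤ) - (i : ℕ) + (i : ℕ) = (0 : ℕ) by push_cast; ring,
      coeffZ_natCast, hF]
  · intro i j hij
    have := Fin.lt_def.mp hij
    rw [Matrix.of_apply, coeffZ_of_neg]
    simp only [id] at this
    push_cast
    omega

/-- In `n` variables, the Schur polynomial of the rectangle `(s, …, s)` with `n` rows is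
`(x₁ ⋯ xₙ)^s`. -/
theorem schurDet_const (n s : ℕ) :
    schurDet (completeSeries (univ : Finset (Fin n))) (fun _ : Fin n => s) =
      ∏ i, (MvPolynomial.X i : MvPolynomial (Fin n) ℚ) ^ s := by
  set x : Fin n → MvPolynomial (Fin n) ℚ := MvPolynomial.X
  set F := completeSeries (univ : Finset (Fin n)) with hF
  set Q : Fin n → (MvPolynomial (Fin n) ℚ)⟦X⟧ := fun i => (elemPoly (univ.erase i) x :)
  have hQF : ∀ i, Q i * F = geomSeries (x i) := by
    intro i
    have h1 : F = geomSeries (x i) * ∏ j ∈ univ.erase i, geomSeries (x j) :=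
      (Finset.mul_prod_erase _ _ (mem_univ i)).symm
    rw [h1, mul_left_comm, elemPoly_mul_prod_geom, mul_one]
  set W : Matrix (Fin n) (Fin n) (MvPolynomial (Fin n) ℚ) :=
    Matrix.of fun i l => PowerSeries.coeff (l : ℕ) (Q i)
  have key : ∀ s : ℕ, W.det * schurDet F (fun _ : Fin n => s) =
      (∏ i, x i ^ s) * (Matrix.vandermonde x).det := by
    intro s
    rw [schurDet, ← Matrix.det_mul, ← Matrix.det_mul_column]
    congr 1
    ext1 i j
    have h1 := coeffZ_mul_of_coeff_eq_zero (Q := Q i) (F := F) (n := n)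
      (fun p hp => coeff_elemPoly_eq_zero _ _ (by
        rw [Finset.card_erase_of_mem (mem_univ i), Finset.card_univ, Fintype.card_fin]
        have := i.2
        omega)) ((s + j : ℕ) : ℤ)
    rw [hQF, coeffZ_natCast, geomSeries, PowerSeries.coeff_mk] at h1
    rw [Matrix.of_apply, Matrix.vandermonde_apply, ← pow_add, h1, Matrix.mul_apply,
      ← Fin.sum_univ_eq_sum_range
        (fun p => PowerSeries.coeff p (Q i) * coeffZ F (((s + j : ℕ) : ℤ) - (p : ℤ))) n]
    refine Finset.sum_congr rfl fun l _ => ?_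
    change PowerSeries.coeff (l : ℕ) (Q i) * coeffZ F ((s : ℤ) - (l : ℕ) + (j : ℕ)) = _
    congr 2
    push_cast
    ring
  have h0 := key 0
  rw [schurDet_zero (completeSeries_spec _).coeff_zero] at h0
  simp only [mul_one, pow_zero, Finset.prod_const_one, one_mul] at h0
  have hne : (Matrix.vandermonde x).det ≠ 0 :=
    Matrix.det_vandermonde_ne_zero_iff.mpr MvPolynomial.X_injective
  have hs := key s
  rw [h0, mul_comm] at hs
  exact mul_right_cancel₀ hne hs

/-- In `n` variables, the Schur polynomial of a partition with more than `n` rows vanishes. -/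
theorem eq_zero_of_schurDet_ne_zero {n : ℕ} {lam : Fin (2 * n) → ℕ}
    (h : schurDet (completeSeries (univ : Finset (Fin n))) lam ≠ 0) (l : Fin (2 * n))
    (hl : n ≤ (l : ℕ)) : lam l = 0 := by
  set x : Fin n → MvPolynomial (Fin n) ℚ := MvPolynomial.X
  set F := completeSeries (univ : Finset (Fin n)) with hF
  set Q : (MvPolynomial (Fin n) ℚ)⟦X⟧ := (elemPoly univ x :) with hQ
  have hQF : Q * F = 1 := elemPoly_mul_prod_geom _ _
  set A : Matrix (Fin (2 * n)) (Fin (2 * n)) (MvPolynomial (Fin n) ℚ) :=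
    Matrix.of fun i j => coeffZ F ((lam i : ℤ) - (i : ℕ) + (j : ℕ)) with hA
  have hV : (toeplitz (2 * n) Q).det = 1 := by
    rw [Matrix.det_of_isUpperTriangular]
    · refine Finset.prod_eq_one fun i _ => ?_
      rw [toeplitz_apply, sub_self]
      exact (coeffZ_natCast Q 0).trans (coeff_zero_elemPoly _ _)
    · intro i j hij
      have := Fin.lt_def.mp hij
      rw [toeplitz_apply, coeffZ_of_neg]
      simp only [id] at this
      omega
  have hAV : ∀ i l : Fin (2 * n), n ≤ (l : ℕ) →
      (A * toeplitz (2 * n) Q) i l = if (lam i : ℤ) - (i : ℕ) + (l : ℕ) = 0 then 1 else 0 := by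
    intro i l hl
    have h1 := coeffZ_mul_of_coeff_eq_zero (Q := Q) (F := F) (n := (l : ℕ) + 1)
      (fun p hp => coeff_elemPoly_eq_zero _ _ (by
        rw [Finset.card_univ, Fintype.card_fin]; omega)) ((lam i : ℤ) - (i : ℕ) + (l : ℕ))
    rw [hQF, coeffZ_one, ← Finset.sum_range_reflect] at h1
    rw [h1, Matrix.mul_apply]
    have h2 : ∀ j : Fin (2 * n), A i j * toeplitz (2 * n) Q j l =
        (fun j : ℕ => coeffZ F ((lam i : ℤ) - (i : ℕ) + j) * coeffZ Q ((l : ℕ) - (j : ℤ))) j :=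
      fun j => rfl
    simp only [h2]
    rw [Fin.sum_univ_eq_sum_range (fun j : ℕ =>
      coeffZ F ((lam i : ℤ) - (i : ℕ) + j) * coeffZ Q ((l : ℕ) - (j : ℤ))) (2 * n)]
    symm
    have h3 : Finset.range ((l : ℕ) + 1) ⊆ Finset.range (2 * n) :=
      Finset.range_subset_range.mpr l.2
    rw [← Finset.sum_subset h3]
    · refine Finset.sum_congr rfl fun j hj => ?_
      have hj := Finset.mem_range.mp hj
      rw [show ((l : ℕ) : ℤ) - (j : ℤ) = (((l : ℕ) + 1 - 1 - j : ℕ) : ℤ) by omega, coeffZ_natCast,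
        mul_comm]
      congr 2
      omega
    · intro j _ hj
      have hj := Finset.mem_range.not.mp hj
      rw [coeffZ_of_neg Q (by omega), mul_zero]
  have key : ∀ d : ℕ, ∀ l : Fin (2 * n), n ≤ (l : ℕ) → (l : ℕ) + d + 1 = 2 * n → lam l = 0 := by
    intro d
    induction d using Nat.strong_induction_on with
    | _ d ih =>
      intro l hl hd
      by_contra hne
      refine h ?_
      have h4 : schurDet F lam = (A * toeplitz (2 * n) Q).det := by
        rw [Matrix.det_mul, hV, mul_one]; rfl
      rw [h4]
      apply Matrix.det_eq_zero_of_column_eq_zero l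
      intro i
      rw [hAV i l hl, if_neg]
      intro h5
      by_cases hil : (i : ℕ) ≤ l
      · have h6 : (i : ℕ) = l := by omega
        rw [Fin.ext h6] at h5
        omega
      · have := ih (2 * n - (i : ℕ) - 1) (by omega) i (by omega) (by omega)
        omega
  exact key (2 * n - (l : ℕ) - 1) l hl (by omega)

/-- Trailing zeros do not change the determinant. -/
theorem schurDet_rectangle {F : R⟦X⟧} (hF : PowerSeries.coeff 0 F = 1) {n s : ℕ}
    {lam : Fin (2 * n) → ℕ} (h : ∀ i, lam i = if (i : ℕ) < n then s else 0) :
    schurDet F lam = schurDet F (fun _ : Fin n => s) := by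
  classical
  rw [schurDet, Matrix.twoBlockTriangular_det _ (fun i : Fin (2 * n) => (i : ℕ) < n)]
  · have h1 : (Matrix.toSquareBlockProp (Matrix.of fun i j : Fin (2 * n) =>
        coeffZ F ((lam i : ℤ) - (i : ℕ) + (j : ℕ))) fun i => ¬ (i : ℕ) < n).det = 1 := by
      rw [Matrix.det_of_isUpperTriangular]
      · refine Finset.prod_eq_one fun i _ => ?_
        rw [Matrix.toSquareBlockProp_def, Matrix.of_apply, Matrix.of_apply, h, if_neg i.2,
          show ((0 : ℕ) : ℤ) - (i.1 : ℕ) + (i.1 : ℕ) = (0 : ℕ) by push_cast; ring,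
          coeffZ_natCast, hF]
      · intro i j hij
        have hij : j < i := hij
        have := Fin.lt_def.mp (Subtype.coe_lt_coe.mpr hij)
        rw [Matrix.toSquareBlockProp_def, Matrix.of_apply, Matrix.of_apply, h, if_neg i.2,
          coeffZ_of_neg]
        push_cast
        omega
    rw [h1, mul_one, schurDet]
    let e : Fin n ≃ {i : Fin (2 * n) // (i : ℕ) < n} :=
      { toFun := fun i => ⟨⟨i, by omega⟩, i.2⟩
        invFun := fun i => ⟨i.1, i.2⟩
        left_inv := fun i => rfl
        right_inv := fun i => rfl }
    rw [← Matrix.det_submatrix_equiv_self e]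
    congr 1
    ext i j
    rw [Matrix.submatrix_apply, Matrix.toSquareBlockProp_def, Matrix.of_apply, Matrix.of_apply, h,
      if_pos (e i).2]
    rfl
  · intro i hi j hj
    rw [Matrix.of_apply, h, if_neg hi, coeffZ_of_neg]
    push_cast
    omega

end SchurDet

/-! ### The Jack function of a rectangle -/

section Rectangle

variable {n N s : ℕ}

/-- The coefficient `∏ᵢ (kᵢ - k_{2n+1-i})` of a self-dual partition. -/
def selfDualCoeff (lam : Fin (2 * n) → ℕ) : ℤ :=
  ∏ i : Fin n, (shiftedPart lam (firstHalf i) - shiftedPart lam (firstHalf i).rev)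

/-- The tau function as a symmetric function. -/
noncomputable def tauSymm (n N : ℕ) : SymmFun :=
  ∑ lam ∈ selfDual (2 * n) (n * (N - 2 * n)),
    (selfDualCoeff lam : SymmFun) * schurDet (dualSeries 1) lam

theorem map_tauSymm {R : Type*} [CommRing R] (f : SymmFun →+* R) :
    f (tauSymm n N) = ∑ lam ∈ selfDual (2 * n) (n * (N - 2 * n)),
      (selfDualCoeff lam : R) * schurDet (PowerSeries.map f (dualSeries 1)) lam := by
  rw [tauSymm, map_sum]
  refine Finset.sum_congr rfl fun lam _ => ?_
  rw [map_mul, map_intCast, map_schurDet]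

theorem dualSeries_half : dualSeries (1 / 2) = dualSeries 1 * dualSeries 1 := by
  refine (dualSeries_spec _).unique (R := SymmFun) ?_
  convert (dualSeries_spec 1).mul (dualSeries_spec 1) using 1
  ext1 m
  rw [map_add, dualLog, dualLog, PowerSeries.coeff_mk, PowerSeries.coeff_mk, ← add_mul, ← map_add]
  norm_num

theorem pfSum_eq_tauSymm (hn : 2 * n ≤ N) :
    pfSum (Matrix.of fun i j : Fin (2 * n) => (((j : ℕ) : SymmFun) - ((i : ℕ) : SymmFun)) *
        coeffZ (dualSeries (1 / 2)) ((N : ℤ) - (i : ℕ) - (j : ℕ) - 1)) =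
      2 ^ n * (n.factorial * tauSymm n N) := by
  rw [dualSeries_half, pfSum_eq_sum_selfDual hn]
  congr 2
  refine Finset.sum_congr rfl fun lam _ => ?_
  rw [selfDualCoeff, Int.cast_prod]

theorem sum_perm_pairs (σ : Equiv.Perm (Fin (2 * n))) :
    ∑ i : Fin n, ((σ (evenIdx i) : ℕ) + (σ (oddIdx i) : ℕ)) = n * (2 * n - 1) := by
  rw [← sum_pairs (fun j => (σ j : ℕ)), Equiv.sum_comp σ (fun j => (j : ℕ)),
    Fin.sum_univ_eq_sum_range (fun j => j) (2 * n)]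
  have := Finset.sum_range_id_mul_two (2 * n)
  rw [mul_assoc, mul_comm] at this
  exact Nat.eq_of_mul_eq_mul_left two_pos this

theorem tauSymm_mem_span (hn : 2 * n ≤ N) : tauSymm n N ∈
    Submodule.span ℚ {f | ∃ e : Fin n →₀ ℕ, ∑ i, e i = n * (N - 2 * n) ∧
      f = dualProd (1 / 2) e} := by
  set V := Submodule.span ℚ {f | ∃ e : Fin n →₀ ℕ, ∑ i, e i = n * (N - 2 * n) ∧
      f = dualProd (1 / 2) e} with hV
  have h1 : tauSymm n N = ((2 : ℚ) ^ n * n.factorial)⁻¹ •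
      ((2 : SymmFun) ^ n * (n.factorial * tauSymm n N)) := by
    have h2 : (2 : SymmFun) ^ n * (n.factorial * tauSymm n N) =
        ((2 : ℚ) ^ n * n.factorial) • tauSymm n N := by
      rw [Algebra.smul_def, ← mul_assoc, map_mul, map_pow, map_ofNat, map_natCast]
    rw [h2, smul_smul, inv_mul_cancel₀ (by positivity), one_smul]
  rw [h1, ← pfSum_eq_tauSymm hn]
  refine Submodule.smul_mem _ _ (Submodule.sum_mem _ fun σ _ => ?_)
  simp only [Matrix.of_apply]
  rw [← zsmul_eq_mul]
  refine zsmul_mem ?_ _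
  rw [Finset.prod_mul_distrib]
  have h3 : ∏ i : Fin n, (((σ (oddIdx i) : ℕ) : SymmFun) - ((σ (evenIdx i) : ℕ) : SymmFun)) =
      ((∏ i : Fin n, (((σ (oddIdx i) : ℕ) : ℤ) - ((σ (evenIdx i) : ℕ) : ℤ)) : ℤ) : SymmFun) := by
    push_cast
    rfl
  rw [h3, ← zsmul_eq_mul]
  refine zsmul_mem ?_ _
  by_cases hpos : ∀ i : Fin n, (σ (evenIdx i) : ℕ) + (σ (oddIdx i) : ℕ) + 1 ≤ N
  · refine Submodule.subset_span ⟨Finsupp.equivFunOnFinite.symm fun i =>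
      N - ((σ (evenIdx i) : ℕ) + (σ (oddIdx i) : ℕ) + 1), ?_, ?_⟩
    · have h4 := sum_perm_pairs σ
      have h5 : ∑ i : Fin n, ((N - ((σ (evenIdx i) : ℕ) + (σ (oddIdx i) : ℕ) + 1)) +
          ((σ (evenIdx i) : ℕ) + (σ (oddIdx i) : ℕ))) = ∑ i : Fin n, (N - 1) :=
        Finset.sum_congr rfl fun i _ => by have := hpos i; omega
      rw [Finset.sum_add_distrib, h4, Finset.sum_const, Finset.card_univ, Fintype.card_fin,
        smul_eq_mul] at h5
      simp only [Finsupp.equivFunOnFinite_symm_apply_apply]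
      rcases Nat.eq_zero_or_pos n with rfl | hn0
      · simp
      · have h6 : N - 1 = (N - 2 * n) + (2 * n - 1) := by omega
        rw [h6, mul_add] at h5
        omega
    · rw [dualProd]
      refine Finset.prod_congr rfl fun i _ => ?_
      have := hpos i
      rw [Finsupp.equivFunOnFinite_symm_apply_apply, dualFun, ← coeffZ_natCast]
      congr 1
      omega
  · push Not at hpos
    obtain ⟨i, hi⟩ := hpos
    rw [Finset.prod_eq_zero (mem_univ i) (coeffZ_of_neg _ (by omega))]
    exact Submodule.zero_mem _

theorem toPoly_dualFun_isHomogeneous (k m : ℕ) :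
    (toPoly k (dualFun (1 / 2) m)).IsHomogeneous m := by
  have h1 : toPoly k (dualFun (1 / 2) m) = PowerSeries.coeff m
      (completeSeries (univ : Finset (Fin k)) * completeSeries (univ : Finset (Fin k))) := by
    rw [dualFun, dualSeries_half, ← map_toPoly_dualSeries, ← map_mul, PowerSeries.coeff_map]
    rfl
  rw [h1, PowerSeries.coeff_mul]
  refine MvPolynomial.IsHomogeneous.sum _ _ _ fun p hp => ?_
  rw [← mem_antidiagonal.mp hp]
  exact (isHomogeneous_coeff_completeSeries _ _).mul (isHomogeneous_coeff_completeSeries _ _)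

theorem toPoly_tauSymm_isHomogeneous (hn : 2 * n ≤ N) (k : ℕ) :
    (toPoly k (tauSymm n N)).IsHomogeneous (n * (N - 2 * n)) := by
  have h1 := tauSymm_mem_span hn
  have h2 : Submodule.span ℚ {f | ∃ e : Fin n →₀ ℕ, ∑ i, e i = n * (N - 2 * n) ∧
      f = dualProd (1 / 2) e} ≤
      (MvPolynomial.homogeneousSubmodule (Fin k) ℚ (n * (N - 2 * n))).comap
        (toPoly k).toLinearMap := by
    rw [Submodule.span_le]
    rintro _ ⟨e, he, rfl⟩
    rw [SetLike.mem_coe, Submodule.mem_comap, MvPolynomial.mem_homogeneousSubmodule, ← he,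
      AlgHom.toLinearMap_apply, dualProd, map_prod]
    exact MvPolynomial.IsHomogeneous.prod _ _ _ fun i _ => toPoly_dualFun_isHomogeneous k (e i)
  exact h2 h1

/-- The coefficients of the monomials of a symmetric function depend only on the partition. -/
theorem exists_coeff_eq (f : SymmFun) (d : ℕ) : ∃ a : d.Partition → ℚ,
    ∀ (k : ℕ) (e : Fin k →₀ ℕ) (mu : d.Partition), mu.parts = expParts e →
      MvPolynomial.coeff e (toPoly k f) = a mu := by
  refine ⟨fun mu => jackForm 1 f (mu.parts.map (dualFun 1)).prod, fun k e mu hmu => ?_⟩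
  rw [coeff_toPoly one_ne_zero]
  simp only
  rw [hmu, dualProd, expParts, Multiset.map_map]
  congr 1
  symm
  exact Finset.prod_subset (Finset.subset_univ _) fun j _ hj => by
    rw [Function.comp_apply, Finsupp.notMem_support_iff.mp hj, dualFun_zero]

theorem exists_hasMonomialExpansion {f : SymmFun} {d : ℕ}
    (hf : ∀ k, (toPoly k f).IsHomogeneous d) : ∃ a : d.Partition → ℚ,
      HasMonomialExpansion f a := by
  obtain ⟨a, ha⟩ := exists_coeff_eq f d
  refine ⟨a, hasMonomialExpansion_iff.mpr fun k e => ?_⟩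
  by_cases h : ∃ mu : d.Partition, mu.parts = expParts e
  · obtain ⟨mu, hmu⟩ := h
    rw [ha k e mu hmu, Finset.sum_eq_single mu]
    · rw [if_pos hmu]
    · intro nu _ hnu
      rw [if_neg]
      contrapose! hnu
      exact Nat.Partition.ext (hnu.trans hmu.symm)
    · simp
  · push Not at h
    rw [Finset.sum_eq_zero fun mu _ => if_neg (h mu)]
    apply (hf k).coeff_eq_zero
    intro hd
    refine h ⟨expParts e, ?_, ?_⟩ rfl
    · intro i hi
      obtain ⟨j, hj, rfl⟩ := Multiset.mem_map.mp hi
      exact Nat.pos_of_ne_zero (Finsupp.mem_support_iff.mp hj)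
    · rw [sum_expParts, ← hd, Finsupp.degree_eq_sum]

theorem rectangle_parts (n s : ℕ) : (rectangle n s).parts = if s = 0 then 0
    else Multiset.replicate n s := by
  change (Multiset.replicate n s).filter (· ≠ 0) = _
  split_ifs with h
  · rw [Multiset.filter_eq_nil]
    intro a ha
    simp [Multiset.eq_of_mem_replicate ha, h]
  · rw [Multiset.filter_eq_self]
    intro a ha
    rw [Multiset.eq_of_mem_replicate ha]
    exact h

theorem partialSums_rectangle (n s r : ℕ) : partialSums (rectangle n s) r = min r n * s := by
  rw [partialSums, rectangle_parts]
  split_ifs with h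
  · simp [h]
  · have : (Multiset.replicate n s).sort (· ≥ ·) = List.replicate n s := by
      rw [List.eq_replicate_iff]
      refine ⟨by simp, fun b hb => Multiset.eq_of_mem_replicate ((Multiset.mem_sort _).mp hb)⟩
    rw [this, List.take_replicate, List.sum_replicate, smul_eq_mul]

theorem le_of_dominatedBy_rectangle {mu : (n * s).Partition} (h : DominatedBy mu (rectangle n s))
    {p : ℕ} (hp : p ∈ mu.parts) : p ≤ s := by
  have h1 := dominatedBy_iff.mp h 1
  rw [partialSums_rectangle] at h1
  have h2 : min 1 n * s ≤ s := by
    calc min 1 n * s ≤ 1 * s := Nat.mul_le_mul_right s (min_le_left _ _)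
      _ = s := one_mul s
  refine le_trans ?_ (h1.trans h2)
  rw [partialSums]
  have h3 : p ∈ mu.parts.sort (· ≥ ·) := (Multiset.mem_sort _).mpr hp
  have h4 := Multiset.pairwise_sort mu.parts (· ≥ ·)
  cases hl : mu.parts.sort (· ≥ ·) with
  | nil => rw [hl] at h3; simp at h3
  | cons a l =>
    rw [hl] at h3 h4
    simp only [List.take_succ_cons, List.take_zero, List.sum_cons, List.sum_nil, add_zero]
    rcases List.mem_cons.mp h3 with h5 | h5
    · exact h5.le
    · exact (List.pairwise_cons.mp h4).1 p h5

theorem dominatedBy_rectangle {mu : (n * s).Partition} (h : ∀ p ∈ mu.parts, p ≤ s) :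
    DominatedBy mu (rectangle n s) := by
  rw [dominatedBy_iff]
  intro r
  rw [partialSums_rectangle, partialSums]
  set l := mu.parts.sort (· ≥ ·) with hl
  rcases le_total r n with hr | hr
  · rw [min_eq_left hr]
    have h1 : (l.take r).sum ≤ (l.take r).length • s := by
      apply List.sum_le_card_nsmul
      intro x hx
      exact h x ((Multiset.mem_sort _).mp (List.mem_of_mem_take hx))
    refine h1.trans ?_
    rw [smul_eq_mul]
    exact Nat.mul_le_mul_right s (by simp)
  · rw [min_eq_right hr]
    have h1 : l.sum = n * s := by
      rw [← Multiset.sum_coe, hl, Multiset.sort_eq, mu.parts_sum]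
    rw [← h1]
    conv_rhs => rw [← List.take_append_drop r l, List.sum_append]
    exact Nat.le_add_right _ _

theorem expParts_const (n s : ℕ) :
    (rectangle n s).parts = expParts (Finsupp.equivFunOnFinite.symm fun _ : Fin n => s) := by
  rw [rectangle_parts]
  split_ifs with h
  · subst h
    have : (Finsupp.equivFunOnFinite.symm fun _ : Fin n => 0) = 0 := by ext; simp
    rw [this]
    rfl
  · have h1 : (Finsupp.equivFunOnFinite.symm fun _ : Fin n => s).support = univ := by
      ext j
      simp [h]
    rw [expParts, h1]
    symm
    rw [Multiset.eq_replicate]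
    refine ⟨by simp, fun b hb => ?_⟩
    obtain ⟨j, -, rfl⟩ := Multiset.mem_map.mp hb
    simp

/-- A product of `n` dual functions is orthogonal to all functions with monomials strictly below the
rectangle with `n` rows. -/
theorem jackForm_dualProd_eq_zero {α : ℚ} (hα : α ≠ 0) {e : Fin n →₀ ℕ} (he : ∑ i, e i = n * s)
    {g : SymmFun} {a : (n * s).Partition → ℚ}
    (ha : ∀ mu, a mu ≠ 0 → DominatedBy mu (rectangle n s) ∧ mu ≠ rectangle n s)
    (hg : HasMonomialExpansion g a) : jackForm α (dualProd α e) g = 0 := by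
  rw [jackForm_apply, jackInner_comm, ← jackForm_apply, ← coeff_toPoly hα]
  by_contra hne
  by_cases h : ∃ mu : (n * s).Partition, mu.parts = expParts e
  · obtain ⟨mu, hmu⟩ := h
    rw [hg.coeff_eq hmu] at hne
    obtain ⟨h1, h2⟩ := ha mu hne
    have h3 : ∀ i ∈ univ, e i ≤ s := by
      intro i _
      rcases Nat.eq_zero_or_pos (e i) with h0 | h0
      · omega
      · exact le_of_dominatedBy_rectangle h1 (hmu ▸ mem_expParts_of_ne_zero e h0.ne')
    have h4 : ∑ i, e i = ∑ _i : Fin n, s := by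
      rw [he, Finset.sum_const, Finset.card_univ, Fintype.card_fin, smul_eq_mul]
    have h5 := (Finset.sum_eq_sum_iff_of_le h3).mp h4
    apply h2
    apply Nat.Partition.ext
    rw [hmu, expParts_const]
    congr 1
    ext i
    rw [h5 i (mem_univ i)]
    simp
  · push Not at h
    exact hne (hg.coeff_eq_zero h)

theorem selfDual_le {lam : Fin (2 * n) → ℕ} (h : lam ∈ selfDual (2 * n) (n * s))
    (i : Fin (2 * n)) : lam i ≤ s := by
  have := (mem_selfDual.mp h).2 i
  omega

theorem degreeOf_toPoly_tauSymm_le (k : ℕ) (j : Fin k) :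
    (toPoly k (tauSymm n N)).degreeOf j ≤ N - 2 * n := by
  have h1 := map_tauSymm (n := n) (N := N) (toPoly k : SymmFun →+* MvPolynomial (Fin k) ℚ)
  rw [map_toPoly_dualSeries] at h1
  have h2 : toPoly k (tauSymm n N) = (toPoly k : SymmFun →+* MvPolynomial (Fin k) ℚ) (tauSymm n N) :=
    rfl
  rw [h2, h1]
  refine (MvPolynomial.degreeOf_sum_le _ _ _).trans (Finset.sup_le fun lam hlam => ?_)
  refine (MvPolynomial.degreeOf_mul_le _ _ _).trans ?_
  have h3 : (selfDualCoeff lam : MvPolynomial (Fin k) ℚ) =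
      MvPolynomial.C (selfDualCoeff lam : ℚ) := by simp
  rw [h3, MvPolynomial.degreeOf_C, zero_add]
  exact degreeOf_schurDet_le (selfDual_le hlam) j

/-- The rectangle `(s, …, s, 0, …, 0)` with `n` nonzero rows out of `2n`. -/
def halfRectangle (n s : ℕ) (i : Fin (2 * n)) : ℕ := if (i : ℕ) < n then s else 0

theorem halfRectangle_mem_selfDual (n s : ℕ) : halfRectangle n s ∈ selfDual (2 * n) (n * s) := by
  rw [mem_selfDual]
  constructor
  · intro i j hij
    have := Fin.le_def.mp hij
    unfold halfRectangle
    split_ifs <;> omega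
  · intro i
    have := Fin.val_rev i
    unfold halfRectangle
    split_ifs <;> omega

theorem selfDualCoeff_halfRectangle (hn : 2 * n ≤ N) :
    selfDualCoeff (halfRectangle n (N - 2 * n)) = ∏ i : Fin n, ((N : ℤ) - 1 - 2 * (i : ℕ)) := by
  refine Finset.prod_congr rfl fun i _ => ?_
  have h1 := firstHalf_rev_apply (mem_selfDual.mp (halfRectangle_mem_selfDual n (N - 2 * n))).2 i
  have h2 : ((firstHalf i : Fin (2 * n)) : ℕ) = i := rfl
  rw [shiftedPart_rev_firstHalf] at h1 ⊢
  have h3 : halfRectangle n (N - 2 * n) (firstHalf i).rev = 0 := by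
    rw [halfRectangle, if_neg]
    rw [Fin.val_rev, h2]
    omega
  rw [h3] at h1 ⊢
  push_cast at h1 ⊢
  omega

theorem toPoly_tauSymm_self (hn : 2 * n ≤ N) : toPoly n (tauSymm n N) =
    MvPolynomial.C (∏ i : Fin n, ((N : ℚ) - 1 - 2 * ((i : ℕ) : ℚ))) *
      MvPolynomial.monomial (Finsupp.equivFunOnFinite.symm fun _ : Fin n => N - 2 * n) 1 := by
  have h1 := map_tauSymm (n := n) (N := N) (toPoly n : SymmFun →+* MvPolynomial (Fin n) ℚ)
  rw [map_toPoly_dualSeries] at h1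
  have h2 : toPoly n (tauSymm n N) = (toPoly n : SymmFun →+* MvPolynomial (Fin n) ℚ) (tauSymm n N) :=
    rfl
  rw [h2, h1, Finset.sum_eq_single (halfRectangle n (N - 2 * n))]
  · rw [schurDet_rectangle (lam := halfRectangle n (N - 2 * n)) (s := N - 2 * n)
      (completeSeries_spec _).coeff_zero (fun i => rfl), schurDet_const,
      selfDualCoeff_halfRectangle hn]
    congr 1
    · rw [map_prod, Int.cast_prod]
      refine Finset.prod_congr rfl fun i _ => ?_
      push_cast
      rw [map_sub, map_sub, map_mul, map_natCast, map_natCast, map_one, map_ofNat]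
    · rw [MvPolynomial.monomial_eq, map_one, one_mul, Finsupp.prod_fintype _ _ (by simp)]
      simp
  · intro lam hlam hne
    rw [mul_eq_zero]
    right
    by_contra h
    apply hne
    have h3 := (mem_selfDual.mp hlam).2
    funext i
    rw [halfRectangle]
    split_ifs with hi
    · have h4 := eq_zero_of_schurDet_ne_zero h i.rev (by rw [Fin.val_rev]; omega)
      have h5 := h3 i
      omega
    · exact eq_zero_of_schurDet_ne_zero h i (by omega)
  · intro h
    exact absurd (halfRectangle_mem_selfDual _ _) h

theorem prod_ne_zero_of_le {K : Type*} [Field K] [CharZero K] (hn : 2 * n ≤ N) :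
    ∏ i : Fin n, ((N : K) - 1 - 2 * ((i : ℕ) : K)) ≠ 0 := by
  rw [Finset.prod_ne_zero_iff]
  intro i _ h
  have h1 : ((N : ℤ) - 1 - 2 * ((i : ℕ) : ℤ)) = 0 := by
    have : (((N : ℤ) - 1 - 2 * ((i : ℕ) : ℤ) : ℤ) : K) = 0 := by push_cast; exact h
    exact_mod_cast this
  omega

/-- The monic Jack function of the rectangle with `n` rows of length `N - 2n`. -/
noncomputable def rectangleJack (n N : ℕ) : SymmFun :=
  (∏ i : Fin n, ((N : ℚ) - 1 - 2 * ((i : ℕ) : ℚ)))⁻¹ • tauSymm n N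

theorem isJack_rectangleJack (hn : 2 * n ≤ N) :
    IsJack (1 / 2) (rectangle n (N - 2 * n)) (rectangleJack n N) := by
  set c : ℚ := ∏ i : Fin n, ((N : ℚ) - 1 - 2 * ((i : ℕ) : ℚ)) with hc
  have hc0 : c ≠ 0 := prod_ne_zero_of_le hn
  constructor
  · obtain ⟨a, ha⟩ := exists_hasMonomialExpansion (f := rectangleJack n N) (d := n * (N - 2 * n))
      (fun k => by
        rw [rectangleJack, map_smul, MvPolynomial.smul_eq_C_mul]
        exact (toPoly_tauSymm_isHomogeneous hn k).C_mul _)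
    refine ⟨a, ?_, ?_, ha⟩
    · rw [← ha.coeff_eq (expParts_const n (N - 2 * n)), rectangleJack, map_smul,
        toPoly_tauSymm_self hn, MvPolynomial.coeff_smul, MvPolynomial.coeff_C_mul,
        MvPolynomial.coeff_monomial, if_pos rfl, mul_one, smul_eq_mul, inv_mul_cancel₀ hc0]
    · intro mu hmu
      obtain ⟨k, e, he⟩ := exists_expParts_eq mu
      rw [← ha.coeff_eq he, rectangleJack, map_smul, MvPolynomial.coeff_smul] at hmu
      have hmu' := right_ne_zero_of_smul hmu
      apply dominatedBy_rectangle
      intro p hp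
      rw [he] at hp
      obtain ⟨j, -, rfl⟩ := Multiset.mem_map.mp hp
      refine le_trans ?_ (degreeOf_toPoly_tauSymm_le (n := n) (N := N) k j)
      exact MvPolynomial.monomial_le_degreeOf j (MvPolynomial.mem_support_iff.mpr hmu')
  · intro g a ha hg
    rw [← jackForm_apply, rectangleJack, map_smul, LinearMap.smul_apply, smul_eq_zero]
    right
    have h1 : Submodule.span ℚ {f | ∃ e : Fin n →₀ ℕ, ∑ i, e i = n * (N - 2 * n) ∧
        f = dualProd (1 / 2) e} ≤ LinearMap.ker ((jackForm (1 / 2)).flip g) := by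
      rw [Submodule.span_le]
      rintro _ ⟨e, he, rfl⟩
      exact jackForm_dualProd_eq_zero (by norm_num) he ha hg
    exact h1 (tauSymm_mem_span hn)

end Rectangle

/-! ### The expansions of the tau function -/

section Tau

variable {n N : ℕ} {b : ℕ → ℂ}

theorem pfaffian_eq_sum_schur (hn : 2 * n ≤ N) (t : ℕ+ → ℂ) :
    pfaffian (Matrix.of fun i j : Fin (2 * n) => (((j : ℕ) : ℂ) - ((i : ℕ) : ℂ)) *
        elemSchur (fun r => 2 * t r) ((N : ℤ) - (i : ℕ) - (j : ℕ) - 1)) =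
      ∑ lam ∈ selfDual (2 * n) (n * (N - 2 * n)),
        (∏ i : Fin n, ((shiftedPart lam (firstHalf i) -
          shiftedPart lam (firstHalf i).rev : ℤ) : ℂ)) * schur lam t := by
  have h := pfSum_eq_sum_selfDual hn (timeExp t)
  rw [← timeExp_two_mul] at h
  rw [pfaffian_eq]
  simp only [elemSchur_eq]
  rw [h, ← mul_assoc (2 ^ n : ℂ), inv_mul_cancel_left₀]
  · rfl
  · have : (n.factorial : ℂ) ≠ 0 := by exact_mod_cast n.factorial_ne_zero
    exact mul_ne_zero (pow_ne_zero _ two_ne_zero) this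

theorem tau_eq_pfaffian (hn : 2 * n ≤ N)
    (hb : ∀ i, i < N / 2 → b i = if Even N then 2 * (i : ℂ) + 1 else 2 * (i : ℂ) + 2)
    (t : ℕ+ → ℂ) : tau hn b t =
      pfaffian (Matrix.of fun i j : Fin (2 * n) => (((j : ℕ) : ℂ) - ((i : ℕ) : ℂ)) *
        elemSchur (fun r => 2 * t r) ((N : ℤ) - (i : ℕ) - (j : ℕ) - 1)) := by
  rw [tau, moment_eq hn b hb]

theorem tau_eq_sum_schur (hn : 2 * n ≤ N)
    (hb : ∀ i, i < N / 2 → b i = if Even N then 2 * (i : ℂ) + 1 else 2 * (i : ℂ) + 2)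
    (t : ℕ+ → ℂ) : tau hn b t =
      ∑ lam ∈ selfDual (2 * n) (n * (N - 2 * n)),
        (∏ i : Fin n, ((shiftedPart lam (firstHalf i) -
          shiftedPart lam (firstHalf i).rev : ℤ) : ℂ)) * schur lam t := by
  rw [tau_eq_pfaffian hn hb, pfaffian_eq_sum_schur hn]

theorem b_shiftedPart (hn : 2 * n ≤ N)
    (hb : ∀ i, i < N / 2 → b i = if Even N then 2 * (i : ℂ) + 1 else 2 * (i : ℂ) + 2)
    {lam : Fin (2 * n) → ℕ} (hlam : lam ∈ selfDual (2 * n) (n * (N - 2 * n))) (i : Fin n) :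
    b (shiftedPart lam (firstHalf i) - ((N + 1) / 2 : ℕ)).toNat =
      ((shiftedPart lam (firstHalf i) - shiftedPart lam (firstHalf i).rev : ℤ) : ℂ) := by
  obtain ⟨h0, h⟩ := mem_selfDual.mp hlam
  have h1 := lowerHalf_lt hn h0 h i
  have h2 := firstHalf_rev_apply h i
  have h3 := shiftedPart_rev_firstHalf lam i
  rw [lowerHalf_val] at h1
  set k := shiftedPart lam (firstHalf i)
  set k' := shiftedPart lam (firstHalf i).rev
  obtain ⟨m, hm⟩ : ∃ m : ℕ, k - ((N + 1) / 2 : ℕ) = m := ⟨(k - ((N + 1) / 2 : ℕ)).toNat, by omega⟩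
  rw [hm, Int.toNat_natCast, hb m (by omega)]
  split_ifs with he
  · have := Nat.even_iff.mp he
    have h5 : k - k' = 2 * m + 1 := by omega
    rw [h5]; push_cast; ring
  · have := Nat.not_even_iff.mp he
    have h5 : k - k' = 2 * m + 2 := by omega
    rw [h5]; push_cast; ring

theorem map_eval_dualSeries {k : ℕ} (x : Fin k → ℂ) :
    PowerSeries.map (MvPolynomial.aeval (fun i : ℕ+ => ∑ j, x j ^ (i : ℕ)) : SymmFun →ₐ[ℚ] ℂ).toRingHom
      (dualSeries 1) = timeExp (fun i => (1 / ((i : ℕ) : ℂ)) * ∑ j, x j ^ (i : ℕ)) := by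
  refine ((dualSeries_spec 1).map _).unique (R := ℂ) ?_
  convert timeExp_spec (fun i => (1 / ((i : ℕ) : ℂ)) * ∑ j, x j ^ (i : ℕ)) using 1
  ext1 m
  have hm : (m : ℂ) + 1 ≠ 0 := by exact_mod_cast m.succ_ne_zero
  rw [PowerSeries.coeff_map, dualLog, PowerSeries.coeff_mk, PowerSeries.coeff_derivative,
    timeSeries, PowerSeries.coeff_mk, dif_pos m.succ_pos]
  simp only [AlgHom.toRingHom_eq_coe, RingHom.coe_coe, MvPolynomial.aeval_X,
    Nat.succPNat_coe, PNat.mk_coe, inv_one, map_one, one_mul]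
  push_cast
  field_simp

theorem tau_eq_evalSymm (hn : 2 * n ≤ N)
    (hb : ∀ i, i < N / 2 → b i = if Even N then 2 * (i : ℂ) + 1 else 2 * (i : ℂ) + 2)
    {k : ℕ} (x : Fin k → ℂ) :
    tau hn b (fun i => (1 / ((i : ℕ) : ℂ)) * ∑ j, x j ^ (i : ℕ)) =
      (∏ i : Fin n, ((N : ℂ) - 1 - 2 * ((i : ℕ) : ℂ))) * evalSymm (rectangleJack n N) x := by
  have hc0 : (∏ i : Fin n, ((N : ℂ) - 1 - 2 * ((i : ℕ) : ℂ))) ≠ 0 := prod_ne_zero_of_le hn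
  have h1 := map_tauSymm (n := n) (N := N)
    (MvPolynomial.aeval (fun i : ℕ+ => ∑ j, x j ^ (i : ℕ)) : SymmFun →ₐ[ℚ] ℂ).toRingHom
  rw [map_eval_dualSeries] at h1
  have h2 : evalSymm (rectangleJack n N) x = (∏ i : Fin n, ((N : ℂ) - 1 - 2 * ((i : ℕ) : ℂ)))⁻¹ *
      (MvPolynomial.aeval (fun i : ℕ+ => ∑ j, x j ^ (i : ℕ)) : SymmFun →ₐ[ℚ] ℂ).toRingHom
        (tauSymm n N) := by
    rw [evalSymm, rectangleJack, map_smul, Algebra.smul_def, map_inv₀, map_prod]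
    simp
  rw [h2, h1, mul_inv_cancel_left₀ hc0, tau_eq_sum_schur hn hb]
  refine Finset.sum_congr rfl fun lam _ => ?_
  rw [selfDualCoeff, Int.cast_prod, schur_eq_schurDet]

end Tau

/-! ### Taylor series of analytic functions -/

section Taylor

/-- `F` is the Taylor series at `0` of the analytic function `f`. -/
structure HasTaylor (f : ℝ → ℂ) (F : ℂ⟦X⟧) : Prop where
  analytic : AnalyticAt ℝ f 0
  iteratedDeriv_eq : ∀ m : ℕ, iteratedDeriv m f 0 = m.factorial * PowerSeries.coeff m F

variable {f g : ℝ → ℂ} {F G : ℂ⟦X⟧}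

theorem HasTaylor.mul (hf : HasTaylor f F) (hg : HasTaylor g G) :
    HasTaylor (fun u => f u * g u) (F * G) where
  analytic := hf.analytic.fun_mul hg.analytic
  iteratedDeriv_eq m := by
    rw [iteratedDeriv_fun_mul hf.analytic.contDiffAt hg.analytic.contDiffAt, PowerSeries.coeff_mul,
      Finset.mul_sum, Finset.Nat.sum_antidiagonal_eq_sum_range_succ_mk]
    refine Finset.sum_congr rfl fun i hi => ?_
    have hi : i ≤ m := Nat.lt_succ_iff.mp (Finset.mem_range.mp hi)
    have hc : (m.factorial : ℂ) = (m.choose i) * i.factorial * (m - i).factorial := by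
      exact_mod_cast (Nat.choose_mul_factorial_mul_factorial hi).symm
    rw [hf.iteratedDeriv_eq, hg.iteratedDeriv_eq, hc]
    ring

theorem hasTaylor_of_hasSum {c : ℕ → ℂ}
    (h : ∀ᶠ u : ℝ in 𝓝 0, HasSum (fun m => (u : ℂ) ^ m * c m) (f u)) :
    HasTaylor f (PowerSeries.mk c) := by
  set p : FormalMultilinearSeries ℝ ℝ ℂ := fun m =>
    ContinuousMultilinearMap.mkPiRing ℝ (Fin m) (c m) with hp
  have hcoeff : ∀ m, p.coeff m = c m := by
    intro m
    simp [FormalMultilinearSeries.coeff, hp]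
  have h1 : HasFPowerSeriesAt f p 0 := by
    rw [hasFPowerSeriesAt_iff]
    filter_upwards [h] with u hu
    have h2 : (fun m => u ^ m • p.coeff m) = fun m => (u : ℂ) ^ m * c m := by
      funext m
      rw [hcoeff, Complex.real_smul]
      push_cast
      rfl
    rw [zero_add, h2]
    exact hu
  refine ⟨h1.analyticAt, fun m => ?_⟩
  obtain ⟨r, hr⟩ := h1
  rw [iteratedDeriv_eq_iteratedFDeriv, ← hr.factorial_smul 1 m, PowerSeries.coeff_mk, nsmul_eq_mul]
  congr 1
  exact hcoeff m

theorem HasTaylor.deriv (hf : HasTaylor f F) :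
    HasTaylor (deriv f) (PowerSeries.derivative ℂ F) where
  analytic := hf.analytic.deriv
  iteratedDeriv_eq m := by
    rw [← iteratedDeriv_succ', hf.iteratedDeriv_eq, PowerSeries.coeff_derivative,
      Nat.factorial_succ]
    push_cast
    ring

theorem HasTaylor.congr (hf : HasTaylor f F) (h : f =ᶠ[𝓝 0] g) : HasTaylor g F where
  analytic := hf.analytic.congr h
  iteratedDeriv_eq m := by rw [← h.iteratedDeriv_eq, hf.iteratedDeriv_eq]

theorem HasTaylor.unique (hf : HasTaylor f F) (hf' : HasTaylor f G) : F = G := by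
  ext m
  have := (hf.iteratedDeriv_eq m).symm.trans (hf'.iteratedDeriv_eq m)
  exact mul_left_cancel₀ (by exact_mod_cast m.factorial_ne_zero) this

theorem HasTaylor.cexp (hf : HasTaylor f F) (h0 : f 0 = 0) :
    ∃ E, HasTaylor (fun u => Complex.exp (f u)) E ∧
      IsExpSolution (PowerSeries.derivative ℂ F) E := by
  have han : AnalyticAt ℝ (fun u => Complex.exp (f u)) 0 :=
    AnalyticAt.fun_comp (g := Complex.exp) (analyticAt_cexp.restrictScalars (𝕜 := ℝ)) hf.analytic
  set E : ℂ⟦X⟧ := PowerSeries.mk fun m =>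
    iteratedDeriv m (fun u => Complex.exp (f u)) 0 / m.factorial with hE
  have hET : HasTaylor (fun u => Complex.exp (f u)) E := by
    refine ⟨han, fun m => ?_⟩
    have : (m.factorial : ℂ) ≠ 0 := by exact_mod_cast m.factorial_ne_zero
    rw [hE, PowerSeries.coeff_mk]
    field_simp
  refine ⟨E, hET, ?_, ?_⟩
  · refine hET.deriv.unique ((hf.deriv.mul hET).congr ?_)
    filter_upwards [hf.analytic.eventually_analyticAt] with u hu
    have h1 : HasDerivAt f (_root_.deriv f u) u := hu.differentiableAt.hasDerivAt
    rw [h1.cexp.deriv, mul_comm]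
  · rw [← PowerSeries.coeff_zero_eq_constantCoeff_apply, hE, PowerSeries.coeff_mk]
    simp [h0]

theorem hasTaylor_const_mul_pow (c : ℂ) (p : ℕ) :
    HasTaylor (fun u : ℝ => c * (u : ℂ) ^ p) (PowerSeries.C c * PowerSeries.X ^ p) := by
  have h : (PowerSeries.C c * PowerSeries.X ^ p : ℂ⟦X⟧) =
      PowerSeries.mk fun m => if m = p then c else 0 := by
    ext m
    rw [PowerSeries.coeff_C_mul, PowerSeries.coeff_X_pow, PowerSeries.coeff_mk]
    split_ifs <;> simp
  rw [h]
  refine hasTaylor_of_hasSum (Filter.Eventually.of_forall fun u => ?_)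
  convert hasSum_single p ?_ using 1
  · simp [mul_comm]
  · intro m hm
    simp [hm]

theorem hasTaylor_times {t : ℕ+ → ℂ}
    (ht : ∃ r : ℝ, 0 < r ∧ Summable fun i : ℕ+ => ‖t i‖ * r ^ (i : ℕ)) :
    HasTaylor (fun u : ℝ => ∑' i : ℕ+, t i * (u : ℂ) ^ (i : ℕ)) (timeSeries t) := by
  obtain ⟨r, hr, hs⟩ := ht
  apply hasTaylor_of_hasSum
  filter_upwards [Metric.ball_mem_nhds (0 : ℝ) hr] with u hu
  rw [Metric.mem_ball, dist_zero_right] at hu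
  have h1 : Summable fun i : ℕ+ => t i * (u : ℂ) ^ (i : ℕ) := by
    refine Summable.of_norm_bounded hs fun i => ?_
    rw [norm_mul, norm_pow, Complex.norm_real]
    gcongr
  have h2 := h1.hasSum
  rw [← PNat.coe_injective.hasSum_iff (f := fun m : ℕ => (u : ℂ) ^ m *
    (if h : 0 < m then t ⟨m, h⟩ else 0))]
  · convert h2 using 2 with i
    simp only [Function.comp_apply]
    rw [dif_pos i.pos, mul_comm]
    rfl
  · intro m hm
    rw [dif_neg, mul_zero]
    intro h
    exact hm ⟨⟨m, h⟩, rfl⟩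

theorem hasTaylor_exp_times {t : ℕ+ → ℂ}
    (ht : ∃ r : ℝ, 0 < r ∧ Summable fun i : ℕ+ => ‖t i‖ * r ^ (i : ℕ)) :
    HasTaylor (fun u : ℝ => Complex.exp (2 * ∑' i : ℕ+, t i * (u : ℂ) ^ (i : ℕ)))
      (timeExp fun r => 2 * t r) := by
  have h1 := hasTaylor_times ht
  have h2 := (hasTaylor_const_mul_pow 2 0).mul h1
  simp only [pow_zero, mul_one] at h2
  have h3 : PowerSeries.C (2 : ℂ) * timeSeries t = timeSeries fun r => 2 * t r := by
    ext m
    rw [PowerSeries.coeff_C_mul, timeSeries, timeSeries, PowerSeries.coeff_mk,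
      PowerSeries.coeff_mk]
    split_ifs <;> simp
  rw [h3] at h2
  obtain ⟨E, hE, hE'⟩ := h2.cexp (by
    have := h1.iteratedDeriv_eq 0
    rw [iteratedDeriv_zero] at this
    rw [this]
    simp [constantCoeff_timeSeries])
  rwa [hE'.unique (timeExp_spec _)] at hE

end Taylor

/-! ### The confluent Vandermonde determinant -/

section Confluent

variable {n : ℕ}

theorem prod_Ioi_eq {M : Type*} [CommMonoid M] (f : Fin n → M) (i : Fin n) :
    ∏ j ∈ Finset.Ioi i, f j = ∏ j, if i < j then f j else 1 := by
  rw [← Finset.prod_filter]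
  congr 1
  ext j
  simp

/-- The Vandermonde determinant of the points `zₖ, zₖ + ε`. -/
theorem det_vandermonde_pairs {R : Type*} [CommRing R] (w : Fin (2 * n) → R) (z : Fin n → R) (ε : R)
    (h0 : ∀ k, w (evenIdx k) = z k) (h1 : ∀ k, w (oddIdx k) = z k + ε) :
    (Matrix.vandermonde w).det = ε ^ n * ∏ k, ∏ l ∈ Finset.Ioi k,
      ((z l - z k) ^ 2 * (z l - z k + ε) * (z l - z k - ε)) := by
  rw [Matrix.det_vandermonde, prod_pairs]
  have key : ∀ k : Fin n, (∏ j ∈ Finset.Ioi (evenIdx k), (w j - w (evenIdx k))) *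
      (∏ j ∈ Finset.Ioi (oddIdx k), (w j - w (oddIdx k))) =
      ε * ∏ l ∈ Finset.Ioi k, ((z l - z k) ^ 2 * (z l - z k + ε) * (z l - z k - ε)) := by
    intro k
    have hε : ∀ y : R, ε * y = (∏ l : Fin n, if k = l then ε else 1) * y := fun y => by simp
    rw [prod_Ioi_eq, prod_Ioi_eq, prod_Ioi_eq, prod_pairs, prod_pairs]
    rw [hε, ← Finset.prod_mul_distrib, ← Finset.prod_mul_distrib]
    refine Finset.prod_congr rfl fun l _ => ?_
    simp only [h0, h1]
    simp only [Fin.lt_def, evenIdx, oddIdx, Fin.ext_iff]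
    rcases lt_trichotomy (k : ℕ) l with h | h | h
    · rw [if_pos (by omega), if_pos (by omega), if_pos (by omega), if_pos (by omega),
        if_neg (by omega), if_pos (by omega)]
      ring
    · rw [if_neg (by omega), if_pos (by omega), if_neg (by omega), if_neg (by omega),
        if_pos (by omega), if_neg (by omega), Fin.ext h]
      ring
    · rw [if_neg (by omega), if_neg (by omega), if_neg (by omega), if_neg (by omega),
        if_neg (by omega), if_neg (by omega)]
      ring
  rw [Finset.prod_congr rfl fun k _ => key k, Finset.prod_mul_distrib, Finset.prod_const,
    Finset.card_univ, Fintype.card_fin]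

/-- The confluent Vandermonde matrix with the rows `zₖʲ` and `j zₖʲ⁻¹`. -/
def confluent {R : Type*} [CommRing R] (z : Fin n → R) : Matrix (Fin (2 * n)) (Fin (2 * n)) R :=
  Matrix.of fun i j => if ((pairEquiv n).symm i).2 = 0 then z ((pairEquiv n).symm i).1 ^ (j : ℕ)
    else (j : ℕ) * z ((pairEquiv n).symm i).1 ^ ((j : ℕ) - 1)

theorem confluent_even {R : Type*} [CommRing R] (z : Fin n → R) (k : Fin n) (j : Fin (2 * n)) :
    confluent z (evenIdx k) j = z k ^ (j : ℕ) := by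
  rw [confluent, Matrix.of_apply, ← pairEquiv_zero, Equiv.symm_apply_apply, if_pos rfl]

theorem confluent_odd {R : Type*} [CommRing R] (z : Fin n → R) (k : Fin n) (j : Fin (2 * n)) :
    confluent z (oddIdx k) j = (j : ℕ) * z k ^ ((j : ℕ) - 1) := by
  rw [confluent, Matrix.of_apply, ← pairEquiv_one, Equiv.symm_apply_apply, if_neg (by simp)]

/-- The lower triangular matrix of the row operations `r_{2k+1} ↦ r_{2k} + ε r_{2k+1}`. -/
def pairRowOp {R : Type*} [CommRing R] (n : ℕ) (ε : R) : Matrix (Fin (2 * n)) (Fin (2 * n)) R :=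
  Matrix.of fun i j => if i = j then (if (i : ℕ) % 2 = 0 then 1 else ε)
    else if (i : ℕ) % 2 = 1 ∧ (j : ℕ) + 1 = i then 1 else 0

theorem det_pairRowOp {R : Type*} [CommRing R] (n : ℕ) (ε : R) : (pairRowOp n ε).det = ε ^ n := by
  rw [Matrix.det_of_isLowerTriangular, prod_pairs]
  · rw [Finset.prod_congr rfl (g := fun _ => ε), Finset.prod_const, Finset.card_univ,
      Fintype.card_fin]
    intro k _
    rw [pairRowOp, Matrix.of_apply, Matrix.of_apply, if_pos rfl, if_pos rfl, evenIdx, oddIdx,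
      if_pos (by simp), if_neg (by simp only; omega), one_mul]
  · intro i j hij
    have hij : i < j := hij
    have := Fin.lt_def.mp hij
    rw [pairRowOp, Matrix.of_apply, if_neg hij.ne, if_neg (by omega)]

theorem pairRowOp_mul_even {R : Type*} [CommRing R] (ε : R)
    (A : Matrix (Fin (2 * n)) (Fin (2 * n)) R) (k : Fin n) (c : Fin (2 * n)) :
    (pairRowOp n ε * A) (evenIdx k) c = A (evenIdx k) c := by
  rw [Matrix.mul_apply, Finset.sum_eq_single (evenIdx k)]
  · rw [pairRowOp, Matrix.of_apply, if_pos rfl, evenIdx, if_pos (by simp), one_mul]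
  · intro j _ hj
    rw [pairRowOp, Matrix.of_apply, if_neg hj.symm, evenIdx, if_neg (by simp only; omega), zero_mul]
  · simp

theorem pairRowOp_mul_odd {R : Type*} [CommRing R] (ε : R)
    (A : Matrix (Fin (2 * n)) (Fin (2 * n)) R) (k : Fin n) (c : Fin (2 * n)) :
    (pairRowOp n ε * A) (oddIdx k) c = A (evenIdx k) c + ε * A (oddIdx k) c := by
  rw [Matrix.mul_apply, Finset.sum_eq_add (evenIdx k) (oddIdx k) (evenIdx_ne_oddIdx k k)]
  · have h0 : pairRowOp n ε (oddIdx k) (evenIdx k) = 1 := by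
      rw [pairRowOp, Matrix.of_apply, if_neg (evenIdx_ne_oddIdx k k).symm, if_pos]
      change (2 * (k : ℕ) + 1) % 2 = 1 ∧ 2 * (k : ℕ) + 1 = 2 * (k : ℕ) + 1
      omega
    have h1 : pairRowOp n ε (oddIdx k) (oddIdx k) = ε := by
      rw [pairRowOp, Matrix.of_apply, if_pos rfl, if_neg]
      change ¬(2 * (k : ℕ) + 1) % 2 = 0
      omega
    rw [h0, h1, one_mul]
  · intro j _ hj
    rw [pairRowOp, Matrix.of_apply, if_neg hj.2.symm, if_neg, zero_mul]
    rintro ⟨-, h⟩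
    apply hj.1
    ext
    simp only [evenIdx, oddIdx] at h ⊢
    omega
  · simp
  · simp

theorem det_confluent {R : Type*} [CommRing R] [IsDomain R] (z : Fin n → R) :
    (confluent z).det = (∏ k, ∏ l ∈ Finset.Ioi k, (z l - z k)) ^ 4 := by
  set ε : Polynomial R := Polynomial.X
  set y : Fin n → Polynomial R := fun k => Polynomial.C (z k)
  set w : Fin (2 * n) → Polynomial R := fun i =>
    y ((pairEquiv n).symm i).1 + if ((pairEquiv n).symm i).2 = 0 then 0 else ε with hw
  have hw0 : ∀ k, w (evenIdx k) = y k := by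
    intro k
    simp only [hw]
    rw [← pairEquiv_zero, Equiv.symm_apply_apply, if_pos rfl, add_zero]
  have hw1 : ∀ k, w (oddIdx k) = y k + ε := by
    intro k
    simp only [hw]
    rw [← pairEquiv_one, Equiv.symm_apply_apply, if_neg (by simp)]
  set A : Matrix (Fin (2 * n)) (Fin (2 * n)) (Polynomial R) := Matrix.of fun i j =>
    if ((pairEquiv n).symm i).2 = 0 then y ((pairEquiv n).symm i).1 ^ (j : ℕ)
    else ∑ a ∈ Finset.range (j : ℕ), (y ((pairEquiv n).symm i).1 + ε) ^ a *
      y ((pairEquiv n).symm i).1 ^ ((j : ℕ) - 1 - a) with hA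
  have hA0 : ∀ k c, A (evenIdx k) c = y k ^ (c : ℕ) := by
    intro k c
    rw [hA, Matrix.of_apply, ← pairEquiv_zero, Equiv.symm_apply_apply, if_pos rfl]
  have hA1 : ∀ k (c : Fin (2 * n)), A (oddIdx k) c = ∑ a ∈ Finset.range (c : ℕ), (y k + ε) ^ a *
      y k ^ ((c : ℕ) - 1 - a) := by
    intro k c
    rw [hA, Matrix.of_apply, ← pairEquiv_one, Equiv.symm_apply_apply, if_neg (by simp)]
  have hV : pairRowOp n ε * A = Matrix.vandermonde w := by
    ext1 i c
    refine forall_pairs (P := fun i => (pairRowOp n ε * A) i c = Matrix.vandermonde w i c) ?_ ?_ i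
    · intro k
      rw [pairRowOp_mul_even, hA0, Matrix.vandermonde_apply, hw0]
    · intro k
      rw [pairRowOp_mul_odd, hA0, hA1, Matrix.vandermonde_apply, hw1]
      have := (Commute.all (y k + ε) (y k)).geom_sum₂_mul (c : ℕ)
      rw [add_sub_cancel_left] at this
      rw [mul_comm ε, this]
      ring
  have h1 := congrArg Matrix.det hV
  rw [Matrix.det_mul, det_pairRowOp, det_vandermonde_pairs w y ε hw0 hw1] at h1
  have h2 := mul_left_cancel₀ (pow_ne_zero n Polynomial.X_ne_zero) h1
  have h3 := congrArg (Polynomial.evalRingHom (0 : R)) h2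
  rw [RingHom.map_det] at h3
  have h4 : (Polynomial.evalRingHom (0 : R)).mapMatrix A = confluent z := by
    ext1 i c
    rw [RingHom.mapMatrix_apply, Matrix.map_apply]
    refine forall_pairs (P := fun i => Polynomial.evalRingHom (0 : R) (A i c) = confluent z i c)
      ?_ ?_ i
    · intro k
      rw [hA0, confluent_even]
      simp [y]
    · intro k
      rw [hA1, confluent_odd, map_sum]
      have h5 : ∀ a ∈ Finset.range (c : ℕ), Polynomial.evalRingHom (0 : R) ((y k + ε) ^ a *
          y k ^ ((c : ℕ) - 1 - a)) = z k ^ ((c : ℕ) - 1) := by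
        intro a ha
        have ha := Finset.mem_range.mp ha
        simp only [Polynomial.coe_evalRingHom, Polynomial.eval_mul, Polynomial.eval_pow,
          Polynomial.eval_add, Polynomial.eval_C, Polynomial.eval_X, add_zero, y, ε]
        rw [← pow_add]
        congr 1
        omega
      rw [Finset.sum_congr rfl h5, Finset.sum_const, Finset.card_range, nsmul_eq_mul]
  rw [h4] at h3
  rw [h3, map_prod, ← Finset.prod_pow]
  refine Finset.prod_congr rfl fun k _ => ?_
  rw [map_prod, ← Finset.prod_pow]
  refine Finset.prod_congr rfl fun l _ => ?_
  simp only [Polynomial.coe_evalRingHom, Polynomial.eval_mul, Polynomial.eval_pow,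
    Polynomial.eval_add, Polynomial.eval_sub, Polynomial.eval_C, Polynomial.eval_X, y, ε]
  ring

end Confluent

/-! ### The integral -/

section Integral

theorem deltaIntegral_sum_prod {ι : Type*} (s : Finset ι) (m n : ℕ) (c : ι → ℂ)
    (φ : ι → Fin n → ℝ → ℂ) (hφ : ∀ j ∈ s, ∀ k, AnalyticAt ℝ (φ j k) 0) :
    deltaIntegral m n (fun z => ∑ j ∈ s, c j * ∏ k, φ j k (z k)) =
      ∑ j ∈ s, c j * ∏ k, ((-1) ^ m * iteratedDeriv m (φ j k) 0) := by
  induction n generalizing c with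
  | zero => simp [deltaIntegral]
  | succ n ih =>
    rw [deltaIntegral]
    have h1 : ∀ u : ℝ, (deltaIntegral m n fun w => ∑ j ∈ s, c j * ∏ k, φ j k ((Fin.cons u w : Fin (n + 1) → ℝ) k)) =
        ∑ j ∈ s, (c j * ∏ k : Fin n, ((-1) ^ m * iteratedDeriv m (φ j k.succ) 0)) * φ j 0 u := by
      intro u
      have h2 := ih (fun j => c j * φ j 0 u) (fun j k => φ j k.succ) (fun j hj k => hφ j hj k.succ)
      have h3 : (fun w : Fin n → ℝ => ∑ j ∈ s, c j * ∏ k, φ j k ((Fin.cons u w : Fin (n + 1) → ℝ) k)) =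
          fun w => ∑ j ∈ s, c j * φ j 0 u * ∏ k : Fin n, φ j k.succ (w k) := by
        funext w
        refine Finset.sum_congr rfl fun j _ => ?_
        rw [Fin.prod_univ_succ, Fin.cons_zero, mul_assoc]
        simp only [Fin.cons_succ]
      rw [h3, h2]
      refine Finset.sum_congr rfl fun j _ => ?_
      ring
    simp only [h1]
    rw [iteratedDeriv_fun_sum, Finset.mul_sum]
    · refine Finset.sum_congr rfl fun j hj => ?_
      rw [iteratedDeriv_const_mul_field, Fin.prod_univ_succ]
      ring
    · intro j hj
      exact contDiffAt_const.mul (hφ j hj 0).contDiffAt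

theorem symplecticIntegrand_eq (n : ℕ) (t : ℕ+ → ℂ) (z : Fin n → ℝ) :
    symplecticIntegrand n t z = ∑ σ : Equiv.Perm (Fin (2 * n)), ((Equiv.Perm.sign σ : ℤ) : ℂ) *
      ∏ k, ((σ (oddIdx k) : ℕ) *
        ((z k : ℝ) : ℂ) ^ ((σ (evenIdx k) : ℕ) + ((σ (oddIdx k) : ℕ) - 1)) *
        Complex.exp (2 * ∑' i : ℕ+, t i * ((z k : ℝ) : ℂ) ^ (i : ℕ))) := by
  have h1 := det_confluent (fun k => ((z k : ℝ) : ℂ))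
  rw [symplecticIntegrand, ← h1, ← Matrix.det_transpose, Matrix.det_apply', Finset.sum_mul]
  refine Finset.sum_congr rfl fun σ _ => ?_
  rw [mul_assoc]
  congr 1
  rw [prod_pairs, ← Finset.prod_mul_distrib]
  refine Finset.prod_congr rfl fun k _ => ?_
  rw [Matrix.transpose_apply, Matrix.transpose_apply, confluent_even, confluent_odd, pow_add]
  ring

theorem iteratedDeriv_integrand {f : ℝ → ℂ} {F : ℂ⟦X⟧} (hf : HasTaylor f F) {N : ℕ} (hN : 2 ≤ N)
    (a b : ℕ) : iteratedDeriv (N - 2) (fun u : ℝ => (b : ℂ) * (u : ℂ) ^ (a + (b - 1)) * f u) 0 =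
      (N - 2).factorial * (b * coeffZ F ((N : ℤ) - a - b - 1)) := by
  rw [((hasTaylor_const_mul_pow (b : ℂ) (a + (b - 1))).mul hf).iteratedDeriv_eq, mul_assoc,
    PowerSeries.coeff_C_mul, PowerSeries.coeff_X_pow_mul']
  rcases Nat.eq_zero_or_pos b with rfl | hb
  · simp
  · split_ifs with h
    · rw [← coeffZ_natCast]
      congr 3
      omega
    · rw [coeffZ_of_neg _ (by omega)]

theorem integral_eq_tau {N n : ℕ} {b : ℕ → ℂ} (hN : 2 ≤ N) (hn : 2 * n ≤ N)
    (hb : ∀ i, i < N / 2 → b i = if Even N then 2 * (i : ℂ) + 1 else 2 * (i : ℂ) + 2)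
    {t : ℕ+ → ℂ} (ht : ∃ r : ℝ, 0 < r ∧ Summable fun i : ℕ+ => ‖t i‖ * r ^ (i : ℕ)) :
    (1 / (n.factorial : ℂ)) * deltaIntegral (N - 2) n (symplecticIntegrand n t) =
      ((-1) ^ N * ((N - 2).factorial : ℂ)) ^ n * tau hn b t := by
  have hE := hasTaylor_exp_times ht
  set G := timeExp fun r => 2 * t r with hG
  set B : Matrix (Fin (2 * n)) (Fin (2 * n)) ℂ := Matrix.of fun i j =>
    ((j : ℕ) : ℂ) * coeffZ G ((N : ℤ) - (i : ℕ) - (j : ℕ) - 1) with hB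
  have h1 : deltaIntegral (N - 2) n (symplecticIntegrand n t) =
      ((-1) ^ N * ((N - 2).factorial : ℂ)) ^ n * pfSum B := by
    have h2 : symplecticIntegrand n t = fun z => ∑ σ : Equiv.Perm (Fin (2 * n)),
        ((Equiv.Perm.sign σ : ℤ) : ℂ) * ∏ k, (fun u : ℝ => ((σ (oddIdx k) : ℕ) : ℂ) *
          (u : ℂ) ^ ((σ (evenIdx k) : ℕ) + ((σ (oddIdx k) : ℕ) - 1)) *
          Complex.exp (2 * ∑' i : ℕ+, t i * (u : ℂ) ^ (i : ℕ))) (z k) :=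
      funext fun z => symplecticIntegrand_eq n t z
    rw [h2, deltaIntegral_sum_prod univ (N - 2) n
      (fun σ : Equiv.Perm (Fin (2 * n)) => ((Equiv.Perm.sign σ : ℤ) : ℂ))
      (fun σ k => fun u : ℝ => ((σ (oddIdx k) : ℕ) : ℂ) *
          (u : ℂ) ^ ((σ (evenIdx k) : ℕ) + ((σ (oddIdx k) : ℕ) - 1)) *
          Complex.exp (2 * ∑' i : ℕ+, t i * (u : ℂ) ^ (i : ℕ)))
      (fun σ _ k => ((hasTaylor_const_mul_pow _ _).mul hE).analytic)]
    rw [pfSum, pfMulti, Finset.mul_sum]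
    refine Finset.sum_congr rfl fun σ _ => ?_
    rw [mul_left_comm]
    congr 1
    have h3 : ((-1) ^ N * ((N - 2).factorial : ℂ)) ^ n =
        ∏ _k : Fin n, ((-1) ^ N * ((N - 2).factorial : ℂ)) := by simp
    rw [h3, ← Finset.prod_mul_distrib]
    refine Finset.prod_congr rfl fun k _ => ?_
    rw [iteratedDeriv_integrand hE hN, hB, Matrix.of_apply]
    have h4 : (-1 : ℂ) ^ N = (-1) ^ (N - 2) := by
      conv_lhs => rw [show N = (N - 2) + 2 by omega, pow_add]
      simp
    rw [h4]
    ring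
  have h5 : (Matrix.of fun i j : Fin (2 * n) => (((j : ℕ) : ℂ) - ((i : ℕ) : ℂ)) *
        elemSchur (fun r => 2 * t r) ((N : ℤ) - (i : ℕ) - (j : ℕ) - 1)) = B - Bᵀ := by
    ext i j
    rw [Matrix.sub_apply, Matrix.transpose_apply, hB, Matrix.of_apply, Matrix.of_apply,
      Matrix.of_apply, elemSchur_eq, ← hG, sub_mul,
      show (N : ℤ) - (j : ℕ) - (i : ℕ) - 1 = (N : ℤ) - (i : ℕ) - (j : ℕ) - 1 by ring]
  rw [h1, tau_eq_pfaffian hn hb, h5, pfaffian_eq, pfSum_sub_transpose]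
  have h6 : (n.factorial : ℂ) ≠ 0 := by exact_mod_cast n.factorial_ne_zero
  have h7 : (2 : ℂ) ^ n ≠ 0 := pow_ne_zero _ two_ne_zero
  field_simp

end Integral

end PfaffLattice

theorem proposition7p1 (N n : ℕ) (hN : 2 ≤ N) (hn : 2 * n ≤ N) (b : ℕ → ℂ)
    (hb : ∀ i, i < N / 2 → b i = if Even N then 2 * (i : ℂ) + 1 else 2 * (i : ℂ) + 2) :
    -- the initial condition `m_N(0)`
    (∀ i j : Fin N, initialMoment N b i j =
      if (i : ℕ) + j + 1 = N then ((j : ℕ) : ℂ) - ((i : ℕ) : ℂ) else 0) ∧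
    -- `m_ℓ(t)` is the upper left corner of `m_N(t) = ((j - i) s_{N-i-j-1}(2t))`
    (∀ (ℓ : ℕ) (hℓ : ℓ ≤ N) (t : ℕ+ → ℂ), moment hℓ b t =
      Matrix.of fun i j : Fin ℓ => (((j : ℕ) : ℂ) - ((i : ℕ) : ℂ)) *
        elemSchur (fun r => 2 * t r) ((N : ℤ) - (i : ℕ) - (j : ℕ) - 1)) ∧
    (∀ t : ℕ+ → ℂ, tau hn b t =
      ∑ lam ∈ selfDual (2 * n) (n * (N - 2 * n)),
        (∏ i : Fin n, b (shiftedPart lam (firstHalf i) - ((N + 1) / 2 : ℕ)).toNat) *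
          schur lam t) ∧
    (∀ t : ℕ+ → ℂ, tau hn b t =
      ∑ lam ∈ selfDual (2 * n) (n * (N - 2 * n)),
        (∏ i : Fin n, ((shiftedPart lam (firstHalf i) -
          shiftedPart lam (firstHalf i).rev : ℤ) : ℂ)) * schur lam t) ∧
    (∀ t : ℕ+ → ℂ, tau hn b t =
      pfaffian (Matrix.of fun i j : Fin (2 * n) => (((j : ℕ) : ℂ) - ((i : ℕ) : ℂ)) *
        elemSchur (fun r => 2 * t r) ((N : ℤ) - (i : ℕ) - (j : ℕ) - 1))) ∧
    -- the Jack polynomial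
    (∃ J : SymmFun, IsJack (1 / 2) (rectangle n (N - 2 * n)) J ∧
      (∀ P, IsJackFamily (1 / 2) P → P (n * (N - 2 * n)) (rectangle n (N - 2 * n)) = J) ∧
      ∀ (k : ℕ) (x : Fin k → ℂ),
        tau hn b (fun i => (1 / ((i : ℕ) : ℂ)) * ∑ j, x j ^ (i : ℕ)) =
          (∏ i : Fin n, ((N : ℂ) - 1 - 2 * ((i : ℕ) : ℂ))) * evalSymm J x) ∧
    -- the integral
    (∀ t : ℕ+ → ℂ, (∃ r : ℝ, 0 < r ∧ Summable fun i : ℕ+ => ‖t i‖ * r ^ (i : ℕ)) →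
      (1 / (n.factorial : ℂ)) * deltaIntegral (N - 2) n (symplecticIntegrand n t) =
        ((-1) ^ N * ((N - 2).factorial : ℂ)) ^ n * tau hn b t) := by
  refine ⟨fun i j => initialMoment_apply b hb i j, fun ℓ hℓ t => moment_eq hℓ b hb t, fun t => ?_,
    fun t => tau_eq_sum_schur hn hb t, fun t => tau_eq_pfaffian hn hb t,
    ⟨rectangleJack n N, isJack_rectangleJack hn,
      fun P hP => (isJack_rectangleJack hn).eq_of_isJackFamily (by norm_num) hP,
      fun k x => tau_eq_evalSymm hn hb x⟩, fun t ht => integral_eq_tau hN hn hb ht⟩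
  rw [tau_eq_sum_schur hn hb]
  refine Finset.sum_congr rfl fun lam hlam => ?_
  rw [Finset.prod_congr rfl fun i _ => b_shiftedPart hn hb hlam i]
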